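/- Let $N>2$ and let $\Omega\subset\mathbb{R}^N$ be a smooth bounded domain. Let $g,F\in C([0,\infty);[0,\infty))\cap C^1((0,\infty);(0,\infty))$ with $g(0)=F(0)=0$ satisfy, for all $t>0$, $$0<\delta_0\le \frac{t g'(t)}{g(t)}\le g_0,\qquad 1+\theta_0\le \frac{tF'(t)}{F(t)}\le 1+f_0,$$ where $\delta_0,g_0,\theta_0,f_0$ are real constants with $1+\delta_0<N$ and $0<1+\theta_0\le 1+f_0\le \frac{N(1+\delta_0)}{N-(1+\delta_0)}$. Put $G(t)=\int_0^t g(s)\,ds$. Let $L^G(\Omega)$ be the Orlicz space with the Luxemburg norm $\|u\|_{L^G(\Omega)}=\inf\{k>0:\int_\Omega G(|u|/k)\,dx\le 1\}$, let $W^{1,G}(\Omega)$ be the space of weakly differentiable $u\in L^G(\Omega)$ with $|\nabla u|\in L^G(\Omega)$, normed by $\|u\|_{L^G(\Omega)}+\|\nabla u\|_{L^G(\Omega)}$, and let $W^{1,G}_0(\Omega)$ be the closure of $C_c^\infty(\Omega)$ in $W^{1,G}(\Omega)$. Let $q\in L^\infty(\Omega)$ with $q\not\equiv 0$, let $\lambda_+\ge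 0$ be a constant, and let $\varphi\in W^{1,G}(\Omega)\cap L^\infty(\Omega)$. Set $\mathcal K=\{v\in W^{1,G}(\Omega): v-\varphi\in W^{1,G}_0(\Omega)\}$ and $$\mathcal J(v)=\int_\Omega\big(G(|\nabla v|)+qF(v^+)+hv+\lambda_+\chi_{\{v>0\}}\big)\,dx,\qquad v^+=\max\{v,0\}.$$ Assume that $h\in L^\infty(\Omega)$ with $h\le 0$ a.e. in $\Omega$, and that $\varphi\ge 0$ on $\partial\Omega$ in the sense of trace, that is, the trace of $\varphi$ in $L^1(\partial\Omega)$ is non-negative almost everywhere with respect to the $(N-1)$-dimensional Hausdorff measure on $\partial\Omega$. Then every minimizer $u$ of $\mathcal J$ over $\mathcal K$ is non-negative in $\Omega$, that is, $u\ge 0$ a.e. in $\Omega$. -/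

import Mathlib

open MeasureTheory Filter Topology
open scoped ENNReal ContDiff

noncomputable section

namespace OrliczFreeBoundary

/-! ### Domains -/

/-- The boundary of `Ω` is smooth: near each boundary point, `Ω` is the sublevel set `{ρ < 0}` of a
smooth function `ρ` whose differential does not vanish at that point. -/
def HasSmoothBoundary {N : ℕ} (Ω : Set (EuclideanSpace ℝ (Fin N))) : Prop :=
  ∀ x ∈ frontier Ω, ∃ (U : Set (EuclideanSpace ℝ (Fin N))) (ρ : EuclideanSpace ℝ (Fin N) → ℝ),
    IsOpen U ∧ x ∈ U ∧ ContDiffOn ℝ ∞ ρ U ∧ fderiv ℝ ρ x ≠ 0 ∧ Ω ∩ U = {y ∈ U | ρ y < 0}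

/-- A smooth bounded domain (`IsConnected` includes non-emptiness). -/
structure IsSmoothBoundedDomain {N : ℕ} (Ω : Set (EuclideanSpace ℝ (Fin N))) : Prop where
  isOpen : IsOpen Ω
  isConnected : IsConnected Ω
  isBounded : Bornology.IsBounded Ω
  smoothBoundary : HasSmoothBoundary Ω

/-! ### Structural conditions -/

/-- `k ∈ C([0,∞);[0,∞)) ∩ C¹((0,∞);(0,∞))`, `k 0 = 0` and `a ≤ t k'(t) / k(t) ≤ b` for `t > 0`.
Only the values of `k` on `[0,∞)` matter. -/
structure LiebermanCondition (k : ℝ → ℝ) (a b : ℝ) : Prop where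
  continuousOn : ContinuousOn k (Set.Ici 0)
  contDiffOn : ContDiffOn ℝ 1 k (Set.Ioi 0)
  map_zero : k 0 = 0
  pos : ∀ t : ℝ, 0 < t → 0 < k t
  lower : ∀ t : ℝ, 0 < t → a ≤ t * deriv k t / k t
  upper : ∀ t : ℝ, 0 < t → t * deriv k t / k t ≤ b

/-- `G(t) = ∫₀ᵗ g(s) ds`. -/
def primitive (g : ℝ → ℝ) (t : ℝ) : ℝ := ∫ s in (0 : ℝ)..t, g s

/-! ### Orlicz spaces -/

/-- The Luxemburg norm `inf {k > 0 : ∫ G(|f| / k) dμ ≤ 1}`, with value `∞` if there is no such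
`k`. -/
def luxemburgNorm {α E : Type*} [MeasurableSpace α] [NormedAddCommGroup E]
    (G : ℝ → ℝ) (f : α → E) (μ : Measure α) : ℝ≥0∞ :=
  ⨅ (k : ℝ) (_ : 0 < k) (_ : ∫⁻ x, ENNReal.ofReal (G (‖f x‖ / k)) ∂μ ≤ 1), ENNReal.ofReal k

/-- Membership in the Orlicz space `L^G(μ)`, the linear hull of the functions `f` for which
`∫ G(|f|) dμ < ∞`. -/
def MemOrlicz {α E : Type*} [MeasurableSpace α] [NormedAddCommGroup E]
    (G : ℝ → ℝ) (f : α → E) (μ : Measure α) : Prop :=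
  AEStronglyMeasurable f μ ∧ luxemburgNorm G f μ < ⊤

/-! ### Weak gradients and Orlicz–Sobolev spaces -/

/-- `C_c^∞(Ω)`. -/
def testFunctions {N : ℕ} (Ω : Set (EuclideanSpace ℝ (Fin N))) :
    Set (EuclideanSpace ℝ (Fin N) → ℝ) :=
  {η | ContDiff ℝ ∞ η ∧ HasCompactSupport η ∧ tsupport η ⊆ Ω}

/-- `V` is a weak gradient of `u` in `Ω`. -/
structure HasWeakGradient {N : ℕ} (Ω : Set (EuclideanSpace ℝ (Fin N)))
    (u : EuclideanSpace ℝ (Fin N) → ℝ)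
    (V : EuclideanSpace ℝ (Fin N) → EuclideanSpace ℝ (Fin N)) : Prop where
  locallyIntegrableOn : LocallyIntegrableOn u Ω
  locallyIntegrableOn_grad : LocallyIntegrableOn V Ω
  integral_eq : ∀ η ∈ testFunctions Ω, ∀ i : Fin N,
    ∫ x in Ω, u x * fderiv ℝ η x (EuclideanSpace.single i 1) = -∫ x in Ω, V x i * η x

/-- `u` is weakly differentiable in `Ω`. -/
def WeaklyDifferentiable {N : ℕ} (Ω : Set (EuclideanSpace ℝ (Fin N)))
    (u : EuclideanSpace ℝ (Fin N) → ℝ) : Prop :=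
  ∃ V, HasWeakGradient Ω u V

open Classical in
/-- The weak gradient `∇u` in `Ω`, unique up to null sets for open `Ω` (zero if `u` is not weakly
differentiable). -/
def weakGradient {N : ℕ} (Ω : Set (EuclideanSpace ℝ (Fin N)))
    (u : EuclideanSpace ℝ (Fin N) → ℝ) : EuclideanSpace ℝ (Fin N) → EuclideanSpace ℝ (Fin N) :=
  if hu : WeaklyDifferentiable Ω u then hu.choose else 0

/-- The Orlicz–Sobolev space `W^{1,G}(Ω)`. -/
def orliczSobolev {N : ℕ} (G : ℝ → ℝ) (Ω : Set (EuclideanSpace ℝ (Fin N))) :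
    Set (EuclideanSpace ℝ (Fin N) → ℝ) :=
  {u | WeaklyDifferentiable Ω u ∧ MemOrlicz G u (volume.restrict Ω) ∧
    MemOrlicz G (weakGradient Ω u) (volume.restrict Ω)}

/-- The norm of `W^{1,G}(Ω)`. -/
def orliczSobolevNorm {N : ℕ} (G : ℝ → ℝ) (Ω : Set (EuclideanSpace ℝ (Fin N)))
    (u : EuclideanSpace ℝ (Fin N) → ℝ) : ℝ≥0∞ :=
  luxemburgNorm G u (volume.restrict Ω) +
    luxemburgNorm G (weakGradient Ω u) (volume.restrict Ω)

/-- `W^{1,G}_0(Ω)`, the closure of `C_c^∞(Ω)` in `W^{1,G}(Ω)`. -/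
def orliczSobolevZero {N : ℕ} (G : ℝ → ℝ) (Ω : Set (EuclideanSpace ℝ (Fin N))) :
    Set (EuclideanSpace ℝ (Fin N) → ℝ) :=
  {u | u ∈ orliczSobolev G Ω ∧
    ∃ η : ℕ → EuclideanSpace ℝ (Fin N) → ℝ, (∀ n, η n ∈ testFunctions Ω) ∧
      Tendsto (fun n => orliczSobolevNorm G Ω (u - η n)) atTop (𝓝 0)}

/-! ### Traces -/

/-- Surface measure on `∂Ω` (the `(N-1)`-dimensional Hausdorff measure). -/
def surfaceMeasure {N : ℕ} (Ω : Set (EuclideanSpace ℝ (Fin N))) :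
    Measure (EuclideanSpace ℝ (Fin N)) :=
  (Measure.hausdorffMeasure ((N : ℝ) - 1)).restrict (frontier Ω)

/-- `T ∈ L¹(∂Ω)` is the boundary trace of `u ∈ W^{1,1}(Ω)`. The trace operator is the continuous
extension to `W^{1,1}(Ω)`, with values in `L¹(∂Ω)`, of the restriction `ψ ↦ ψ|_{∂Ω}` of functions
`ψ` that are smooth up to the boundary: `T` is the limit in `L¹(∂Ω)` of the boundary values of such
functions converging to `u` in `W^{1,1}(Ω)`. -/
def IsTrace {N : ℕ} (Ω : Set (EuclideanSpace ℝ (Fin N)))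
    (u T : EuclideanSpace ℝ (Fin N) → ℝ) : Prop :=
  WeaklyDifferentiable Ω u ∧ MemLp u 1 (volume.restrict Ω) ∧
  MemLp (weakGradient Ω u) 1 (volume.restrict Ω) ∧ MemLp T 1 (surfaceMeasure Ω) ∧
  ∃ ψ : ℕ → EuclideanSpace ℝ (Fin N) → ℝ, (∀ n, ContDiff ℝ ∞ (ψ n)) ∧
    Tendsto (fun n => eLpNorm (ψ n - u) 1 (volume.restrict Ω)) atTop (𝓝 0) ∧
    Tendsto (fun n => eLpNorm (gradient (ψ n) - weakGradient Ω u) 1 (volume.restrict Ω))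
      atTop (𝓝 0) ∧
    Tendsto (fun n => eLpNorm (ψ n - T) 1 (surfaceMeasure Ω)) atTop (𝓝 0)

/-- `u ≥ 0` on `∂Ω` in the sense of trace. -/
def NonnegOnBoundary {N : ℕ} (Ω : Set (EuclideanSpace ℝ (Fin N)))
    (u : EuclideanSpace ℝ (Fin N) → ℝ) : Prop :=
  ∃ T, IsTrace Ω u T ∧ ∀ᵐ x ∂(surfaceMeasure Ω), 0 ≤ T x

/-! ### The minimum problem -/

/-- `𝒦 = {v ∈ W^{1,G}(Ω) : v - φ ∈ W^{1,G}_0(Ω)}`. -/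
def admissible {N : ℕ} (G : ℝ → ℝ) (Ω : Set (EuclideanSpace ℝ (Fin N)))
    (φ : EuclideanSpace ℝ (Fin N) → ℝ) : Set (EuclideanSpace ℝ (Fin N) → ℝ) :=
  {v | v ∈ orliczSobolev G Ω ∧ v - φ ∈ orliczSobolevZero G Ω}

/-- `J(u) = ∫_Ω (G(|∇u|) + q F(u⁺) + h u + λ₊ χ_{u > 0}) dx`. -/
def energy {N : ℕ} (Ω : Set (EuclideanSpace ℝ (Fin N))) (G F : ℝ → ℝ)
    (q h : EuclideanSpace ℝ (Fin N) → ℝ) (lam : ℝ) (u : EuclideanSpace ℝ (Fin N) → ℝ) : ℝ :=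
  ∫ x in Ω, (G ‖weakGradient Ω u x‖ + q x * F (max (u x) 0) + h x * u x
    + lam * Set.indicator {y | 0 < u y} (fun _ => (1 : ℝ)) x)

/-- `u` minimizes `J` over `𝒦`. -/
def IsMinimizer {N : ℕ} (Ω : Set (EuclideanSpace ℝ (Fin N))) (G F : ℝ → ℝ)
    (q h : EuclideanSpace ℝ (Fin N) → ℝ) (lam : ℝ) (φ u : EuclideanSpace ℝ (Fin N) → ℝ) : Prop :=
  u ∈ admissible G Ω φ ∧ IsMinOn (energy Ω G F q h lam) (admissible G Ω φ) u

end OrliczFreeBoundary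

end

/-! The competitor is the positive part `u + u⁻`. Replacing `u` by it leaves the `F` term and the
`χ` term unchanged, so the energy drops by the integral over `{u < 0}` of `G(|∇u|) + h u`. Both
summands are non-negative there because `h ≤ 0`. Minimality forces this integral to vanish, so `∇u =
0` a.e. on `{u < 0}`. Then `u⁻`, extended by zero, has zero weak gradient on the whole space and
compact support, hence is zero.

The comparison needs `u⁻ ∈ W^{1,G}_0(Ω)`, although the boundary condition is only an `L¹` trace.
Adding the smooth approximants of `φ` to the test functions approximating `u - φ` gives smooth `ζ n
→ u` in `W^{1,1}(Ω)` whose negative parts tend to zero in `L¹(∂Ω)`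
(`IsGauge.exists_contDiff_tendsto`). Integration by parts for `u⁻` has no boundary term once `∫_Ω ∂ᵢ
f` is bounded by a surface integral of `|f|`. Instead of the divergence theorem,
`enorm_setIntegral_partial_le` uses difference quotients: `Ω` and its translate by `s eᵢ` differ
only at points from which a segment of length `s` in direction `-eᵢ` meets `∂Ω`, and projection
along `eᵢ` does not increase Hausdorff measure. Thus the zero extension of `u⁻` is a Sobolev
function on `ℝᴺ` (`hasWeakGradient_indicator_negPart`).

Smoothness of `∂Ω` then gives a local cone of directions pointing into `Ω` (`exists_inner_cone`).
After localization by cutoffs, mollifying with kernels supported in such a cone moves the support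
inside `Ω`, so the mollifications are test functions (`IsGlobalSobolev.mem_orliczSobolevZero`).

Two facts hold the argument together. The two-sided power scaling of `G` makes Luxemburg convergence
equivalent to modular convergence, so limits can be taken in `∫ G(|f|)`. The Sobolev inequality with
exponent `p = 1 + δ₀` and the bound on `f₀` make every admissible energy density integrable
(`IsGauge.integrableOn_energy`), so energies may be subtracted. -/

noncomputable section

namespace OrliczFreeBoundary

/-! ### Gauges -/

/-- A convex gauge on `[0,∞)` that scales between the powers `p` and `r`. -/
structure IsGauge (G : ℝ → ℝ) (p r : ℝ) : Prop where
  one_le : 1 ≤ p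
  continuousOn : ContinuousOn G (Set.Ici 0)
  map_zero : G 0 = 0
  pos : ∀ t : ℝ, 0 < t → 0 < G t
  mono : MonotoneOn G (Set.Ici 0)
  convex : ConvexOn ℝ (Set.Ici 0) G
  scale_le : ∀ t l : ℝ, 0 ≤ t → 1 ≤ l → G (l * t) ≤ l ^ r * G t
  le_scale : ∀ t l : ℝ, 0 ≤ t → 1 ≤ l → l ^ p * G t ≤ G (l * t)

lemma LiebermanCondition.hasDerivAt {k : ℝ → ℝ} {a b : ℝ} (hk : LiebermanCondition k a b)
    {t : ℝ} (ht : 0 < t) : HasDerivAt k (deriv k t) t :=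
  ((hk.contDiffOn.differentiableOn (by norm_num)).differentiableAt
    (Ioi_mem_nhds ht)).hasDerivAt

/-- The sign of this derivative is the sign of `t k' / k - c`, so the structural bounds say that
`log k - c log t` is monotone for `c = a` and antitone for `c = b`. -/
lemma LiebermanCondition.hasDerivAt_log_sub {k : ℝ → ℝ} {a b : ℝ} (hk : LiebermanCondition k a b)
    (c : ℝ) {t : ℝ} (ht : 0 < t) :
    HasDerivAt (fun t => Real.log (k t) - c * Real.log t) ((t * deriv k t / k t - c) / t) t := by
  have h1 := ((hk.hasDerivAt ht).log (hk.pos t ht).ne').sub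
    ((Real.hasDerivAt_log ht.ne').const_mul c)
  have hk0 := (hk.pos t ht).ne'
  refine h1.congr_deriv ?_
  field_simp

/-- Since `log k - b log t` is antitone on `(0, ∞)`, comparing its values at `t` and `l t` and
exponentiating gives the bound. -/
lemma LiebermanCondition.scale_le {k : ℝ → ℝ} {a b : ℝ} (hk : LiebermanCondition k a b)
    {t l : ℝ} (ht : 0 ≤ t) (hl : 1 ≤ l) : k (l * t) ≤ l ^ b * k t := by
  rcases ht.eq_or_lt with rfl | ht
  · simp [hk.map_zero]
  have hanti : AntitoneOn (fun t => Real.log (k t) - b * Real.log t) (Set.Ioi 0) := by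
    apply antitoneOn_of_deriv_nonpos (convex_Ioi 0)
    · exact fun t ht => (hk.hasDerivAt_log_sub b ht).continuousAt.continuousWithinAt
    · rw [interior_Ioi]
      exact fun t ht => (hk.hasDerivAt_log_sub b ht).differentiableAt.differentiableWithinAt
    · rw [interior_Ioi]
      intro t ht
      rw [(hk.hasDerivAt_log_sub b ht).deriv]
      exact div_nonpos_of_nonpos_of_nonneg (by linarith [hk.upper t ht]) (le_of_lt ht)
  have hl0 : 0 < l := by linarith
  have := hanti (Set.mem_Ioi.2 ht) (Set.mem_Ioi.2 (by positivity : 0 < l * t)) (by nlinarith)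
  simp only [Real.log_mul hl0.ne' ht.ne'] at this
  rw [← Real.log_le_log_iff (hk.pos _ (by positivity))
    (mul_pos (Real.rpow_pos_of_pos hl0 _) (hk.pos t ht)), Real.log_mul
    (Real.rpow_pos_of_pos hl0 _).ne' (hk.pos t ht).ne', Real.log_rpow hl0]
  linarith

lemma LiebermanCondition.le_scale {k : ℝ → ℝ} {a b : ℝ} (hk : LiebermanCondition k a b)
    {t l : ℝ} (ht : 0 ≤ t) (hl : 1 ≤ l) : l ^ a * k t ≤ k (l * t) := by
  rcases ht.eq_or_lt with rfl | ht
  · simp [hk.map_zero]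
  have hmono : MonotoneOn (fun t => Real.log (k t) - a * Real.log t) (Set.Ioi 0) := by
    apply monotoneOn_of_deriv_nonneg (convex_Ioi 0)
    · exact fun t ht => (hk.hasDerivAt_log_sub a ht).continuousAt.continuousWithinAt
    · rw [interior_Ioi]
      exact fun t ht => (hk.hasDerivAt_log_sub a ht).differentiableAt.differentiableWithinAt
    · rw [interior_Ioi]
      intro t ht
      rw [(hk.hasDerivAt_log_sub a ht).deriv]
      exact div_nonneg (by linarith [hk.lower t ht]) (le_of_lt ht)
  have hl0 : 0 < l := by linarith
  have := hmono (Set.mem_Ioi.2 ht) (Set.mem_Ioi.2 (by positivity : 0 < l * t)) (by nlinarith)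
  simp only [Real.log_mul hl0.ne' ht.ne'] at this
  rw [← Real.log_le_log_iff (mul_pos (Real.rpow_pos_of_pos hl0 _) (hk.pos t ht))
    (hk.pos _ (by positivity)), Real.log_mul
    (Real.rpow_pos_of_pos hl0 _).ne' (hk.pos t ht).ne', Real.log_rpow hl0]
  linarith

lemma LiebermanCondition.nonneg {k : ℝ → ℝ} {a b : ℝ} (hk : LiebermanCondition k a b)
    {t : ℝ} (ht : 0 ≤ t) : 0 ≤ k t := by
  rcases ht.eq_or_lt with rfl | ht
  · simp [hk.map_zero]
  · exact (hk.pos t ht).le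

lemma LiebermanCondition.monotoneOn {k : ℝ → ℝ} {a b : ℝ} (hk : LiebermanCondition k a b)
    (ha : 0 ≤ a) : MonotoneOn k (Set.Ici 0) := by
  intro s hs t ht hst
  rcases (Set.mem_Ici.1 hs).eq_or_lt with rfl | hs
  · rw [hk.map_zero]; exact hk.nonneg ht
  have h1 : 1 ≤ t / s := by rwa [le_div_iff₀ hs, one_mul]
  have := hk.le_scale hs.le h1
  rw [div_mul_cancel₀ _ hs.ne'] at this
  exact le_trans (le_mul_of_one_le_left (hk.pos s hs).le (Real.one_le_rpow h1 ha)) this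

/-- Growth of `k` at infinity. -/
lemma LiebermanCondition.le_rpow {k : ℝ → ℝ} {a b : ℝ} (hk : LiebermanCondition k a b)
    (ha : 0 ≤ a) {c : ℝ} (hbc : b ≤ c) {t : ℝ} (ht : 0 ≤ t) : k t ≤ k 1 * (1 + t ^ c) := by
  have hk1 := hk.pos 1 one_pos
  rcases le_total t 1 with h1 | h1
  · refine (hk.monotoneOn ha ht (Set.mem_Ici.2 zero_le_one) h1).trans ?_
    have := Real.rpow_nonneg ht c
    nlinarith
  · have h2 := hk.scale_le zero_le_one h1
    rw [mul_one] at h2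
    have h3 := Real.rpow_le_rpow_of_exponent_le h1 hbc
    nlinarith

lemma LiebermanCondition.intervalIntegrable {k : ℝ → ℝ} {a b : ℝ} (hk : LiebermanCondition k a b)
    {s t : ℝ} (hs : 0 ≤ s) (ht : 0 ≤ t) : IntervalIntegrable k volume s t := by
  apply ContinuousOn.intervalIntegrable
  refine hk.continuousOn.mono fun x hx => ?_
  exact le_trans (le_min hs ht) hx.1

lemma primitive_mul (g : ℝ → ℝ) {l : ℝ} (hl : 0 < l) (t : ℝ) :
    primitive g (l * t) = l * ∫ s in (0 : ℝ)..t, g (l * s) := by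
  simp [primitive, hl.ne']

lemma LiebermanCondition.hasDerivAt_primitive {g : ℝ → ℝ} {a b : ℝ}
    (hg : LiebermanCondition g a b) {t : ℝ} (ht : 0 < t) : HasDerivAt (primitive g) (g t) t := by
  refine intervalIntegral.integral_hasDerivAt_right (hg.intervalIntegrable le_rfl ht.le) ?_
    (hg.hasDerivAt ht).continuousAt
  exact (hg.contDiffOn.continuousOn).stronglyMeasurableAtFilter isOpen_Ioi t ht

/-- The substitution `s ↦ l s` contributes a factor `l`, so both scaling exponents of `g` go up by
one. -/
lemma LiebermanCondition.isGauge_primitive {g : ℝ → ℝ} {a b : ℝ} (hg : LiebermanCondition g a b)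
    (ha : 0 ≤ a) : IsGauge (primitive g) (1 + a) (1 + b) := by
  have hcont : ContinuousOn (primitive g) (Set.Ici 0) := by
    intro t ht
    have h1 : ContinuousOn (fun x => ∫ s in (0 : ℝ)..x, g s) (Set.uIcc 0 (t + 1)) := by
      apply intervalIntegral.continuousOn_primitive_interval
      have := (hg.intervalIntegrable le_rfl (by linarith [Set.mem_Ici.1 ht] : 0 ≤ t + 1))
      rwa [intervalIntegrable_iff_integrableOn_Icc_of_le (by linarith [Set.mem_Ici.1 ht]),
        ← Set.uIcc_of_le (by linarith [Set.mem_Ici.1 ht])] at this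
    rw [Set.uIcc_of_le (by linarith [Set.mem_Ici.1 ht])] at h1
    have h2 := h1 t ⟨ht, by linarith⟩
    refine h2.mono_of_mem_nhdsWithin ?_
    filter_upwards [self_mem_nhdsWithin, mem_nhdsWithin_of_mem_nhds
      (Iio_mem_nhds (lt_add_one t))] with x hx hx2
    exact ⟨hx, le_of_lt hx2⟩
  have hpos : ∀ t : ℝ, 0 < t → 0 < primitive g t := by
    intro t ht
    apply intervalIntegral.intervalIntegral_pos_of_pos_on (hg.intervalIntegrable le_rfl ht.le)
    · exact fun x hx => hg.pos x hx.1
    · exact ht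
  have hmono : MonotoneOn (primitive g) (Set.Ici 0) := by
    apply monotoneOn_of_deriv_nonneg (convex_Ici 0) hcont
    · rw [interior_Ici]
      exact fun t ht => (hg.hasDerivAt_primitive ht).differentiableAt.differentiableWithinAt
    · rw [interior_Ici]
      intro t ht
      rw [(hg.hasDerivAt_primitive ht).deriv]
      exact (hg.pos t ht).le
  have hint : ∀ {t l : ℝ}, 0 ≤ t → 1 ≤ l →
      IntervalIntegrable (fun s => g (l * s)) volume 0 t := by
    intro t l ht hl
    apply ContinuousOn.intervalIntegrable
    refine hg.continuousOn.comp (by fun_prop) fun x hx => ?_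
    rw [Set.uIcc_of_le ht] at hx
    exact mul_nonneg (by linarith) hx.1
  refine ⟨by linarith, hcont, by simp [primitive], hpos, hmono, ?_, ?_, ?_⟩
  -- The derivative of the primitive is `g`, which is monotone because the lower exponent is
  -- non-negative.
  · apply MonotoneOn.convexOn_of_deriv (convex_Ici 0) hcont
    · rw [interior_Ici]
      exact fun t ht => (hg.hasDerivAt_primitive ht).differentiableAt.differentiableWithinAt
    · rw [interior_Ici]
      intro s hs t ht hst
      rw [(hg.hasDerivAt_primitive ht).deriv, (hg.hasDerivAt_primitive hs).deriv]
      exact hg.monotoneOn ha (Set.mem_Ici.2 (le_of_lt hs)) (Set.mem_Ici.2 (le_of_lt ht)) hst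
  · intro t l ht hl
    have hl0 : 0 < l := by linarith
    rw [primitive_mul g hl0, Real.rpow_add hl0, Real.rpow_one, mul_assoc]
    refine mul_le_mul_of_nonneg_left ?_ hl0.le
    rw [primitive, ← intervalIntegral.integral_const_mul]
    exact intervalIntegral.integral_mono_on ht (hint ht hl)
      ((hg.intervalIntegrable le_rfl ht).const_mul _) fun x hx => hg.scale_le hx.1 hl
  · intro t l ht hl
    have hl0 : 0 < l := by linarith
    rw [primitive_mul g hl0, Real.rpow_add hl0, Real.rpow_one, mul_assoc]
    refine mul_le_mul_of_nonneg_left ?_ hl0.le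
    rw [primitive, ← intervalIntegral.integral_const_mul]
    exact intervalIntegral.integral_mono_on ht
      ((hg.intervalIntegrable le_rfl ht).const_mul _) (hint ht hl)
      fun x hx => hg.le_scale hx.1 hl

namespace IsGauge

variable {G : ℝ → ℝ} {p r : ℝ}

lemma nonneg (hG : IsGauge G p r) {t : ℝ} (ht : 0 ≤ t) : 0 ≤ G t := by
  rcases ht.eq_or_lt with rfl | ht
  · simp [hG.map_zero]
  · exact (hG.pos t ht).le

lemma eq_zero (hG : IsGauge G p r) {t : ℝ} (ht : 0 ≤ t) (h : G t = 0) : t = 0 := by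
  by_contra h0
  exact (hG.pos t (lt_of_le_of_ne ht (Ne.symm h0))).ne' h

lemma map_mul_le (hG : IsGauge G p r) {t l : ℝ} (ht : 0 ≤ t) (hl : 0 ≤ l) (hl1 : l ≤ 1) :
    G (l * t) ≤ l * G t := by
  have := hG.convex.2 (Set.mem_Ici.2 ht) (Set.mem_Ici.2 le_rfl) hl (sub_nonneg.2 hl1) (by ring)
  simpa [hG.map_zero] using this

lemma continuous_comp_norm (hG : IsGauge G p r) {E : Type*} [NormedAddCommGroup E] :
    Continuous fun v : E => G ‖v‖ := by
  have := hG.continuousOn.comp_continuous continuous_norm (fun v : E => norm_nonneg v)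
  exact this

/-- The doubling property: `s + t` is at most twice the larger of the two. -/
lemma map_add_le (hG : IsGauge G p r) {s t : ℝ} (hs : 0 ≤ s) (ht : 0 ≤ t) :
    G (s + t) ≤ 2 ^ r * (G s + G t) := by
  have h2 : (0 : ℝ) < 2 ^ r := by positivity
  rcases le_total s t with h | h
  · have h1 := hG.mono (Set.mem_Ici.2 (add_nonneg hs ht))
      (Set.mem_Ici.2 (by linarith : 0 ≤ 2 * t)) (by linarith)
    have h3 := hG.scale_le t 2 ht one_le_two
    have := mul_nonneg h2.le (hG.nonneg hs)
    linarith
  · have h1 := hG.mono (Set.mem_Ici.2 (add_nonneg hs ht))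
      (Set.mem_Ici.2 (by linarith : 0 ≤ 2 * s)) (by linarith)
    have h3 := hG.scale_le s 2 hs one_le_two
    have := mul_nonneg h2.le (hG.nonneg ht)
    linarith

lemma map_norm_add_le (hG : IsGauge G p r) {E : Type*} [NormedAddCommGroup E] (v w : E) :
    G ‖v + w‖ ≤ 2 ^ r * (G ‖v‖ + G ‖w‖) :=
  (hG.mono (norm_nonneg _) (Set.mem_Ici.2 (by positivity)) (norm_add_le v w)).trans
    (hG.map_add_le (norm_nonneg _) (norm_nonneg _))

lemma map_norm_sub_le (hG : IsGauge G p r) {E : Type*} [NormedAddCommGroup E] (v w : E) :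
    G ‖v - w‖ ≤ 2 ^ r * (G ‖v‖ + G ‖w‖) := by
  simpa [sub_eq_add_neg] using hG.map_norm_add_le v (-w)

/-- Growth of order `p` at infinity, the input for the Sobolev inequality; the constant `1` covers
`t ≤ 1`. -/
lemma rpow_le (hG : IsGauge G p r) {t : ℝ} (ht : 0 ≤ t) : t ^ p ≤ 1 + (G 1)⁻¹ * G t := by
  have hG1 := hG.pos 1 one_pos
  have hGt := hG.nonneg ht
  rcases le_total t 1 with h | h
  · have h1 : t ^ p ≤ 1 := Real.rpow_le_one ht h (by linarith [hG.one_le])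
    have : 0 ≤ (G 1)⁻¹ * G t := by positivity
    linarith
  · have := hG.le_scale 1 t zero_le_one h
    rw [mul_one] at this
    have h2 : t ^ p ≤ (G 1)⁻¹ * G t := by
      rw [inv_mul_eq_div, le_div_iff₀ hG1]; exact this
    linarith

/-- For `t ≥ e` the ratio `G t / t` is at least `G e / e`. The free parameter `e` allows modular
convergence to be upgraded to `L¹` convergence on finite measure spaces. -/
lemma le_add (hG : IsGauge G p r) {t e : ℝ} (ht : 0 ≤ t) (he : 0 < e) :
    t ≤ e + (e / G e) * G t := by
  have hGe := hG.pos e he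
  have hGt := hG.nonneg ht
  rcases le_total t e with h | h
  · have : 0 ≤ (e / G e) * G t := by positivity
    linarith
  · have h1 : 1 ≤ t / e := by rwa [le_div_iff₀ he, one_mul]
    have h2 := hG.le_scale e (t / e) he.le h1
    rw [div_mul_cancel₀ _ he.ne'] at h2
    have h3 : t / e ≤ (t / e) ^ p := by
      conv_lhs => rw [← Real.rpow_one (t / e)]
      exact Real.rpow_le_rpow_of_exponent_le h1 hG.one_le
    have h4 : t / e * G e ≤ G t := (mul_le_mul_of_nonneg_right h3 hGe.le).trans h2
    have h5 : t = e / G e * (t / e * G e) := by field_simp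
    have h6 : e / G e * (t / e * G e) ≤ e / G e * G t :=
      mul_le_mul_of_nonneg_left h4 (by positivity)
    linarith

lemma convexOn_norm (hG : IsGauge G p r) {E : Type*} [NormedAddCommGroup E] [NormedSpace ℝ E] :
    ConvexOn ℝ Set.univ fun v : E => G ‖v‖ := by
  refine ⟨convex_univ, fun v _ w _ a b ha hb hab => ?_⟩
  refine (hG.mono (norm_nonneg _) (Set.mem_Ici.2 (by positivity))
    (norm_add_le (a • v) (b • w))).trans ?_
  rw [norm_smul, norm_smul, Real.norm_of_nonneg ha, Real.norm_of_nonneg hb]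
  exact hG.convex.2 (norm_nonneg v) (norm_nonneg w) ha hb hab

end IsGauge

/-! ### Modulars and Luxemburg norms -/

/-- The modular `∫ G(|f|) dμ`. -/
def modular {α E : Type*} [MeasurableSpace α] [NormedAddCommGroup E]
    (G : ℝ → ℝ) (f : α → E) (μ : Measure α) : ℝ≥0∞ :=
  ∫⁻ x, ENNReal.ofReal (G ‖f x‖) ∂μ

variable {α E : Type*} [MeasurableSpace α] [NormedAddCommGroup E] {μ : Measure α}
  {G : ℝ → ℝ} {p r : ℝ}

lemma luxemburgNorm_congr {f g : α → E} (h : f =ᵐ[μ] g) :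
    luxemburgNorm G f μ = luxemburgNorm G g μ := by
  have : ∀ k : ℝ, ∫⁻ x, ENNReal.ofReal (G (‖f x‖ / k)) ∂μ
      = ∫⁻ x, ENNReal.ofReal (G (‖g x‖ / k)) ∂μ := fun k =>
    lintegral_congr_ae (h.mono fun x hx => by simp only [hx])
  simp only [luxemburgNorm, this]

lemma exists_of_luxemburgNorm_lt {f : α → E} {c : ℝ≥0∞} (h : luxemburgNorm G f μ < c) :
    ∃ k : ℝ, 0 < k ∧ ∫⁻ x, ENNReal.ofReal (G (‖f x‖ / k)) ∂μ ≤ 1 ∧ ENNReal.ofReal k < c := by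
  simp only [luxemburgNorm, iInf_lt_iff] at h
  obtain ⟨k, hk, h1, h2⟩ := h
  exact ⟨k, hk, h1, h2⟩

lemma luxemburgNorm_le {f : α → E} {k : ℝ} (hk : 0 < k)
    (h : ∫⁻ x, ENNReal.ofReal (G (‖f x‖ / k)) ∂μ ≤ 1) :
    luxemburgNorm G f μ ≤ ENNReal.ofReal k :=
  iInf_le_of_le k (iInf_le_of_le hk (iInf_le_of_le h le_rfl))

lemma lintegral_ofReal_le_mul {f g : α → ℝ} {c : ℝ} (hc : 0 ≤ c) (h : ∀ x, f x ≤ c * g x) :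
    ∫⁻ x, ENNReal.ofReal (f x) ∂μ ≤ ENNReal.ofReal c * ∫⁻ x, ENNReal.ofReal (g x) ∂μ := by
  rw [← lintegral_const_mul' _ _ ENNReal.ofReal_ne_top]
  refine lintegral_mono fun x => ?_
  rw [← ENNReal.ofReal_mul hc]
  exact ENNReal.ofReal_le_ofReal (h x)

/-- Convexity and `G 0 = 0` give `G(|f|) ≤ k' G(|f| / k')` for any `k' ≤ 1` admitted in the
Luxemburg infimum. -/
lemma IsGauge.modular_le_of_luxemburgNorm_lt (hG : IsGauge G p r) {f : α → E} {k : ℝ}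
    (hk : k ≤ 1) (h : luxemburgNorm G f μ < ENNReal.ofReal k) :
    modular G f μ ≤ ENNReal.ofReal k := by
  obtain ⟨k', hk', h1, h2⟩ := exists_of_luxemburgNorm_lt h
  have h3 : k' < k := (ENNReal.ofReal_lt_ofReal_iff_of_nonneg hk'.le).1 h2
  calc modular G f μ ≤ ENNReal.ofReal k' * ∫⁻ x, ENNReal.ofReal (G (‖f x‖ / k')) ∂μ := by
        refine lintegral_ofReal_le_mul hk'.le fun x => ?_
        have := hG.map_mul_le (t := ‖f x‖ / k') (by positivity) hk'.le (h3.le.trans hk)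
        rwa [mul_div_cancel₀ _ hk'.ne'] at this
    _ ≤ ENNReal.ofReal k' * 1 := by gcongr
    _ ≤ ENNReal.ofReal k := by rw [mul_one]; exact h2.le

/-- Dividing the argument of `G` by `k ≤ 1` costs at most the factor `k⁻¹ ^ r`. This direction
depends on the upper scaling bound. -/
lemma IsGauge.luxemburgNorm_le_of_modular_le (hG : IsGauge G p r) {f : α → E} {k : ℝ}
    (hk : 0 < k) (hk1 : k ≤ 1) (h : modular G f μ ≤ ENNReal.ofReal (k ^ r)) :
    luxemburgNorm G f μ ≤ ENNReal.ofReal k := by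
  refine luxemburgNorm_le hk ?_
  have hkr : 0 < k⁻¹ ^ r := Real.rpow_pos_of_pos (inv_pos.2 hk) _
  calc ∫⁻ x, ENNReal.ofReal (G (‖f x‖ / k)) ∂μ
      ≤ ENNReal.ofReal (k⁻¹ ^ r) * modular G f μ := by
        refine lintegral_ofReal_le_mul hkr.le fun x => ?_
        rw [div_eq_inv_mul]
        exact hG.scale_le _ _ (norm_nonneg _) ((one_le_inv₀ hk).2 hk1)
    _ ≤ ENNReal.ofReal (k⁻¹ ^ r) * ENNReal.ofReal (k ^ r) := by gcongr
    _ = 1 := by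
        rw [← ENNReal.ofReal_mul hkr.le, ← Real.mul_rpow (inv_pos.2 hk).le hk.le,
          inv_mul_cancel₀ hk.ne']
        simp

lemma IsGauge.luxemburgNorm_lt_top_iff (hG : IsGauge G p r) {f : α → E} :
    luxemburgNorm G f μ < ⊤ ↔ modular G f μ < ⊤ := by
  constructor
  · intro h
    obtain ⟨k, hk, h1, -⟩ := exists_of_luxemburgNorm_lt h
    have hm : (1 : ℝ) ≤ max k 1 := le_max_right _ _
    refine lt_of_le_of_lt (lintegral_ofReal_le_mul (c := max k 1 ^ r)
      (g := fun x => G (‖f x‖ / k)) (by positivity) fun x => ?_)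
      (ENNReal.mul_lt_top ENNReal.ofReal_lt_top (h1.trans_lt ENNReal.one_lt_top))
    have hx : 0 ≤ ‖f x‖ / k := by positivity
    refine le_trans (hG.mono (norm_nonneg _) (Set.mem_Ici.2 (by positivity)) ?_)
      (hG.scale_le _ _ hx hm)
    calc ‖f x‖ = k * (‖f x‖ / k) := by field_simp
      _ ≤ max k 1 * (‖f x‖ / k) := by gcongr; exact le_max_left _ _
  · intro h
    set k := max (modular G f μ).toReal 1 with hk
    have hk1 : 1 ≤ k := le_max_right _ _
    have hk0 : 0 < k := by linarith
    refine lt_of_le_of_lt (luxemburgNorm_le hk0 ?_) ENNReal.ofReal_lt_top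
    calc ∫⁻ x, ENNReal.ofReal (G (‖f x‖ / k)) ∂μ ≤ ENNReal.ofReal k⁻¹ * modular G f μ := by
          refine lintegral_ofReal_le_mul (by positivity) fun x => ?_
          rw [div_eq_inv_mul]
          exact hG.map_mul_le (norm_nonneg _) (by positivity) (inv_le_one_of_one_le₀ hk1)
      _ ≤ ENNReal.ofReal k⁻¹ * ENNReal.ofReal k := by
          gcongr
          rw [← ENNReal.ofReal_toReal h.ne]
          exact ENNReal.ofReal_le_ofReal (le_max_left _ _)
      _ = 1 := by
          rw [← ENNReal.ofReal_mul (by positivity), inv_mul_cancel₀ hk0.ne']; simp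

lemma IsGauge.tendsto_luxemburgNorm_iff (hG : IsGauge G p r) {ι : Type*} {l : Filter ι}
    {f : ι → α → E} :
    Tendsto (fun n => luxemburgNorm G (f n) μ) l (𝓝 0) ↔
      Tendsto (fun n => modular G (f n) μ) l (𝓝 0) := by
  have key : ∀ ε : ℝ≥0∞, 0 < ε → ∃ k : ℝ, 0 < k ∧ k ≤ 1 ∧ ENNReal.ofReal k ≤ ε := by
    intro ε hε
    refine ⟨(min ε 1).toReal, ENNReal.toReal_pos (by simp [hε.ne']) (by simp), ?_, ?_⟩
    · exact ENNReal.toReal_le_of_le_ofReal zero_le_one (by simp)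
    · rw [ENNReal.ofReal_toReal (by simp)]; exact min_le_left _ _
  constructor <;> intro h <;> rw [ENNReal.tendsto_nhds_zero] at h ⊢ <;> intro ε hε <;>
    obtain ⟨k, hk, hk1, hkε⟩ := key ε hε
  · filter_upwards [h (ENNReal.ofReal (k / 2)) (by simp [hk])] with n hn
    refine (hG.modular_le_of_luxemburgNorm_lt hk1 (hn.trans_lt ?_)).trans hkε
    exact (ENNReal.ofReal_lt_ofReal_iff hk).2 (by linarith)
  · filter_upwards [h (ENNReal.ofReal (k ^ r)) (by simpa using Real.rpow_pos_of_pos hk r)]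
      with n hn
    exact (hG.luxemburgNorm_le_of_modular_le hk hk1 hn).trans hkε

lemma IsGauge.aemeasurable (hG : IsGauge G p r) {f : α → E} (hf : AEStronglyMeasurable f μ) :
    AEMeasurable (fun x => ENNReal.ofReal (G ‖f x‖)) μ :=
  (hG.continuous_comp_norm.comp_aestronglyMeasurable hf).aemeasurable.ennreal_ofReal

lemma IsGauge.modular_add_le (hG : IsGauge G p r) {f g : α → E}
    (hf : AEStronglyMeasurable f μ) :
    modular G (f + g) μ ≤ ENNReal.ofReal (2 ^ r) * (modular G f μ + modular G g μ) := by
  rw [modular, modular, modular, ← lintegral_add_left' (hG.aemeasurable hf),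
    ← lintegral_const_mul' _ _ ENNReal.ofReal_ne_top]
  refine lintegral_mono fun x => ?_
  rw [← ENNReal.ofReal_add (hG.nonneg (norm_nonneg _)) (hG.nonneg (norm_nonneg _)),
    ← ENNReal.ofReal_mul (by positivity)]
  exact ENNReal.ofReal_le_ofReal (hG.map_norm_add_le _ _)

lemma modular_neg {f : α → E} : modular G (-f) μ = modular G f μ := by
  simp [modular]

lemma IsGauge.modular_mono (hG : IsGauge G p r) {E' : Type*} [NormedAddCommGroup E']
    {f : α → E} {g : α → E'} (h : ∀ᵐ x ∂μ, ‖f x‖ ≤ ‖g x‖) : modular G f μ ≤ modular G g μ :=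
  lintegral_mono_ae (h.mono fun _ hx =>
    ENNReal.ofReal_le_ofReal (hG.mono (norm_nonneg _) (Set.mem_Ici.2 (norm_nonneg _)) hx))

lemma IsGauge.modular_lt_top_of_norm_le (hG : IsGauge G p r) {E' : Type*}
    [NormedAddCommGroup E'] {f : α → E} {g : α → E'} {C : ℝ} (h : ∀ x, ‖f x‖ ≤ C * ‖g x‖)
    (hg : modular G g μ < ⊤) : modular G f μ < ⊤ := by
  refine lt_of_le_of_lt (lintegral_ofReal_le_mul (c := max C 1 ^ r)
    (g := fun x => G ‖g x‖) (by positivity) fun x => ?_)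
    (ENNReal.mul_lt_top ENNReal.ofReal_lt_top hg)
  refine le_trans (hG.mono (norm_nonneg _) (Set.mem_Ici.2 (by positivity)) ?_)
    (hG.scale_le ‖g x‖ (max C 1) (norm_nonneg _) (le_max_right _ _))
  refine (h x).trans ?_
  gcongr
  exact le_max_left _ _

lemma IsGauge.modular_add_lt_top (hG : IsGauge G p r) {f g : α → E}
    (hf : AEStronglyMeasurable f μ) (hf' : modular G f μ < ⊤) (hg' : modular G g μ < ⊤) :
    modular G (f + g) μ < ⊤ :=
  (hG.modular_add_le hf).trans_lt
    (ENNReal.mul_lt_top ENNReal.ofReal_lt_top (ENNReal.add_lt_top.2 ⟨hf', hg'⟩))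

lemma IsGauge.tendsto_modular_add (hG : IsGauge G p r) {ι : Type*} {l : Filter ι}
    {f g : ι → α → E} (hf : ∀ n, AEStronglyMeasurable (f n) μ)
    (hf' : Tendsto (fun n => modular G (f n) μ) l (𝓝 0))
    (hg' : Tendsto (fun n => modular G (g n) μ) l (𝓝 0)) :
    Tendsto (fun n => modular G (f n + g n) μ) l (𝓝 0) := by
  refine tendsto_of_tendsto_of_tendsto_of_le_of_le tendsto_const_nhds ?_ (fun _ => zero_le)
    fun n => hG.modular_add_le (hf n)
  simpa using ENNReal.Tendsto.const_mul (hf'.add hg') (Or.inr ENNReal.ofReal_ne_top)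

lemma modular_mono_measure {ν : Measure α} (h : μ ≤ ν) {f : α → E} :
    modular G f μ ≤ modular G f ν :=
  lintegral_mono' h le_rfl

lemma IsGauge.memOrlicz_iff (hG : IsGauge G p r) {f : α → E} :
    MemOrlicz G f μ ↔ AEStronglyMeasurable f μ ∧ modular G f μ < ⊤ := by
  rw [MemOrlicz, hG.luxemburgNorm_lt_top_iff]

lemma MemOrlicz.congr {f g : α → E} (hf : MemOrlicz G f μ) (h : f =ᵐ[μ] g) :
    MemOrlicz G g μ :=
  ⟨hf.1.congr h, (luxemburgNorm_congr h) ▸ hf.2⟩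

lemma IsGauge.lintegral_enorm_le (hG : IsGauge G p r) {f : α → E} {e : ℝ} (he : 0 < e) :
    ∫⁻ x, ‖f x‖ₑ ∂μ ≤ ENNReal.ofReal e * μ Set.univ +
      ENNReal.ofReal (e / G e) * modular G f μ := by
  rw [modular, ← lintegral_const, ← lintegral_const_mul' _ _ ENNReal.ofReal_ne_top,
    ← lintegral_add_left measurable_const]
  refine lintegral_mono fun x => ?_
  have h1 : 0 ≤ e / G e := div_nonneg he.le (hG.pos e he).le
  rw [← ofReal_norm, ← ENNReal.ofReal_mul h1, ← ENNReal.ofReal_add he.le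
    (mul_nonneg h1 (hG.nonneg (norm_nonneg _)))]
  exact ENNReal.ofReal_le_ofReal (hG.le_add (norm_nonneg _) he)

lemma IsGauge.memLp_one (hG : IsGauge G p r) [IsFiniteMeasure μ] {f : α → E}
    (hf : MemOrlicz G f μ) : MemLp f 1 μ := by
  refine ⟨hf.1, ?_⟩
  rw [eLpNorm_one_eq_lintegral_enorm]
  refine (hG.lintegral_enorm_le one_pos).trans_lt ?_
  exact ENNReal.add_lt_top.2 ⟨ENNReal.mul_lt_top ENNReal.ofReal_lt_top (measure_lt_top _ _),
    ENNReal.mul_lt_top ENNReal.ofReal_lt_top (hG.luxemburgNorm_lt_top_iff.1 hf.2)⟩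

lemma IsGauge.tendsto_eLpNorm_one (hG : IsGauge G p r) [IsFiniteMeasure μ] {ι : Type*}
    {l : Filter ι} {f : ι → α → E} (h : Tendsto (fun n => modular G (f n) μ) l (𝓝 0)) :
    Tendsto (fun n => eLpNorm (f n) 1 μ) l (𝓝 0) := by
  rw [ENNReal.tendsto_nhds_zero]
  intro ε hε
  wlog hεt : ε ≠ ⊤ generalizing ε
  · filter_upwards [this 1 one_pos ENNReal.one_ne_top] with n _
    rw [not_not.1 hεt]; exact le_top
  have hε0 : 0 < ε.toReal := ENNReal.toReal_pos hε.ne' hεt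
  -- Chosen so that `e * μ univ ≤ ε / 2`; the `+ 1` keeps the denominator positive when the measure
  -- is zero.
  set e := ε.toReal / (2 * ((μ Set.univ).toReal + 1)) with he_def
  have hM : 0 ≤ (μ Set.univ).toReal := ENNReal.toReal_nonneg
  have he : 0 < e := by positivity
  have h1 : Tendsto (fun n => ENNReal.ofReal (e / G e) * modular G (f n) μ) l (𝓝 0) := by
    simpa using ENNReal.Tendsto.const_mul h (Or.inr ENNReal.ofReal_ne_top)
  rw [ENNReal.tendsto_nhds_zero] at h1
  filter_upwards [h1 (ε / 2) (by simpa using hε.ne')] with n hn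
  rw [eLpNorm_one_eq_lintegral_enorm]
  refine (hG.lintegral_enorm_le he).trans ?_
  rw [← ENNReal.add_halves ε]
  gcongr
  rw [← ENNReal.ofReal_toReal (measure_ne_top μ Set.univ), ← ENNReal.ofReal_mul he.le,
    ← ENNReal.ofReal_toReal (a := ε / 2) (ENNReal.div_ne_top hεt (by simp))]
  apply ENNReal.ofReal_le_ofReal
  rw [ENNReal.toReal_div, he_def, div_mul_eq_mul_div, div_le_div_iff₀ (by positivity) (by simp)]
  simp
  nlinarith

/-! ### Weak gradients -/

section WeakGradient

variable {N : ℕ} {Ω : Set (EuclideanSpace ℝ (Fin N))}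
  {u u' : EuclideanSpace ℝ (Fin N) → ℝ} {V V' : EuclideanSpace ℝ (Fin N) → EuclideanSpace ℝ (Fin N)}

lemma gradient_apply {f : EuclideanSpace ℝ (Fin N) → ℝ} (x : EuclideanSpace ℝ (Fin N))
    (i : Fin N) : gradient f x i = fderiv ℝ f x (EuclideanSpace.single i 1) := by
  have h : inner ℝ (gradient f x) (EuclideanSpace.single i (1 : ℝ))
      = fderiv ℝ f x (EuclideanSpace.single i 1) := by
    simp [gradient]
  rw [← h, EuclideanSpace.inner_single_right]
  simp

lemma norm_gradient {f : EuclideanSpace ℝ (Fin N) → ℝ} (x : EuclideanSpace ℝ (Fin N)) :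
    ‖gradient f x‖ = ‖fderiv ℝ f x‖ := by
  simp [gradient]

lemma continuous_gradient {f : EuclideanSpace ℝ (Fin N) → ℝ} (hf : ContDiff ℝ 1 f) :
    Continuous (gradient f) :=
  (InnerProductSpace.toDual ℝ (EuclideanSpace ℝ (Fin N))).symm.continuous.comp
    (hf.continuous_fderiv one_ne_zero)

lemma continuous_partial {η : EuclideanSpace ℝ (Fin N) → ℝ} (hη : ContDiff ℝ 1 η)
    (v : EuclideanSpace ℝ (Fin N)) : Continuous fun x => fderiv ℝ η x v :=
  (hη.continuous_fderiv one_ne_zero).clm_apply continuous_const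

lemma tsupport_partial_subset {η : EuclideanSpace ℝ (Fin N) → ℝ}
    (v : EuclideanSpace ℝ (Fin N)) : tsupport (fun x => fderiv ℝ η x v) ⊆ tsupport η := by
  refine closure_minimal ?_ (isClosed_tsupport η)
  intro x hx
  by_contra h
  exact hx (by simp [fderiv_of_notMem_tsupport ℝ h])

lemma hasCompactSupport_partial {η : EuclideanSpace ℝ (Fin N) → ℝ} (hη : HasCompactSupport η)
    (v : EuclideanSpace ℝ (Fin N)) : HasCompactSupport (fun x => fderiv ℝ η x v) :=
  hη.isCompact.of_isClosed_subset (isClosed_tsupport _) (tsupport_partial_subset v)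

lemma integrableOn_mul_of_tsupport_subset {f η : EuclideanSpace ℝ (Fin N) → ℝ}
    (hΩ : MeasurableSet Ω) (hf : LocallyIntegrableOn f Ω) (hη : Continuous η)
    (hc : HasCompactSupport η) (hs : tsupport η ⊆ Ω) :
    IntegrableOn (fun x => f x * η x) Ω := by
  have h1 : IntegrableOn (fun x => f x * η x) (tsupport η) :=
    (hf.integrableOn_compact_subset hs hc).mul_continuousOn hη.continuousOn hc
  refine h1.of_forall_sdiff_eq_zero hΩ fun x hx => ?_
  rw [image_eq_zero_of_notMem_tsupport hx.2, mul_zero]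

lemma locallyIntegrableOn_apply (hV : LocallyIntegrableOn V Ω) (i : Fin N) :
    LocallyIntegrableOn (fun x => V x i) Ω := by
  intro x hx
  obtain ⟨t, ht, h⟩ := hV x hx
  exact ⟨t, ht, (EuclideanSpace.proj (𝕜 := ℝ) i).integrable_comp h⟩

namespace HasWeakGradient

lemma congr (h : HasWeakGradient Ω u V) (hu : u =ᵐ[volume.restrict Ω] u')
    (hV : V =ᵐ[volume.restrict Ω] V') : HasWeakGradient Ω u' V' := by
  refine ⟨h.1.congr hu, h.2.congr hV, fun η hη i => ?_⟩
  have h1 := h.integral_eq η hη i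
  rw [integral_congr_ae (g := fun x => u' x * fderiv ℝ η x (EuclideanSpace.single i 1))
    (hu.mono fun x hx => by simp only [hx]), integral_congr_ae (f := fun x => V x i * η x)
    (g := fun x => V' x i * η x) (hV.mono fun x hx => by simp only [hx])] at h1
  exact h1

lemma integrableOn_left (hΩ : IsOpen Ω) (h : HasWeakGradient Ω u V)
    {η : EuclideanSpace ℝ (Fin N) → ℝ} (hη : η ∈ testFunctions Ω) (i : Fin N) :
    IntegrableOn (fun x => u x * fderiv ℝ η x (EuclideanSpace.single i 1)) Ω :=
  integrableOn_mul_of_tsupport_subset hΩ.measurableSet h.1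
    (continuous_partial (hη.1.of_le (by simp)) _) (hasCompactSupport_partial hη.2.1 _)
    ((tsupport_partial_subset _).trans hη.2.2)

lemma integrableOn_right (hΩ : IsOpen Ω) (h : HasWeakGradient Ω u V)
    {η : EuclideanSpace ℝ (Fin N) → ℝ} (hη : η ∈ testFunctions Ω) (i : Fin N) :
    IntegrableOn (fun x => V x i * η x) Ω :=
  integrableOn_mul_of_tsupport_subset hΩ.measurableSet (locallyIntegrableOn_apply h.2 i)
    hη.1.continuous hη.2.1 hη.2.2

lemma add (hΩ : IsOpen Ω) (h : HasWeakGradient Ω u V) (h' : HasWeakGradient Ω u' V') :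
    HasWeakGradient Ω (u + u') (V + V') := by
  refine ⟨h.1.add h'.1, h.2.add h'.2, fun η hη i => ?_⟩
  simp only [Pi.add_apply, PiLp.add_apply, add_mul]
  rw [integral_add (h.integrableOn_left hΩ hη i) (h'.integrableOn_left hΩ hη i),
    integral_add (h.integrableOn_right hΩ hη i) (h'.integrableOn_right hΩ hη i),
    h.integral_eq η hη i, h'.integral_eq η hη i]
  ring

lemma neg (h : HasWeakGradient Ω u V) : HasWeakGradient Ω (-u) (-V) := by
  refine ⟨h.1.neg, h.2.neg, fun η hη i => ?_⟩
  simp only [Pi.neg_apply, PiLp.neg_apply, neg_mul, integral_neg, h.integral_eq η hη i]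

lemma sub (hΩ : IsOpen Ω) (h : HasWeakGradient Ω u V) (h' : HasWeakGradient Ω u' V') :
    HasWeakGradient Ω (u - u') (V - V') := by
  rw [sub_eq_add_neg, sub_eq_add_neg]
  exact h.add hΩ h'.neg

/-- The fundamental lemma of the calculus of variations, applied to each coordinate of the
difference. -/
lemma unique (hΩ : IsOpen Ω) (h : HasWeakGradient Ω u V) (h' : HasWeakGradient Ω u V') :
    V =ᵐ[volume.restrict Ω] V' := by
  have key : ∀ i : Fin N, ∀ᵐ x ∂(volume : Measure (EuclideanSpace ℝ (Fin N))),
      x ∈ Ω → V x i - V' x i = 0 := by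
    intro i
    refine hΩ.ae_eq_zero_of_integral_contDiff_smul_eq_zero
      ((locallyIntegrableOn_apply h.2 i).sub (locallyIntegrableOn_apply h'.2 i)) ?_
    intro η hη hc hs
    have hη' : η ∈ testFunctions Ω := ⟨hη, hc, hs⟩
    have h1 : ∫ x in Ω, η x • (V x i - V' x i) = ∫ x, η x • (V x i - V' x i) := by
      apply setIntegral_eq_integral_of_forall_compl_eq_zero
      intro x hx
      rw [image_eq_zero_of_notMem_tsupport fun hx' => hx (hs hx'), zero_smul]
    have h2 := h.integral_eq η hη' i
    rw [h'.integral_eq η hη' i, neg_inj] at h2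
    rw [← h1]
    simp only [smul_eq_mul, mul_comm (η _), sub_mul]
    rw [integral_sub (h.integrableOn_right hΩ hη' i) (h'.integrableOn_right hΩ hη' i), h2,
      sub_self]
  rw [Filter.EventuallyEq, ae_restrict_iff' hΩ.measurableSet]
  filter_upwards [ae_all_iff.2 key] with x hx hxΩ
  ext i
  exact sub_eq_zero.1 (hx i hxΩ)

lemma weaklyDifferentiable (h : HasWeakGradient Ω u V) : WeaklyDifferentiable Ω u := ⟨V, h⟩

end HasWeakGradient

lemma WeaklyDifferentiable.hasWeakGradient (h : WeaklyDifferentiable Ω u) :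
    HasWeakGradient Ω u (weakGradient Ω u) := by
  rw [weakGradient, dif_pos h]
  exact h.choose_spec

/-- Allows the arbitrarily chosen `weakGradient` to be replaced by an explicit gradient wherever
only a.e. classes matter. -/
lemma HasWeakGradient.weakGradient_ae_eq (hΩ : IsOpen Ω) (h : HasWeakGradient Ω u V) :
    weakGradient Ω u =ᵐ[volume.restrict Ω] V :=
  h.weaklyDifferentiable.hasWeakGradient.unique hΩ h

lemma hasWeakGradient_of_contDiff {ψ : EuclideanSpace ℝ (Fin N) → ℝ}
    (hψ : ContDiff ℝ 1 ψ) : HasWeakGradient Ω ψ (gradient ψ) := by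
  refine ⟨hψ.continuous.locallyIntegrable.locallyIntegrableOn _,
    (continuous_gradient hψ).locallyIntegrable.locallyIntegrableOn _, fun η hη i => ?_⟩
  have hη1 : ContDiff ℝ 1 η := hη.1.of_le (by simp)
  have hz : ∀ x, x ∉ Ω → η x = 0 := fun x hx =>
    image_eq_zero_of_notMem_tsupport fun hx' => hx (hη.2.2 hx')
  have hz' : ∀ x, x ∉ Ω → fderiv ℝ η x (EuclideanSpace.single i 1) = 0 := fun x hx => by
    simp [fderiv_of_notMem_tsupport ℝ fun hx' => hx (hη.2.2 hx')]
  rw [setIntegral_eq_integral_of_forall_compl_eq_zero fun x hx => by rw [hz' x hx, mul_zero],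
    setIntegral_eq_integral_of_forall_compl_eq_zero fun x hx => by rw [hz x hx, mul_zero]]
  simp only [gradient_apply]
  apply integral_mul_fderiv_eq_neg_fderiv_mul_of_integrable
  · exact ((continuous_partial hψ _).mul hη1.continuous).integrable_of_hasCompactSupport
      hη.2.1.mul_left
  · exact (hψ.continuous.mul (continuous_partial hη1 _)).integrable_of_hasCompactSupport
      (hasCompactSupport_partial hη.2.1 _).mul_left
  · exact (hψ.continuous.mul hη1.continuous).integrable_of_hasCompactSupport hη.2.1.mul_left
  · exact fun x _ => hψ.differentiable one_ne_zero x
  · exact fun x _ => hη1.differentiable one_ne_zero x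

end WeakGradient

/-! ### A boundary estimate for integrals of derivatives -/

section Boundary

variable {m : ℕ}

/-- The projection along the `i`-th coordinate direction. -/
def dropCoord (i : Fin (m + 1)) (x : EuclideanSpace ℝ (Fin (m + 1))) : Fin m → ℝ :=
  fun j => x (i.succAbove j)

/-- The point with `i`-th coordinate `t` and remaining coordinates `y`. -/
def insertCoord (i : Fin (m + 1)) (t : ℝ) (y : Fin m → ℝ) : EuclideanSpace ℝ (Fin (m + 1)) :=
  WithLp.toLp 2 (i.insertNth t y)

@[simp] lemma dropCoord_insertCoord (i : Fin (m + 1)) (t : ℝ) (y : Fin m → ℝ) :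
    dropCoord i (insertCoord i t y) = y := by
  ext j; simp [dropCoord, insertCoord]

@[simp] lemma insertCoord_apply_same (i : Fin (m + 1)) (t : ℝ) (y : Fin m → ℝ) :
    insertCoord i t y i = t := by
  simp [insertCoord]

lemma continuous_dropCoord (i : Fin (m + 1)) : Continuous (dropCoord i) := by
  unfold dropCoord; fun_prop

lemma lipschitzWith_dropCoord (i : Fin (m + 1)) : LipschitzWith 1 (dropCoord i) := by
  refine LipschitzWith.of_dist_le_mul fun x y => ?_
  rw [NNReal.coe_one, one_mul, dist_pi_le_iff dist_nonneg]
  intro j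
  rw [dropCoord, dropCoord, Real.dist_eq, dist_eq_norm]
  exact PiLp.norm_apply_le (x - y) (i.succAbove j)

lemma dropCoord_sub_smul_single (i : Fin (m + 1)) (x : EuclideanSpace ℝ (Fin (m + 1))) (t : ℝ) :
    dropCoord i (x - t • EuclideanSpace.single i 1) = dropCoord i x := by
  ext j; simp [dropCoord]

lemma dist_eq_of_dropCoord_eq (i : Fin (m + 1)) {x y : EuclideanSpace ℝ (Fin (m + 1))}
    (h : dropCoord i x = dropCoord i y) : dist x y = |x i - y i| := by
  have : x - y = EuclideanSpace.single i (x i - y i) := by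
    ext j
    rcases eq_or_ne j i with rfl | hj
    · simp
    · obtain ⟨k, rfl⟩ := Fin.exists_succAbove_eq hj
      have := congrFun h k
      simp only [dropCoord] at this
      simp [this]
  rw [dist_eq_norm, this]
  simp

lemma lintegral_eq_lintegral_insertCoord (i : Fin (m + 1))
    {f : EuclideanSpace ℝ (Fin (m + 1)) → ℝ≥0∞} (hf : Measurable f) :
    Measurable (fun y => ∫⁻ t, f (insertCoord i t y)) ∧
    ∫⁻ x, f x = ∫⁻ y, ∫⁻ t, f (insertCoord i t y) := by
  have h1 := EuclideanSpace.volume_preserving_symm_measurableEquiv_toLp (Fin (m + 1))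
  have h2 := volume_preserving_piFinSuccAbove (fun _ : Fin (m + 1) => ℝ) i
  set e := (MeasurableEquiv.toLp 2 (Fin (m + 1) → ℝ)).symm.trans
    (MeasurableEquiv.piFinSuccAbove (fun _ : Fin (m + 1) => ℝ) i) with he
  have h3 : MeasurePreserving e volume volume := h2.comp h1
  have h4 : ∀ z : ℝ × (Fin m → ℝ), e.symm z = insertCoord i z.1 z.2 := fun z => rfl
  have hm : Measurable fun z : ℝ × (Fin m → ℝ) => f (insertCoord i z.1 z.2) := by
    simp only [← h4]
    exact hf.comp e.symm.measurable
  refine ⟨hm.lintegral_prod_left', ?_⟩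
  rw [← h3.symm.lintegral_comp_emb e.symm.measurableEmbedding]
  simp only [h4]
  rw [Measure.volume_eq_prod, lintegral_prod_symm _ hm.aemeasurable]

/-- Integrals over a projection are bounded by Hausdorff integrals. -/
lemma lintegral_le_setLIntegral_dropCoord (i : Fin (m + 1))
    {A : Set (EuclideanSpace ℝ (Fin (m + 1)))} {f : (Fin m → ℝ) → ℝ≥0∞}
    (hf : Measurable f) (h : ∀ y, f y ≠ 0 → ∃ x ∈ A, dropCoord i x = y) :
    ∫⁻ y, f y ≤ ∫⁻ x in A, f (dropCoord i x) ∂μH[(m : ℝ)] := by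
  have hd : Measurable (dropCoord i) := (continuous_dropCoord i).measurable
  set T := {y | f y ≠ 0} with hT
  have hTm : MeasurableSet T := hf (measurableSet_singleton 0).compl
  -- Every point of `T` is the projection of a point of `A`, and the projection is `1`-Lipschitz, so
  -- Lebesgue measure on `T` is dominated by the pushforward of Hausdorff measure on `A`.
  have hle : (volume : Measure (Fin m → ℝ)).restrict T
      ≤ Measure.map (dropCoord i) ((μH[(m : ℝ)]).restrict A) := by
    refine Measure.le_iff.2 fun S hS => ?_
    rw [Measure.restrict_apply hS, Measure.map_apply hd hS, Measure.restrict_apply (hd hS)]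
    have hsub : S ∩ T ⊆ dropCoord i '' (dropCoord i ⁻¹' S ∩ A) := by
      rintro y ⟨hyS, hyT⟩
      obtain ⟨x, hxA, rfl⟩ := h y hyT
      exact ⟨x, ⟨hyS, hxA⟩, rfl⟩
    refine (measure_mono hsub).trans ?_
    have := ((lipschitzWith_dropCoord i).lipschitzOnWith
      (s := dropCoord i ⁻¹' S ∩ A)).hausdorffMeasure_image_le (d := (m : ℝ)) (Nat.cast_nonneg m)
    -- For the sup metric the two measures agree without a normalizing constant, which is why the
    -- projection takes values in `Fin m → ℝ`.
    have hv : (μH[(m : ℝ)] : Measure (Fin m → ℝ)) = volume := by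
      rw [← hausdorffMeasure_pi_real, Fintype.card_fin]
    rw [hv] at this
    simpa using this
  calc ∫⁻ y, f y = ∫⁻ y in T, f y := by
        rw [← lintegral_indicator hTm]
        congr 1 with y
        by_cases hy : y ∈ T
        · simp [hy]
        · simp only [Set.indicator_of_notMem hy]
          simpa [hT] using hy
    _ ≤ ∫⁻ y, f y ∂(Measure.map (dropCoord i) ((μH[(m : ℝ)]).restrict A)) :=
        lintegral_mono' hle le_rfl
    _ = ∫⁻ x in A, f (dropCoord i x) ∂μH[(m : ℝ)] := lintegral_map hf hd

/-- A segment that avoids the frontier is covered by the disjoint open sets `interior Ω` and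
`(closure Ω)ᶜ`; being connected, it lies in one of them. -/
lemma exists_mem_frontier_of_mem_iff {m : ℕ} {Ω : Set (EuclideanSpace ℝ (Fin m))}
    {x e : EuclideanSpace ℝ (Fin m)} {s : ℝ} (hs : 0 ≤ s) (h : ¬(x - s • e ∈ Ω ↔ x ∈ Ω)) :
    ∃ τ, 0 ≤ τ ∧ τ ≤ s ∧ x - τ • e ∈ frontier Ω := by
  by_contra! hcon
  have hp : IsPreconnected ((fun τ : ℝ => x - τ • e) '' Set.Icc 0 s) :=
    isPreconnected_Icc.image _ (by fun_prop)
  have hdis : Disjoint (frontier Ω) ((fun τ : ℝ => x - τ • e) '' Set.Icc 0 s) := by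
    rw [Set.disjoint_right]
    rintro _ ⟨τ, hτ, rfl⟩
    exact hcon τ hτ.1 hτ.2
  have h0 : x ∈ (fun τ : ℝ => x - τ • e) '' Set.Icc 0 s := ⟨0, ⟨le_rfl, hs⟩, by simp⟩
  have h1 : x - s • e ∈ (fun τ : ℝ => x - τ • e) '' Set.Icc 0 s := ⟨s, ⟨hs, le_rfl⟩, rfl⟩
  have hcov : (fun τ : ℝ => x - τ • e) '' Set.Icc 0 s ⊆ interior Ω ∪ (closure Ω)ᶜ := by
    intro y hy
    have := Set.disjoint_right.1 hdis hy
    by_cases hyc : y ∈ closure Ω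
    · left
      by_contra hyi
      exact this ⟨hyc, hyi⟩
    · exact Or.inr hyc
  rcases hp.subset_or_subset isOpen_interior isClosed_closure.isOpen_compl
    (Set.disjoint_left.2 fun y hy hy' => hy' (subset_closure (interior_subset hy))) hcov with hi | hi
  · exact h ⟨fun _ => interior_subset (hi h0), fun _ => interior_subset (hi h1)⟩
  · exact h ⟨fun hc => absurd (subset_closure hc) (hi h1),
      fun hc => absurd (subset_closure hc) (hi h0)⟩

variable {Ω : Set (EuclideanSpace ℝ (Fin (m + 1)))}

/-- The slab `k s ≤ x i < (k + 1) s`. -/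
def slab (i : Fin (m + 1)) (s : ℝ) (k : ℤ) : Set (EuclideanSpace ℝ (Fin (m + 1))) :=
  {x | ⌊x i / s⌋ = k}

lemma measurableSet_slab (i : Fin (m + 1)) (s : ℝ) (k : ℤ) : MeasurableSet (slab i s k) := by
  have : Measurable fun x : EuclideanSpace ℝ (Fin (m + 1)) => ⌊x i / s⌋ := by
    apply Measurable.floor
    fun_prop
  exact this (measurableSet_singleton k)

lemma iUnion_slab (i : Fin (m + 1)) (s : ℝ) : ⋃ k, slab i s k = Set.univ := by
  ext x; simp [slab]

lemma pairwise_disjoint_slab (i : Fin (m + 1)) (s : ℝ) :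
    Pairwise (Function.onFun Disjoint (slab i s)) := by
  intro k l hkl
  exact Set.disjoint_left.2 fun x hx hx' => hkl (hx.symm.trans hx')

lemma mem_slab_iff {i : Fin (m + 1)} {s : ℝ} (hs : 0 < s) {k : ℤ}
    {x : EuclideanSpace ℝ (Fin (m + 1))} : x ∈ slab i s k ↔ k * s ≤ x i ∧ x i < (k + 1) * s := by
  rw [slab, Set.mem_ofPred_eq, Int.floor_eq_iff, le_div_iff₀ hs, div_lt_iff₀ hs]

lemma tsum_setLIntegral_slab (i : Fin (m + 1)) (s : ℝ)
    (μ : Measure (EuclideanSpace ℝ (Fin (m + 1))))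
    (f : EuclideanSpace ℝ (Fin (m + 1)) → ℝ≥0∞) :
    ∑' k, ∫⁻ x in slab i s k, f x ∂μ = ∫⁻ x, f x ∂μ := by
  rw [← lintegral_iUnion (measurableSet_slab i s) (pairwise_disjoint_slab i s), iUnion_slab,
    setLIntegral_univ]

/-- Fubini along direction `i`: a line meets the slab in length `s`, and a line carrying a point of
the symmetric difference also carries a frontier point in this slab or the one below. Cutting into
slabs keeps that frontier point within `2 s`, so `|f|` on the line is bounded by `w` there. -/
lemma setLIntegral_slab_le (hΩ : MeasurableSet Ω) (i : Fin (m + 1)) {s : ℝ} (hs : 0 < s) (k : ℤ)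
    {f : EuclideanSpace ℝ (Fin (m + 1)) → ℝ} (hf : Continuous f)
    {w : EuclideanSpace ℝ (Fin (m + 1)) → ℝ≥0∞}
    (hw : ∀ x y, dist x y ≤ 2 * s → ‖f x‖ₑ ≤ w y) :
    ∫⁻ x in {x | ¬(x - s • EuclideanSpace.single i 1 ∈ Ω ↔ x ∈ Ω)} ∩ slab i s k, ‖f x‖ₑ ≤
      ENNReal.ofReal s * (∫⁻ x in slab i s (k - 1), w x ∂(surfaceMeasure Ω) +
        ∫⁻ x in slab i s k, w x ∂(surfaceMeasure Ω)) := by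
  set D := {x | ¬(x - s • EuclideanSpace.single i 1 ∈ Ω ↔ x ∈ Ω)} ∩ slab i s k with hD
  have hsub : Measurable fun x : EuclideanSpace ℝ (Fin (m + 1)) =>
      x - s • EuclideanSpace.single i (1 : ℝ) := by fun_prop
  have hDm : MeasurableSet D :=
    (((hsub hΩ).iff hΩ).compl).inter (measurableSet_slab i s k)
  have hmeas : Measurable (D.indicator fun x => ‖f x‖ₑ) := hf.enorm.measurable.indicator hDm
  obtain ⟨hΨm, hΨ⟩ := lintegral_eq_lintegral_insertCoord i hmeas
  set A := frontier Ω ∩ (slab i s (k - 1) ∪ slab i s k) with hA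
  have hAm : MeasurableSet A := isClosed_frontier.measurableSet.inter
    ((measurableSet_slab i s _).union (measurableSet_slab i s _))
  have hdist : ∀ x ∈ slab i s k, ∀ y ∈ A, dropCoord i y = dropCoord i x → dist x y ≤ 2 * s := by
    intro x hx y hy hxy
    rw [dist_eq_of_dropCoord_eq i hxy.symm, abs_le]
    rw [mem_slab_iff hs] at hx
    rcases hy.2 with h | h <;> rw [mem_slab_iff hs] at h <;> push_cast at h <;>
      constructor <;> nlinarith
  rw [← lintegral_indicator hDm, hΨ]
  refine (lintegral_le_setLIntegral_dropCoord i (A := A) hΨm ?_).trans ?_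
  · intro y hy
    obtain ⟨t, ht⟩ : ∃ t, D.indicator (fun x => ‖f x‖ₑ) (insertCoord i t y) ≠ 0 := by
      by_contra! hcon
      exact hy (by simp [hcon])
    have htD := Set.mem_of_indicator_ne_zero ht
    -- The crossing occurs at most `s` below the point, hence no lower than the preceding slab.
    obtain ⟨τ, hτ0, hτs, hτ⟩ := exists_mem_frontier_of_mem_iff hs.le htD.1
    refine ⟨_, ⟨hτ, ?_⟩, (dropCoord_sub_smul_single i _ τ).trans (dropCoord_insertCoord i t y)⟩
    have hsl := (mem_slab_iff hs).1 htD.2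
    rw [Set.mem_union, mem_slab_iff hs, mem_slab_iff hs]
    have : (insertCoord i t y - τ • EuclideanSpace.single i (1 : ℝ)) i
        = insertCoord i t y i - τ := by simp
    rw [this]
    push_cast
    by_cases hc : k * s ≤ insertCoord i t y i - τ
    · right; exact ⟨hc, by linarith [hsl.2]⟩
    · left
      constructor
      · nlinarith [hsl.1]
      · push Not at hc; linarith
  · have hbound : ∀ x ∈ A, ∫⁻ t, D.indicator (fun x => ‖f x‖ₑ) (insertCoord i t (dropCoord i x))
        ≤ ENNReal.ofReal s * w x := by
      intro x hx
      calc ∫⁻ t, D.indicator (fun x => ‖f x‖ₑ) (insertCoord i t (dropCoord i x))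
          ≤ ∫⁻ t, (Set.Ico (k * s : ℝ) ((k + 1) * s)).indicator (fun _ => w x) t := by
            refine lintegral_mono fun t => ?_
            by_cases hzD : insertCoord i t (dropCoord i x) ∈ D
            · have hsl := (mem_slab_iff hs).1 hzD.2
              rw [insertCoord_apply_same] at hsl
              rw [Set.indicator_of_mem hzD, Set.indicator_of_mem (Set.mem_Ico.2 hsl)]
              exact hw _ _ (hdist _ hzD.2 x hx (dropCoord_insertCoord i t _).symm)
            · rw [Set.indicator_of_notMem hzD]; exact zero_le
        _ = ENNReal.ofReal s * w x := by
            rw [lintegral_indicator measurableSet_Ico, setLIntegral_const, Real.volume_Ico,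
              mul_comm]
            congr 2; ring
    refine (setLIntegral_mono' hAm hbound).trans ?_
    rw [lintegral_const_mul' _ _ ENNReal.ofReal_ne_top]
    gcongr
    have hm1 : ((m + 1 : ℕ) : ℝ) - 1 = m := by push_cast; ring
    rw [surfaceMeasure, hm1, Measure.restrict_restrict (measurableSet_slab i s _),
      Measure.restrict_restrict (measurableSet_slab i s _), hA, Set.inter_comm,
      Set.union_inter_distrib_right]
    exact lintegral_union_le _ _ _

/-- Summation over the slabs: each one appears on the right for two values of `k`, which produces
the factor `2`. -/
lemma setLIntegral_symmDiff_le (hΩ : MeasurableSet Ω) (i : Fin (m + 1)) {s : ℝ} (hs : 0 < s)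
    {f : EuclideanSpace ℝ (Fin (m + 1)) → ℝ} (hf : Continuous f)
    {w : EuclideanSpace ℝ (Fin (m + 1)) → ℝ≥0∞}
    (hw : ∀ x y, dist x y ≤ 2 * s → ‖f x‖ₑ ≤ w y) :
    ∫⁻ x in {x | ¬(x - s • EuclideanSpace.single i 1 ∈ Ω ↔ x ∈ Ω)}, ‖f x‖ₑ ≤
      ENNReal.ofReal s * (2 * ∫⁻ x, w x ∂(surfaceMeasure Ω)) := by
  set D := {x | ¬(x - s • EuclideanSpace.single i 1 ∈ Ω ↔ x ∈ Ω)} with hD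
  calc ∫⁻ x in D, ‖f x‖ₑ = ∑' k, ∫⁻ x in D ∩ slab i s k, ‖f x‖ₑ := by
        rw [← tsum_setLIntegral_slab i s]
        congr 1 with k
        rw [Measure.restrict_restrict (measurableSet_slab i s k), Set.inter_comm]
    _ ≤ ∑' k, ENNReal.ofReal s * (∫⁻ x in slab i s (k - 1), w x ∂(surfaceMeasure Ω) +
        ∫⁻ x in slab i s k, w x ∂(surfaceMeasure Ω)) :=
        ENNReal.tsum_le_tsum fun k => setLIntegral_slab_le hΩ i hs k hf hw
    _ = _ := by
        rw [ENNReal.tsum_mul_left, ENNReal.tsum_add, tsum_setLIntegral_slab i s,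
          show ∑' k, ∫⁻ x in slab i s (k - 1), w x ∂(surfaceMeasure Ω)
            = ∑' k, ∫⁻ x in slab i s k, w x ∂(surfaceMeasure Ω) from
            (Equiv.subRight (1 : ℤ)).tsum_eq
              (fun k => ∫⁻ x in slab i s k, w x ∂(surfaceMeasure Ω)),
          tsum_setLIntegral_slab i s, two_mul]

/-- Translation invariance moves the shift from `f` to `Ω`; the difference of the two integrals then
lives on the symmetric difference of `Ω` and its translate. -/
lemma enorm_integral_difference_le (hΩ : MeasurableSet Ω) (i : Fin (m + 1)) {s : ℝ} (hs : 0 < s)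
    {f : EuclideanSpace ℝ (Fin (m + 1)) → ℝ} (hf : Continuous f) (hc : HasCompactSupport f)
    {w : EuclideanSpace ℝ (Fin (m + 1)) → ℝ≥0∞}
    (hw : ∀ x y, dist x y ≤ 2 * s → ‖f x‖ₑ ≤ w y) :
    ‖∫ x in Ω, s⁻¹ • (f (x + s • EuclideanSpace.single i 1) - f x)‖ₑ ≤
      2 * ∫⁻ x, w x ∂(surfaceMeasure Ω) := by
  set e : EuclideanSpace ℝ (Fin (m + 1)) := EuclideanSpace.single i 1 with he
  have hfi : Integrable f := hf.integrable_of_hasCompactSupport hc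
  have hΩs : MeasurableSet {x | x - s • e ∈ Ω} := (measurable_id.sub_const (s • e)) hΩ
  have h1 : ∫ x in Ω, f (x + s • e) = ∫ x, {x | x - s • e ∈ Ω}.indicator f x := by
    rw [← integral_indicator hΩ,
      ← integral_add_right_eq_self (fun x => {x | x - s • e ∈ Ω}.indicator f x) (s • e)]
    congr 1 with x
    by_cases hx : x ∈ Ω <;> simp [Set.indicator, hx]
  rw [integral_smul, integral_sub (hfi.comp_add_right (s • e)).integrableOn hfi.integrableOn, h1,
    ← integral_indicator hΩ, ← integral_sub (hfi.indicator hΩs) (hfi.indicator hΩ), enorm_smul]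
  have h2 : ‖∫ x, ({x | x - s • e ∈ Ω}.indicator f x - Ω.indicator f x)‖ₑ
      ≤ ENNReal.ofReal s * (2 * ∫⁻ x, w x ∂(surfaceMeasure Ω)) := by
    refine (enorm_integral_le_lintegral_enorm _).trans ?_
    refine le_trans ?_ (setLIntegral_symmDiff_le hΩ i hs hf hw)
    have hDm : MeasurableSet {x | ¬(x - s • EuclideanSpace.single i 1 ∈ Ω ↔ x ∈ Ω)} :=
      (hΩs.iff hΩ).compl
    rw [← lintegral_indicator hDm]
    refine lintegral_mono fun x => ?_
    by_cases hx : x ∈ Ω <;> by_cases hx' : x - s • e ∈ Ω <;> simp [Set.indicator, hx, hx', ← he]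
  calc ‖s⁻¹‖ₑ * ‖∫ x, ({x | x - s • e ∈ Ω}.indicator f x - Ω.indicator f x)‖ₑ
      ≤ ENNReal.ofReal s⁻¹ * (ENNReal.ofReal s * (2 * ∫⁻ x, w x ∂(surfaceMeasure Ω))) := by
        rw [Real.enorm_of_nonneg (inv_pos.2 hs).le]
        gcongr
    _ = 2 * ∫⁻ x, w x ∂(surfaceMeasure Ω) := by
        rw [← mul_assoc, ← ENNReal.ofReal_mul (inv_pos.2 hs).le, inv_mul_cancel₀ hs.ne',
          ENNReal.ofReal_one, one_mul]

/-- The integral of a partial derivative over `Ω` is bounded by a surface integral. -/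
lemma enorm_setIntegral_partial_le (hΩ : MeasurableSet Ω) (hΩfin : volume Ω ≠ ⊤)
    (i : Fin (m + 1)) {f : EuclideanSpace ℝ (Fin (m + 1)) → ℝ} (hf : ContDiff ℝ 1 f)
    (hc : HasCompactSupport f) {w : EuclideanSpace ℝ (Fin (m + 1)) → ℝ≥0∞} {δ : ℝ} (hδ : 0 < δ)
    (hw : ∀ x y, dist x y ≤ δ → ‖f x‖ₑ ≤ w y) :
    ‖∫ x in Ω, fderiv ℝ f x (EuclideanSpace.single i 1)‖ₑ ≤
      2 * ∫⁻ x, w x ∂(surfaceMeasure Ω) := by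
  set e : EuclideanSpace ℝ (Fin (m + 1)) := EuclideanSpace.single i 1 with he
  obtain ⟨C, hC⟩ := hf.lipschitzWith_of_hasCompactSupport hc one_ne_zero
  have : IsFiniteMeasure (volume.restrict Ω) := ⟨by simpa using hΩfin.lt_top⟩
  -- The difference quotients are dominated by the Lipschitz constant of `f`, integrable on a set of
  -- finite measure.
  have hlim : Tendsto (fun s : ℝ => ∫ x in Ω, s⁻¹ • (f (x + s • e) - f x)) (𝓝[>] 0)
      (𝓝 (∫ x in Ω, fderiv ℝ f x e)) := by
    refine tendsto_integral_filter_of_dominated_convergence (fun _ => (C : ℝ)) ?_ ?_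
      (integrable_const _) ?_
    · refine Eventually.of_forall fun s => Continuous.aestronglyMeasurable ?_
      have := hf.continuous
      fun_prop
    · filter_upwards [self_mem_nhdsWithin] with s hs
      refine Eventually.of_forall fun x => ?_
      have h1 := hC.dist_le_mul (x + s • e) x
      rw [dist_eq_norm, dist_eq_norm, add_sub_cancel_left, norm_smul,
        Real.norm_of_nonneg (le_of_lt hs)] at h1
      have h2 : ‖e‖ = 1 := by simp [he]
      rw [h2, mul_one] at h1
      rw [norm_smul, norm_inv, Real.norm_of_nonneg (le_of_lt hs), inv_mul_le_iff₀ hs, mul_comm]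
      exact h1
    · refine Eventually.of_forall fun x => ?_
      exact ((hf.differentiable one_ne_zero x).hasFDerivAt.hasLineDerivAt e).tendsto_slope_zero_right
  refine le_of_tendsto ((continuous_enorm.tendsto _).comp hlim) ?_
  -- For `s ≤ δ / 2` the distance `2 s` in the estimate stays within the range `δ` of `hw`.
  filter_upwards [Ioc_mem_nhdsGT (half_pos hδ)] with s hs
  exact enorm_integral_difference_le hΩ i hs.1 hf.continuous hc
    fun x y hxy => hw x y (hxy.trans (by linarith [hs.2]))

end Boundary

/-! ### Mollification with off-centre kernels -/

/-- Continuity of translations in `L¹`, expressed through the continuous action of `DomAddAct` on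
`Lp`. -/
lemma tendsto_lintegral_comp_sub_sub {N : ℕ} {F : Type*} [NormedAddCommGroup F]
    {f : EuclideanSpace ℝ (Fin N) → F} (hf : Integrable f) :
    Tendsto (fun z => ∫⁻ x, ‖f (x - z) - f x‖ₑ) (𝓝 0) (𝓝 0) := by
  have hm : MemLp f 1 volume := memLp_one_iff_integrable.2 hf
  have : Fact ((1 : ℝ≥0∞) ≠ ⊤) := ⟨ENNReal.one_ne_top⟩
  have h1 : Continuous fun z : EuclideanSpace ℝ (Fin N) =>
      DomAddAct.mk (-z) +ᵥ hm.toLp f :=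
    (DomAddAct.continuous_mk.comp continuous_neg).vadd continuous_const
  have h2 := (h1.tendsto 0).edist (tendsto_const_nhds (x := hm.toLp f))
  have h0 : DomAddAct.mk (-0 : EuclideanSpace ℝ (Fin N)) +ᵥ hm.toLp f = hm.toLp f := by
    rw [DomAddAct.mk_vadd_toLp]; simp
  rw [h0, edist_self] at h2
  refine h2.congr fun z => ?_
  rw [DomAddAct.mk_vadd_toLp, Lp.edist_toLp_toLp, eLpNorm_one_eq_lintegral_enorm]
  simp [sub_eq_neg_add, add_comm]

section Mollify

variable {N : ℕ} {F : Type*} [NormedAddCommGroup F] [NormedSpace ℝ F]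

/-- The probability measure with density a normalized bump. -/
def bumpMeasure {c : EuclideanSpace ℝ (Fin N)} (φ : ContDiffBump c) :
    Measure (EuclideanSpace ℝ (Fin N)) :=
  volume.withDensity fun z => ENNReal.ofReal (φ.normed volume z)

/-- The average of translates of `f` with respect to a bump. -/
def mollify {c : EuclideanSpace ℝ (Fin N)} (φ : ContDiffBump c)
    (f : EuclideanSpace ℝ (Fin N) → F) (x : EuclideanSpace ℝ (Fin N)) : F :=
  ∫ z, f (x - z) ∂(bumpMeasure φ)

variable {c : EuclideanSpace ℝ (Fin N)} (φ : ContDiffBump c)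

lemma measurable_bump_density :
    Measurable fun z => ENNReal.ofReal (φ.normed volume z) :=
  φ.continuous_normed.measurable.ennreal_ofReal

instance : IsProbabilityMeasure (bumpMeasure φ) := by
  constructor
  rw [bumpMeasure, withDensity_apply _ MeasurableSet.univ, setLIntegral_univ,
    ← ofReal_integral_eq_lintegral_ofReal φ.integrable_normed
      (Eventually.of_forall φ.nonneg_normed), φ.integral_normed, ENNReal.ofReal_one]

lemma ae_bumpMeasure_mem_ball : ∀ᵐ z ∂(bumpMeasure φ), z ∈ Metric.ball c φ.rOut := by
  rw [bumpMeasure, ae_withDensity_iff (measurable_bump_density φ)]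
  refine Eventually.of_forall fun z hz => ?_
  rw [← φ.support_normed_eq (μ := volume)]
  intro h0
  exact hz (by simp [h0])

lemma integral_bumpMeasure (f : EuclideanSpace ℝ (Fin N) → F) :
    ∫ z, f z ∂(bumpMeasure φ) = ∫ z, φ.normed volume z • f z := by
  rw [bumpMeasure, integral_withDensity_eq_integral_toReal_smul (measurable_bump_density φ)
    (by simp)]
  simp [ENNReal.toReal_ofReal (φ.nonneg_normed _)]

/-- The average against a probability measure is the form suited to Jensen's inequality; the
convolution is the form suited to smoothness. -/
lemma mollify_eq_convolution (f : EuclideanSpace ℝ (Fin N) → F) :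
    mollify φ f = convolution (φ.normed volume) f (ContinuousLinearMap.lsmul ℝ ℝ) volume := by
  ext x
  rw [mollify, integral_bumpMeasure, convolution_lsmul]

lemma integrable_bumpMeasure_comp_sub {f : EuclideanSpace ℝ (Fin N) → F}
    (hf : LocallyIntegrable f) (x : EuclideanSpace ℝ (Fin N)) :
    Integrable (fun z => f (x - z)) (bumpMeasure φ) := by
  rw [bumpMeasure, integrable_withDensity_iff_integrable_smul' (measurable_bump_density φ)
    (by simp)]
  have := (φ.hasCompactSupport_normed (μ := volume)).convolutionExists_left (μ := volume)
    (ContinuousLinearMap.lsmul ℝ ℝ) φ.continuous_normed hf x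
  simpa [ConvolutionExistsAt, ENNReal.toReal_ofReal (φ.nonneg_normed _)] using this

lemma continuous_mollify {f : EuclideanSpace ℝ (Fin N) → F}
    (hf : LocallyIntegrable f) : Continuous (mollify φ f) := by
  rw [mollify_eq_convolution]
  exact φ.hasCompactSupport_normed.continuous_convolution_left _ φ.continuous_normed hf

lemma contDiff_mollify [CompleteSpace F] {f : EuclideanSpace ℝ (Fin N) → F}
    (hf : LocallyIntegrable f) : ContDiff ℝ ∞ (mollify φ f) := by
  rw [mollify_eq_convolution]
  exact φ.hasCompactSupport_normed.contDiff_convolution_left _ φ.contDiff_normed hf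

/-- Fubini: the `L¹` error is at most the average of the `L¹` distances between `f` and its
translates. -/
lemma eLpNorm_mollify_sub_le [CompleteSpace F] {f : EuclideanSpace ℝ (Fin N) → F}
    (hf : Integrable f) {ε : ℝ≥0∞}
    (h : ∀ z ∈ Metric.ball c φ.rOut, ∫⁻ x, ‖f (x - z) - f x‖ₑ ≤ ε) :
    eLpNorm (mollify φ f - f) 1 volume ≤ ε := by
  rw [eLpNorm_one_eq_lintegral_enorm]
  have hmeas : AEMeasurable (Function.uncurry fun x z => ‖f (x - z) - f x‖ₑ)
      ((volume : Measure (EuclideanSpace ℝ (Fin N))).prod (bumpMeasure φ)) := by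
    have h1 := hf.aestronglyMeasurable.comp_quasiMeasurePreserving
      (quasiMeasurePreserving_sub_of_right_invariant volume (bumpMeasure φ))
    exact (h1.sub hf.aestronglyMeasurable.comp_fst).enorm
  calc ∫⁻ x, ‖(mollify φ f - f) x‖ₑ
      ≤ ∫⁻ x, ∫⁻ z, ‖f (x - z) - f x‖ₑ ∂(bumpMeasure φ) := by
        refine lintegral_mono fun x => ?_
        have : (mollify φ f - f) x = ∫ z, (f (x - z) - f x) ∂(bumpMeasure φ) := by
          rw [integral_sub (integrable_bumpMeasure_comp_sub φ hf.locallyIntegrable x)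
            (integrable_const _)]
          simp [mollify]
        rw [this]
        exact enorm_integral_le_lintegral_enorm _
    _ = ∫⁻ z, (∫⁻ x, ‖f (x - z) - f x‖ₑ) ∂(bumpMeasure φ) := lintegral_lintegral_swap hmeas
    _ ≤ ∫⁻ z, ε ∂(bumpMeasure φ) := by
        refine lintegral_mono_ae ?_
        filter_upwards [ae_bumpMeasure_mem_ball φ] with z hz using h z hz
    _ = ε := by simp

/-- Mollification converges in `L¹` as the supports of the kernels shrink to the origin. -/
lemma tendsto_eLpNorm_mollify_sub [CompleteSpace F] {c : ℕ → EuclideanSpace ℝ (Fin N)}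
    (φ : ∀ n, ContDiffBump (c n)) {R : ℕ → ℝ} (hR : Tendsto R atTop (𝓝 0))
    (hφ : ∀ n, Metric.ball (c n) (φ n).rOut ⊆ Metric.ball 0 (R n))
    {f : EuclideanSpace ℝ (Fin N) → F} (hf : Integrable f) :
    Tendsto (fun n => eLpNorm (mollify (φ n) f - f) 1 volume) atTop (𝓝 0) := by
  rw [ENNReal.tendsto_nhds_zero]
  intro ε hε
  have h1 := (ENNReal.tendsto_nhds_zero.1 (tendsto_lintegral_comp_sub_sub hf)) ε hε
  obtain ⟨δ, hδ, hball⟩ := Metric.eventually_nhds_iff_ball.1 h1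
  filter_upwards [hR.eventually (gt_mem_nhds hδ)] with n hn
  exact eLpNorm_mollify_sub_le (φ n) hf fun z hz =>
    hball z (Metric.ball_subset_ball hn.le (hφ n hz))

/-- Jensen's inequality for the convex function `v ↦ G ‖v‖` and the probability measure `bumpMeasure
φ`. -/
lemma IsGauge.map_mollify_le [CompleteSpace F] {G : ℝ → ℝ} {p r : ℝ} (hG : IsGauge G p r)
    {f : EuclideanSpace ℝ (Fin N) → F} (hf : Integrable f)
    (hGf : Integrable fun x => G ‖f x‖) (x : EuclideanSpace ℝ (Fin N)) :
    G ‖mollify φ f x‖ ≤ mollify φ (fun x => G ‖f x‖) x :=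
  hG.convexOn_norm.map_integral_le hG.continuous_comp_norm.continuousOn isClosed_univ (by simp)
    (integrable_bumpMeasure_comp_sub φ hf.locallyIntegrable x)
    (integrable_bumpMeasure_comp_sub φ hGf.locallyIntegrable x)

end Mollify

/-- `L¹` convergence improves to modular convergence if the modulars are dominated by an
`L¹`-convergent sequence. -/
lemma IsGauge.tendsto_modular_sub {α E : Type*} [MeasurableSpace α] [NormedAddCommGroup E]
    {μ : Measure α} {G : ℝ → ℝ} {p r : ℝ} (hG : IsGauge G p r) {f : ℕ → α → E} {g : α → E}
    {P : ℕ → α → ℝ} (hf : ∀ n, AEStronglyMeasurable (f n) μ) (hg : AEStronglyMeasurable g μ)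
    (hfg : Tendsto (fun n => eLpNorm (f n - g) 1 μ) atTop (𝓝 0))
    (hfP : ∀ n x, G ‖f n x‖ ≤ P n x) (hP : ∀ n, AEStronglyMeasurable (P n) μ)
    (hGg : modular G g μ < ⊤)
    (hPg : Tendsto (fun n => eLpNorm (P n - fun x => G ‖g x‖) 1 μ) atTop (𝓝 0)) :
    Tendsto (fun n => modular G (f n - g) μ) atTop (𝓝 0) := by
  -- It suffices to find in each subsequence a further one that converges; `L¹` convergence supplies
  -- a.e. convergence along it.
  refine tendsto_of_subseq_tendsto fun ns hns => ?_
  have hmeas := tendstoInMeasure_of_tendsto_eLpNorm one_ne_zero (fun n => hf (ns n)) hg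
    (hfg.comp hns)
  obtain ⟨ms, hms, hae⟩ := hmeas.exists_seq_tendsto_ae
  refine ⟨ms, ?_⟩
  have hnm : Tendsto (fun k => ns (ms k)) atTop atTop := hns.comp hms.tendsto_atTop
  set C : ℝ≥0∞ := ENNReal.ofReal (2 ^ r) with hC
  have hCt : C ≠ ⊤ := ENNReal.ofReal_ne_top
  set Q : α → ℝ≥0∞ := fun x => ENNReal.ofReal (G ‖g x‖) with hQ
  have hQm : AEMeasurable Q μ := hG.aemeasurable hg
  set D : ℕ → α → ℝ≥0∞ := fun n x => ENNReal.ofReal (G ‖(f n - g) x‖) with hD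
  have hDm : ∀ n, AEMeasurable (D n) μ := fun n => hG.aemeasurable ((hf n).sub hg)
  -- A generalized dominated convergence: the first term tends to zero in `L¹`, and the truncated
  -- second term has the fixed integrable majorant `2 C G(|g|)`.
  have hpt : ∀ n x, D n x ≤ C * ‖(P n - fun x => G ‖g x‖) x‖ₑ + min (D n x) (C * (2 * Q x)) := by
    intro n x
    have hGg0 := hG.nonneg (norm_nonneg (g x))
    have h1 : D n x ≤ C * ‖(P n - fun x => G ‖g x‖) x‖ₑ + C * (2 * Q x) := by
      rw [← mul_add, hQ, ← ofReal_norm, ← ENNReal.ofReal_ofNat 2, ← ENNReal.ofReal_mul (by simp),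
        ← ENNReal.ofReal_add (norm_nonneg _) (by positivity), hC,
        ← ENNReal.ofReal_mul (by positivity)]
      refine ENNReal.ofReal_le_ofReal ((hG.map_norm_sub_le _ _).trans ?_)
      refine mul_le_mul_of_nonneg_left ?_ (by positivity)
      have h2 := hfP n x
      have h3 := le_abs_self (P n x - G ‖g x‖)
      simp only [Pi.sub_apply, Real.norm_eq_abs]
      linarith
    rcases le_total (D n x) (C * (2 * Q x)) with h | h
    · rw [min_eq_left h]; exact le_add_self
    · rw [min_eq_right h]; exact h1
  have hlim1 : Tendsto (fun n => C * ∫⁻ x, ‖(P (ns (ms n)) - fun x => G ‖g x‖) x‖ₑ ∂μ) atTop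
      (𝓝 0) := by
    simp only [eLpNorm_one_eq_lintegral_enorm] at hPg
    simpa using ENNReal.Tendsto.const_mul (hPg.comp hnm) (Or.inr hCt)
  have hlim2 : Tendsto (fun n => ∫⁻ x, min (D (ns (ms n)) x) (C * (2 * Q x)) ∂μ) atTop (𝓝 0) := by
    have := tendsto_lintegral_of_dominated_convergence' (μ := μ)
      (F := fun n x => min (D (ns (ms n)) x) (C * (2 * Q x))) (f := fun _ => 0)
      (fun x => C * (2 * Q x)) (fun n => (hDm _).min ((hQm.const_mul _).const_mul _))
      (fun n => Eventually.of_forall fun x => min_le_right _ _) ?_ ?_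
    · simpa using this
    · rw [lintegral_const_mul' _ _ hCt, lintegral_const_mul' _ _ (by simp)]
      exact ENNReal.mul_ne_top hCt (ENNReal.mul_ne_top (by simp) hGg.ne)
    · filter_upwards [hae] with x hx
      have h1 : Tendsto (fun n => D (ns (ms n)) x) atTop (𝓝 0) := by
        have h2 : Tendsto (fun n => f (ns (ms n)) x - g x) atTop (𝓝 0) := by
          simpa using hx.sub_const (g x)
        have h3 := ((hG.continuous_comp_norm (E := E)).tendsto 0).comp h2
        simp only [norm_zero, hG.map_zero] at h3
        simpa [hD] using ENNReal.tendsto_ofReal h3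
      refine tendsto_of_tendsto_of_tendsto_of_le_of_le tendsto_const_nhds h1
        (fun _ => zero_le) (fun n => min_le_left _ _)
  refine tendsto_of_tendsto_of_tendsto_of_le_of_le tendsto_const_nhds
    (by simpa using hlim1.add hlim2) (fun _ => zero_le) fun n => ?_
  rw [← lintegral_const_mul' _ _ hCt, ← lintegral_add_left']
  · exact lintegral_mono (hpt _)
  · exact (((hP _).sub (hG.continuous_comp_norm.comp_aestronglyMeasurable hg)).enorm).const_mul _

/-! ### Modular convergence of mollifications and of their gradients -/

section Mollify

variable {N : ℕ} {F : Type*} [NormedAddCommGroup F] [NormedSpace ℝ F]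

/-- Mollification converges in the modular. -/
lemma IsGauge.tendsto_modular_mollify_sub [CompleteSpace F] {G : ℝ → ℝ} {p r : ℝ} (hG : IsGauge G p r)
    {c : ℕ → EuclideanSpace ℝ (Fin N)} (φ : ∀ n, ContDiffBump (c n)) {R : ℕ → ℝ}
    (hR : Tendsto R atTop (𝓝 0))
    (hφ : ∀ n, Metric.ball (c n) (φ n).rOut ⊆ Metric.ball 0 (R n))
    {f : EuclideanSpace ℝ (Fin N) → F} (hf : Integrable f) (hGf : modular G f volume < ⊤) :
    Tendsto (fun n => modular G (mollify (φ n) f - f) volume) atTop (𝓝 0) := by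
  have hGi : Integrable fun x => G ‖f x‖ := by
    refine ⟨hG.continuous_comp_norm.comp_aestronglyMeasurable hf.1, ?_⟩
    rw [hasFiniteIntegral_iff_ofReal (Eventually.of_forall fun x => hG.nonneg (norm_nonneg _))]
    exact hGf
  -- By Jensen the modular density of the mollification is dominated by the mollified modular
  -- density, which converges in `L¹`.
  exact hG.tendsto_modular_sub (P := fun n => mollify (φ n) fun x => G ‖f x‖)
    (fun n => (continuous_mollify (φ n) hf.locallyIntegrable).aestronglyMeasurable) hf.1
    (tendsto_eLpNorm_mollify_sub φ hR hφ hf) (fun n x => hG.map_mollify_le (φ n) hf hGi x)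
    (fun n => (continuous_mollify (φ n) hGi.locallyIntegrable).aestronglyMeasurable) hGf
    (tendsto_eLpNorm_mollify_sub φ hR hφ hGi)

variable {c : EuclideanSpace ℝ (Fin N)} (φ : ContDiffBump c)

lemma exists_ne_zero_of_mollify_ne_zero {f : EuclideanSpace ℝ (Fin N) → F}
    {x : EuclideanSpace ℝ (Fin N)} (hx : mollify φ f x ≠ 0) :
    ∃ z ∈ Metric.ball c φ.rOut, f (x - z) ≠ 0 := by
  by_contra! hcon
  apply hx
  rw [mollify]
  apply integral_eq_zero_of_ae
  filter_upwards [ae_bumpMeasure_mem_ball φ] with z hz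
  exact hcon z hz

lemma fderiv_convolution_apply {E : Type*} [NormedAddCommGroup E] [NormedSpace ℝ E]
    [FiniteDimensional ℝ E] [MeasurableSpace E] [BorelSpace E] {μ : Measure E}
    [μ.IsAddHaarMeasure] {k u : E → ℝ} (hk : ContDiff ℝ 1 k)
    (hc : HasCompactSupport k) (hu : LocallyIntegrable u μ) (x e : E) :
    fderiv ℝ (convolution k u (ContinuousLinearMap.lsmul ℝ ℝ) μ) x e
      = ∫ z, fderiv ℝ k z e * u (x - z) ∂μ := by
  have h1 := hc.hasFDerivAt_convolution_left (ContinuousLinearMap.lsmul ℝ ℝ) hk hu x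
  have h2 := (hc.fderiv ℝ).convolutionExists_left ((ContinuousLinearMap.lsmul ℝ ℝ).precompL E)
        (hk.continuous_fderiv one_ne_zero) hu x
  rw [h1.fderiv, convolution_def, ContinuousLinearMap.integral_apply h2]
  simp

/-- The gradient of a mollified function is the mollified weak gradient. -/
lemma gradient_mollify {u : EuclideanSpace ℝ (Fin N) → ℝ}
    {V : EuclideanSpace ℝ (Fin N) → EuclideanSpace ℝ (Fin N)}
    (h : HasWeakGradient Set.univ u V) :
    gradient (mollify φ u) = mollify φ V := by
  have hu : LocallyIntegrable u := locallyIntegrableOn_univ.1 h.1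
  have hV : LocallyIntegrable V := locallyIntegrableOn_univ.1 h.2
  ext x i
  set e : EuclideanSpace ℝ (Fin N) := EuclideanSpace.single i 1 with he
  have h2 : gradient (mollify φ u) x i
      = ∫ z, fderiv ℝ (φ.normed volume) z e * u (x - z) := by
    rw [gradient_apply, mollify_eq_convolution]
    exact fderiv_convolution_apply (φ.contDiff_normed (n := 1)) φ.hasCompactSupport_normed hu x e
  have h3 : mollify φ V x i = ∫ z, φ.normed volume z * V (x - z) i := by
    have h4 := (EuclideanSpace.proj (𝕜 := ℝ) i : EuclideanSpace ℝ (Fin N) →L[ℝ] ℝ).integral_comp_comm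
      (integrable_bumpMeasure_comp_sub φ hV x)
    have h5 : mollify φ V x i = ∫ z, V (x - z) i ∂(bumpMeasure φ) := h4.symm
    rw [h5, integral_bumpMeasure]
    simp
  rw [h2, h3, ← integral_sub_left_eq_self _ _ x, ← integral_sub_left_eq_self (fun z =>
    φ.normed volume z * V (x - z) i) _ x]
  simp only [sub_sub_cancel]
  -- The reflected kernel is the test function. Its reflection supplies the sign that cancels the
  -- minus in the weak gradient identity.
  set η : EuclideanSpace ℝ (Fin N) → ℝ := fun y => φ.normed volume (x - y) with hη
  have hηc : ContDiff ℝ ∞ η := φ.contDiff_normed.comp (contDiff_const.sub contDiff_id)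
  have hηt : η ∈ testFunctions (Set.univ : Set (EuclideanSpace ℝ (Fin N))) :=
    ⟨hηc, φ.hasCompactSupport_normed.comp_homeomorph (Homeomorph.subLeft x), Set.subset_univ _⟩
  have h6 : ∀ y, fderiv ℝ η y e = - fderiv ℝ (φ.normed volume) (x - y) e := by
    intro y
    have h7 : HasFDerivAt (φ.normed volume) (fderiv ℝ (φ.normed volume) (x - y)) (x - y) :=
      ((φ.contDiff_normed (n := 1)).differentiable one_ne_zero _).hasFDerivAt
    have h8 := h7.comp y ((hasFDerivAt_id y).const_sub x)
    have h9 : HasFDerivAt η _ y := h8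
    rw [h9.fderiv]
    simp
  have h10 := h.integral_eq η hηt i
  simp only [Measure.restrict_univ, ← he, h6, mul_neg, integral_neg, neg_inj] at h10
  simp only [mul_comm _ (u _), mul_comm _ (V _ i)]
  exact h10

end Mollify

/-! ### The negative part -/

/-- A `C¹` approximation of the negative part that vanishes on `[-ε, ∞)`. -/
def smoothNeg (ε s : ℝ) : ℝ := √(max (-(s + ε)) 0 ^ 2 + ε ^ 2) - ε

/-- The derivative of `smoothNeg`. -/
def smoothNegDeriv (ε s : ℝ) : ℝ := -max (-(s + ε)) 0 / √(max (-(s + ε)) 0 ^ 2 + ε ^ 2)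

/-- The derivative of the negative part. -/
def negPartDeriv (s : ℝ) : ℝ := (Set.Iio (0 : ℝ)).indicator (fun _ => -1) s

lemma measurable_negPartDeriv : Measurable negPartDeriv :=
  measurable_const.indicator measurableSet_Iio

lemma abs_negPartDeriv_le (s : ℝ) : |negPartDeriv s| ≤ 1 := by
  by_cases h : s < 0 <;> simp [negPartDeriv, h]

lemma hasDerivAt_negPart_sq (s : ℝ) :
    HasDerivAt (fun s : ℝ => max (-s) 0 ^ 2) (-2 * max (-s) 0) s := by
  rcases lt_trichotomy s 0 with h | rfl | h
  · have h1 : HasDerivAt (fun s : ℝ => s ^ 2) (2 * s) s := by simpa using hasDerivAt_pow 2 s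
    have h2 : max (-s) 0 = -s := max_eq_left (by linarith)
    rw [h2]
    refine (h1.congr_of_eventuallyEq ?_).congr_deriv (by ring)
    filter_upwards [gt_mem_nhds h] with t ht
    rw [max_eq_left (by linarith)]; ring
  · rw [hasDerivAt_iff_isLittleO_nhds_zero]
    simp only [zero_add, neg_zero, max_self, ne_eq, OfNat.ofNat_ne_zero, not_false_eq_true,
      zero_pow, sub_zero, mul_zero, smul_zero]
    -- Squaring removes the kink at the origin.
    have h1 : (fun h : ℝ => max (-h) 0 ^ 2) =O[𝓝 0] fun h : ℝ => h ^ 2 := by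
      refine Asymptotics.isBigO_of_le _ fun t => ?_
      rw [norm_pow, norm_pow]
      refine pow_le_pow_left₀ (norm_nonneg _) ?_ 2
      rw [Real.norm_eq_abs, abs_of_nonneg (le_max_right _ _)]
      exact max_le (neg_le_abs t) (abs_nonneg t)
    refine h1.trans_isLittleO ?_
    simpa using (Asymptotics.isLittleO_pow_id (𝕜 := ℝ) (n := 2) one_lt_two)
  · have h2 : max (-s) 0 = 0 := max_eq_right (by linarith)
    rw [h2, mul_zero]
    refine (hasDerivAt_const s (0 : ℝ)).congr_of_eventuallyEq ?_
    filter_upwards [lt_mem_nhds h] with t ht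
    rw [max_eq_right (by linarith)]; ring

section smoothNeg

variable {ε : ℝ}

lemma smoothNeg_sqrt_pos (hε : 0 < ε) (s : ℝ) : 0 < √(max (-(s + ε)) 0 ^ 2 + ε ^ 2) :=
  Real.sqrt_pos.2 (by positivity)

lemma hasDerivAt_smoothNeg (hε : 0 < ε) (s : ℝ) :
    HasDerivAt (smoothNeg ε) (smoothNegDeriv ε s) s := by
  have h1 : HasDerivAt (fun s : ℝ => max (-(s + ε)) 0 ^ 2) (-2 * max (-(s + ε)) 0) s := by
    have h0 := (hasDerivAt_negPart_sq (s + ε)).comp s ((hasDerivAt_id s).add_const ε)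
    rw [mul_one] at h0
    exact h0
  have h2 := ((h1.add_const (ε ^ 2)).sqrt (by positivity)).sub_const ε
  refine h2.congr_deriv ?_
  have := smoothNeg_sqrt_pos hε s
  rw [smoothNegDeriv]
  field_simp

lemma continuous_smoothNegDeriv (hε : 0 < ε) : Continuous (smoothNegDeriv ε) := by
  unfold smoothNegDeriv
  exact Continuous.div (by fun_prop) (by fun_prop) fun s => (smoothNeg_sqrt_pos hε s).ne'

lemma contDiff_smoothNeg (hε : 0 < ε) : ContDiff ℝ 1 (smoothNeg ε) := by
  rw [contDiff_one_iff_deriv]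
  refine ⟨fun s => (hasDerivAt_smoothNeg hε s).differentiableAt, ?_⟩
  have : deriv (smoothNeg ε) = smoothNegDeriv ε :=
    funext fun s => (hasDerivAt_smoothNeg hε s).deriv
  rw [this]
  exact continuous_smoothNegDeriv hε

lemma abs_smoothNegDeriv_le (hε : 0 < ε) (s : ℝ) : |smoothNegDeriv ε s| ≤ 1 := by
  rw [smoothNegDeriv, abs_div, abs_neg, abs_of_pos (smoothNeg_sqrt_pos hε s),
    div_le_one (smoothNeg_sqrt_pos hε s)]
  exact Real.abs_le_sqrt (by nlinarith [sq_nonneg ε])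

/-- The shift by `ε` in the bound absorbs an oscillation of size `ε`: if `|s - t| < ε`, then
`smoothNeg ε s` is controlled by the negative part of `t`. -/
lemma abs_smoothNeg_le (hε : 0 < ε) (s : ℝ) : |smoothNeg ε s| ≤ max (-(s + ε)) 0 := by
  have h1 : ε ≤ √(max (-(s + ε)) 0 ^ 2 + ε ^ 2) := Real.le_sqrt_of_sq_le (by nlinarith [sq_nonneg (max (-(s + ε)) 0)])
  have h2 : √(max (-(s + ε)) 0 ^ 2 + ε ^ 2) ≤ max (-(s + ε)) 0 + ε := by
    rw [Real.sqrt_le_left (by positivity)]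
    have : 0 ≤ max (-(s + ε)) 0 := le_max_right _ _
    nlinarith
  rw [smoothNeg, abs_of_nonneg (by linarith)]
  linarith

lemma abs_smoothNeg_sub_le (hε : 0 < ε) (s t : ℝ) :
    |smoothNeg ε s - smoothNeg ε t| ≤ |s - t| := by
  have := Convex.norm_image_sub_le_of_norm_hasDerivWithin_le (C := 1) (s := Set.univ)
    (fun x _ => (hasDerivAt_smoothNeg hε x).hasDerivWithinAt)
    (fun x _ => abs_smoothNegDeriv_le hε x) convex_univ (Set.mem_univ t) (Set.mem_univ s)
  simpa using this

lemma tendsto_smoothNeg (s : ℝ) :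
    Tendsto (fun ε => smoothNeg ε s) (𝓝[>] 0) (𝓝 (max (-s) 0)) := by
  have h1 : Continuous fun ε => smoothNeg ε s := by unfold smoothNeg; fun_prop
  have h2 := (h1.tendsto 0).mono_left (nhdsWithin_le_nhds (s := Set.Ioi 0))
  simpa [smoothNeg] using h2

/-- For `s ≥ 0` the approximating derivatives vanish for every `ε > 0`. The limit at `s = 0` is
therefore `0`, matching the open half-line in `negPartDeriv`. -/
lemma tendsto_smoothNegDeriv (s : ℝ) :
    Tendsto (fun ε => smoothNegDeriv ε s) (𝓝[>] 0) (𝓝 (negPartDeriv s)) := by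
  by_cases hs : s < 0
  · have h1 : ContinuousAt (fun ε => smoothNegDeriv ε s) 0 := by
      unfold smoothNegDeriv
      refine ContinuousAt.div (by fun_prop) (by fun_prop) ?_
      rw [Real.sqrt_ne_zero']
      have : 0 < max (-(s + 0)) 0 := lt_max_of_lt_left (by linarith)
      positivity
    have h2 := h1.tendsto.mono_left (nhdsWithin_le_nhds (s := Set.Ioi 0))
    have h3 : max (-s) 0 = -s := max_eq_left (by linarith)
    have h4 : smoothNegDeriv 0 s = negPartDeriv s := by
      simp only [smoothNegDeriv, negPartDeriv, add_zero, h3, ne_eq, OfNat.ofNat_ne_zero,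
        not_false_eq_true, zero_pow, Set.indicator_of_mem (Set.mem_Iio.2 hs)]
      rw [Real.sqrt_sq (by linarith), neg_div, div_self (by linarith)]
    rwa [h4] at h2
  · refine tendsto_const_nhds.congr' ?_
    filter_upwards [self_mem_nhdsWithin] with ε hε
    have : max (-(s + ε)) 0 = 0 := max_eq_right (by linarith [Set.mem_Ioi.1 hε])
    rw [smoothNegDeriv, this, negPartDeriv, Set.indicator_of_notMem (by simpa using hs)]
    simp

end smoothNeg

/-! ### Weak differentiability of the zero extension of the negative part -/

section

variable {m : ℕ} {Ω : Set (EuclideanSpace ℝ (Fin (m + 1)))}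
  {u : EuclideanSpace ℝ (Fin (m + 1)) → ℝ}
  {V : EuclideanSpace ℝ (Fin (m + 1)) → EuclideanSpace ℝ (Fin (m + 1))}
  {ζ : ℕ → EuclideanSpace ℝ (Fin (m + 1)) → ℝ}
  {η : EuclideanSpace ℝ (Fin (m + 1)) → ℝ}

/-- Supplies the majorant `w` for the boundary estimate. Uniform continuity of `z` on the support of
`η` makes its oscillation less than `ε`, which the shift in `smoothNeg` absorbs. -/
lemma exists_dist_le_smoothNeg_le {ε : ℝ} (hε : 0 < ε)
    {z : EuclideanSpace ℝ (Fin (m + 1)) → ℝ} (hz : Continuous z) (hη : HasCompactSupport η)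
    {M : ℝ} (hM : ∀ x, |η x| ≤ M) :
    ∃ δ > 0, ∀ x y, dist x y ≤ δ →
      ‖smoothNeg ε (z x) * η x‖ₑ ≤ ENNReal.ofReal M * ENNReal.ofReal (max (-z y) 0) := by
  have hM0 : 0 ≤ M := (abs_nonneg _).trans (hM 0)
  have h1 := hη.isCompact.uniformContinuousAt_of_continuousAt z
    (fun a _ => hz.continuousAt) (Metric.dist_mem_uniformity hε)
  obtain ⟨δ, hδ, h2⟩ := Metric.mem_uniformity_dist.1 h1
  refine ⟨δ / 2, by linarith, fun x y hxy => ?_⟩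
  by_cases hx : x ∈ tsupport η
  · have h3 : dist (z x) (z y) < ε := h2 (show dist x y < δ by linarith) hx
    rw [Real.dist_eq] at h3
    rw [← ENNReal.ofReal_mul hM0, ← ofReal_norm]
    refine ENNReal.ofReal_le_ofReal ?_
    rw [norm_mul, mul_comm, Real.norm_eq_abs, Real.norm_eq_abs]
    refine mul_le_mul (hM x) ((abs_smoothNeg_le hε _).trans ?_) (abs_nonneg _) hM0
    exact max_le_max_right _ (by linarith [(abs_lt.1 h3).1])
  · simp [image_eq_zero_of_notMem_tsupport hx]

/-- Integration by parts without boundary term for `smoothNeg ε ∘ u`, where the boundary values of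
`u` are non-negative. -/
lemma integral_smoothNeg_eq_zero (hΩ : MeasurableSet Ω) (hΩfin : volume Ω ≠ ⊤)
    (hu : IntegrableOn u Ω) (hV : IntegrableOn V Ω) (hζ : ∀ n, ContDiff ℝ 1 (ζ n))
    (hζu : Tendsto (fun n => eLpNorm (ζ n - u) 1 (volume.restrict Ω)) atTop (𝓝 0))
    (hae : ∀ᵐ x ∂(volume.restrict Ω), Tendsto (fun n => ζ n x) atTop (𝓝 (u x)))
    (hζV : Tendsto (fun n => eLpNorm (gradient (ζ n) - V) 1 (volume.restrict Ω)) atTop (𝓝 0))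
    (hneg : Tendsto (fun n => ∫⁻ x, ENNReal.ofReal (max (-ζ n x) 0) ∂(surfaceMeasure Ω))
      atTop (𝓝 0))
    (hη : ContDiff ℝ 1 η) (hηc : HasCompactSupport η) (i : Fin (m + 1)) {ε : ℝ} (hε : 0 < ε) :
    ∫ x in Ω, (smoothNeg ε (u x) * fderiv ℝ η x (EuclideanSpace.single i 1)
      + smoothNegDeriv ε (u x) * V x i * η x) = 0 := by
  set e : EuclideanSpace ℝ (Fin (m + 1)) := EuclideanSpace.single i 1 with he
  obtain ⟨M, hM⟩ := hηc.exists_bound_of_continuous hη.continuous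
  obtain ⟨M', hM'⟩ := (hasCompactSupport_partial hηc e).exists_bound_of_continuous
    (continuous_partial hη e)
  have hM0 : 0 ≤ M := (norm_nonneg _).trans (hM 0)
  have hM'0 : 0 ≤ M' := (norm_nonneg _).trans (hM' 0)
  have hcd : ∀ n, ContDiff ℝ 1 fun x => smoothNeg ε (ζ n x) * η x := fun n =>
    ((contDiff_smoothNeg hε).comp (hζ n)).mul hη
  have hder : ∀ n x, fderiv ℝ (fun x => smoothNeg ε (ζ n x) * η x) x e
      = smoothNeg ε (ζ n x) * fderiv ℝ η x e + smoothNegDeriv ε (ζ n x) * gradient (ζ n) x i * η x := by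
    intro n x
    have h1 : HasFDerivAt (fun x => smoothNeg ε (ζ n x)) (smoothNegDeriv ε (ζ n x) •
        fderiv ℝ (ζ n) x) x := (hasDerivAt_smoothNeg hε (ζ n x)).comp_hasFDerivAt x
          ((hζ n).differentiable one_ne_zero x).hasFDerivAt
    have h2 : HasFDerivAt (fun x => smoothNeg ε (ζ n x) * η x) _ x :=
      h1.mul (hη.differentiable one_ne_zero x).hasFDerivAt
    rw [h2.fderiv, gradient_apply]
    simp
    ring
  have hbound : ∀ n, ‖∫ x in Ω, fderiv ℝ (fun x => smoothNeg ε (ζ n x) * η x) x e‖ₑ ≤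
      2 * (ENNReal.ofReal M * ∫⁻ x, ENNReal.ofReal (max (-ζ n x) 0) ∂(surfaceMeasure Ω)) := by
    intro n
    obtain ⟨δ, hδ, h⟩ := exists_dist_le_smoothNeg_le hε (hζ n).continuous hηc hM
    rw [← lintegral_const_mul' _ _ ENNReal.ofReal_ne_top]
    exact enorm_setIntegral_partial_le hΩ hΩfin i (hcd n) hηc.mul_left hδ h
  have hlim0 : Tendsto (fun n => ∫ x in Ω, fderiv ℝ (fun x => smoothNeg ε (ζ n x) * η x) x e)
      atTop (𝓝 0) := by
    rw [tendsto_zero_iff_enorm_tendsto_zero]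
    refine tendsto_of_tendsto_of_tendsto_of_le_of_le tendsto_const_nhds ?_ (fun _ => zero_le) hbound
    simpa using ENNReal.Tendsto.const_mul (ENNReal.Tendsto.const_mul hneg
      (Or.inr (ENNReal.ofReal_ne_top (r := M)))) (Or.inr ENNReal.ofNat_ne_top)
  refine tendsto_nhds_unique ?_ hlim0
  have hucont : AEStronglyMeasurable (fun x => smoothNegDeriv ε (u x)) (volume.restrict Ω) :=
    (continuous_smoothNegDeriv hε).comp_aestronglyMeasurable hu.1
  have hVi : IntegrableOn (fun x => V x i) Ω :=
    (EuclideanSpace.proj (𝕜 := ℝ) i).integrable_comp hV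
  have hDmeas : ∀ n, AEMeasurable (fun x => ‖(smoothNegDeriv ε (ζ n x) - smoothNegDeriv ε (u x)) *
      V x i‖ₑ) (volume.restrict Ω) := fun n =>
    (((((continuous_smoothNegDeriv hε).comp (hζ n).continuous).aestronglyMeasurable).sub
      hucont).mul hVi.1).enorm
  -- The coefficients `smoothNegDeriv ε (ζ n)` converge only a.e., so they are paired with the fixed
  -- function `V` and handled by dominated convergence.
  have hDlim : Tendsto (fun n => ∫⁻ x in Ω,
      ‖(smoothNegDeriv ε (ζ n x) - smoothNegDeriv ε (u x)) * V x i‖ₑ) atTop (𝓝 0) := by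
    have := tendsto_lintegral_of_dominated_convergence' (μ := volume.restrict Ω)
      (F := fun n x => ‖(smoothNegDeriv ε (ζ n x) - smoothNegDeriv ε (u x)) * V x i‖ₑ)
      (f := fun _ => 0) (fun x => 2 * ‖V x i‖ₑ) hDmeas ?_ ?_ ?_
    · simpa using this
    · refine fun n => Eventually.of_forall fun x => ?_
      simp only [enorm_mul]
      gcongr
      rw [← ofReal_norm, ← ENNReal.ofReal_ofNat 2]
      refine ENNReal.ofReal_le_ofReal ((norm_sub_le _ _).trans ?_)
      rw [Real.norm_eq_abs, Real.norm_eq_abs]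
      linarith [abs_smoothNegDeriv_le hε (ζ n x), abs_smoothNegDeriv_le hε (u x)]
    · rw [lintegral_const_mul' _ _ (by simp)]
      exact ENNReal.mul_ne_top (by simp) hVi.2.ne
    · filter_upwards [hae] with x hx
      have h1 := (((continuous_smoothNegDeriv hε).tendsto (u x)).comp hx).sub_const
        (smoothNegDeriv ε (u x))
      have h2 := (continuous_enorm.tendsto _).comp (h1.mul_const (V x i))
      simpa [Function.comp_def] using h2
  have hpt : ∀ n x, ‖(smoothNeg ε (ζ n x) * fderiv ℝ η x e
        + smoothNegDeriv ε (ζ n x) * gradient (ζ n) x i * η x) -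
        (smoothNeg ε (u x) * fderiv ℝ η x e + smoothNegDeriv ε (u x) * V x i * η x)‖ₑ ≤
      ENNReal.ofReal M' * ‖(ζ n - u) x‖ₑ + ENNReal.ofReal M * ‖(gradient (ζ n) - V) x‖ₑ +
      ENNReal.ofReal M * ‖(smoothNegDeriv ε (ζ n x) - smoothNegDeriv ε (u x)) * V x i‖ₑ := by
    intro n x
    simp only [← ofReal_norm]
    rw [← ENNReal.ofReal_mul hM'0, ← ENNReal.ofReal_mul hM0, ← ENNReal.ofReal_mul hM0,
      ← ENNReal.ofReal_add (by positivity) (by positivity),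
      ← ENNReal.ofReal_add (by positivity) (by positivity)]
    refine ENNReal.ofReal_le_ofReal ?_
    -- The three errors come from `ζ n - u`, from `∇ζ n - V`, and from the change of coefficient in
    -- front of `V`.
    have hsplit : (smoothNeg ε (ζ n x) * fderiv ℝ η x e
        + smoothNegDeriv ε (ζ n x) * gradient (ζ n) x i * η x) -
        (smoothNeg ε (u x) * fderiv ℝ η x e + smoothNegDeriv ε (u x) * V x i * η x)
        = fderiv ℝ η x e * (smoothNeg ε (ζ n x) - smoothNeg ε (u x))
        + η x * (smoothNegDeriv ε (ζ n x) * (gradient (ζ n) - V) x i)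
        + η x * ((smoothNegDeriv ε (ζ n x) - smoothNegDeriv ε (u x)) * V x i) := by
      simp only [Pi.sub_apply, PiLp.sub_apply]; ring
    rw [hsplit]
    refine (norm_add₃_le).trans ?_
    refine add_le_add (add_le_add ?_ ?_) ?_ <;> rw [norm_mul]
    · exact mul_le_mul (hM' x) (abs_smoothNeg_sub_le hε _ _) (norm_nonneg _) hM'0
    · refine mul_le_mul (hM x) ?_ (norm_nonneg _) hM0
      rw [norm_mul]
      exact (mul_le_of_le_one_left (norm_nonneg _) (abs_smoothNegDeriv_le hε _)).trans
        (PiLp.norm_apply_le _ i)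
    · exact mul_le_mul_of_nonneg_right (hM x) (norm_nonneg _)
  have hmeas1 : AEStronglyMeasurable (fun x => smoothNeg ε (u x) * fderiv ℝ η x e)
      (volume.restrict Ω) :=
    ((contDiff_smoothNeg hε).continuous.comp_aestronglyMeasurable hu.1).mul
      (continuous_partial hη e).aestronglyMeasurable
  have hmeas2 : AEStronglyMeasurable (fun x => smoothNegDeriv ε (u x) * V x i * η x)
      (volume.restrict Ω) := (hucont.mul hVi.1).mul hη.continuous.aestronglyMeasurable
  refine tendsto_integral_of_L1 _ (hmeas1.add hmeas2) ?_ ?_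
  · refine Eventually.of_forall fun n => ?_
    exact ((continuous_partial (hcd n) e).integrable_of_hasCompactSupport
      (hasCompactSupport_partial hηc.mul_left e)).integrableOn
  · simp only [eLpNorm_one_eq_lintegral_enorm] at hζu hζV
    have hsum := (((ENNReal.Tendsto.const_mul hζu (Or.inr (ENNReal.ofReal_ne_top (r := M')))).add
      (ENNReal.Tendsto.const_mul hζV (Or.inr (ENNReal.ofReal_ne_top (r := M))))).add
      (ENNReal.Tendsto.const_mul hDlim (Or.inr (ENNReal.ofReal_ne_top (r := M)))))
    simp only [mul_zero, add_zero] at hsum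
    refine tendsto_of_tendsto_of_tendsto_of_le_of_le tendsto_const_nhds hsum
      (fun _ => zero_le) fun n => ?_
    simp only [hder]
    rw [← lintegral_const_mul' _ _ ENNReal.ofReal_ne_top,
      ← lintegral_const_mul' _ _ ENNReal.ofReal_ne_top,
      ← lintegral_const_mul' _ _ ENNReal.ofReal_ne_top, ← lintegral_add_left',
      ← lintegral_add_left']
    · exact lintegral_mono (hpt n)
    · exact (AEMeasurable.const_mul ((hζ n).continuous.aestronglyMeasurable.sub hu.1).enorm _).add
        (AEMeasurable.const_mul
          ((continuous_gradient (hζ n)).aestronglyMeasurable.sub hV.1).enorm _)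
    · exact AEMeasurable.const_mul ((hζ n).continuous.aestronglyMeasurable.sub hu.1).enorm _

/-- If `u` is a limit in `W^{1,1}(Ω)` of functions whose negative parts tend to zero in `L¹(∂Ω)`,
then the extension by zero of the negative part of `u` is weakly differentiable in the whole
space. -/
lemma hasWeakGradient_indicator_negPart (hΩ : MeasurableSet Ω) (hΩfin : volume Ω ≠ ⊤)
    (hu : IntegrableOn u Ω) (hV : IntegrableOn V Ω) (hζ : ∀ n, ContDiff ℝ 1 (ζ n))
    (hζu : Tendsto (fun n => eLpNorm (ζ n - u) 1 (volume.restrict Ω)) atTop (𝓝 0))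
    (hζV : Tendsto (fun n => eLpNorm (gradient (ζ n) - V) 1 (volume.restrict Ω)) atTop (𝓝 0))
    (hneg : Tendsto (fun n => ∫⁻ x, ENNReal.ofReal (max (-ζ n x) 0) ∂(surfaceMeasure Ω))
      atTop (𝓝 0)) :
    Integrable (Ω.indicator fun x => max (-u x) 0) ∧
    Integrable (Ω.indicator fun x => negPartDeriv (u x) • V x) ∧
    HasWeakGradient Set.univ (Ω.indicator fun x => max (-u x) 0)
      (Ω.indicator fun x => negPartDeriv (u x) • V x) := by
  have hU : IntegrableOn (fun x => max (-u x) 0) Ω := hu.neg.pos_part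
  have hsm : AEStronglyMeasurable (fun x => negPartDeriv (u x)) (volume.restrict Ω) :=
    (measurable_negPartDeriv.comp_aemeasurable hu.1.aemeasurable).aestronglyMeasurable
  have hW : IntegrableOn (fun x => negPartDeriv (u x) • V x) Ω := by
    refine Integrable.mono hV (hsm.smul hV.1) (Eventually.of_forall fun x => ?_)
    rw [norm_smul]
    exact mul_le_of_le_one_left (norm_nonneg _) (abs_negPartDeriv_le _)
  have hU' := hU.integrable_indicator hΩ
  have hW' := hW.integrable_indicator hΩ
  refine ⟨hU', hW', hU'.locallyIntegrable.locallyIntegrableOn _,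
    hW'.locallyIntegrable.locallyIntegrableOn _, fun η hη i => ?_⟩
  obtain ⟨hηcd, hηc, -⟩ := hη
  have hη1 : ContDiff ℝ 1 η := hηcd.of_le (by simp)
  set e : EuclideanSpace ℝ (Fin (m + 1)) := EuclideanSpace.single i 1 with he
  obtain ⟨M, hM⟩ := hηc.exists_bound_of_continuous hη1.continuous
  obtain ⟨M', hM'⟩ := (hasCompactSupport_partial hηc e).exists_bound_of_continuous
    (continuous_partial hη1 e)
  -- A subsequence converging a.e. is needed for the coefficients above; the `L¹` and boundary
  -- limits pass to it.
  obtain ⟨ns, hns, hae⟩ := (tendstoInMeasure_of_tendsto_eLpNorm one_ne_zero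
    (fun n => (hζ n).continuous.aestronglyMeasurable) hu.1 hζu).exists_seq_tendsto_ae
  have hVi : IntegrableOn (fun x => V x i) Ω :=
    (EuclideanSpace.proj (𝕜 := ℝ) i).integrable_comp hV
  have hlim : Tendsto (fun ε => ∫ x in Ω, (smoothNeg ε (u x) * fderiv ℝ η x e
      + smoothNegDeriv ε (u x) * V x i * η x)) (𝓝[>] 0) (𝓝 (∫ x in Ω,
      (max (-u x) 0 * fderiv ℝ η x e + negPartDeriv (u x) * V x i * η x))) := by
    refine tendsto_integral_filter_of_dominated_convergence
      (fun x => M' * ‖u x‖ + M * ‖V x i‖) ?_ ?_ ?_ ?_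
    · filter_upwards [self_mem_nhdsWithin] with ε hε
      exact (((contDiff_smoothNeg hε).continuous.comp_aestronglyMeasurable hu.1).mul
        (continuous_partial hη1 e).aestronglyMeasurable).add
        ((((continuous_smoothNegDeriv hε).comp_aestronglyMeasurable hu.1).mul hVi.1).mul
        hη1.continuous.aestronglyMeasurable)
    · filter_upwards [self_mem_nhdsWithin] with ε hε
      refine Eventually.of_forall fun x => (norm_add_le _ _).trans (add_le_add ?_ ?_)
      · rw [norm_mul, mul_comm]
        refine mul_le_mul (hM' x) ((abs_smoothNeg_le hε _).trans ?_) (norm_nonneg _)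
          ((norm_nonneg _).trans (hM' x))
        exact max_le (by linarith [neg_le_abs (u x), Set.mem_Ioi.1 hε, Real.norm_eq_abs (u x)])
          (norm_nonneg _)
      · rw [norm_mul, norm_mul, mul_comm]
        refine mul_le_mul (hM x) ?_ (by positivity) ((norm_nonneg _).trans (hM x))
        exact mul_le_of_le_one_left (norm_nonneg _) (abs_smoothNegDeriv_le hε _)
    · exact (hu.norm.const_mul _).add (hVi.norm.const_mul _)
    · exact Eventually.of_forall fun x => ((tendsto_smoothNeg _).mul_const _).add
        (((tendsto_smoothNegDeriv _).mul_const _).mul_const _)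
  have hzero : ∫ x in Ω, (max (-u x) 0 * fderiv ℝ η x e + negPartDeriv (u x) * V x i * η x) = 0 := by
    refine tendsto_nhds_unique hlim (tendsto_const_nhds.congr' ?_)
    filter_upwards [self_mem_nhdsWithin] with ε hε
    exact (integral_smoothNeg_eq_zero hΩ hΩfin hu hV (fun n => hζ (ns n))
      (hζu.comp hns.tendsto_atTop) hae (hζV.comp hns.tendsto_atTop)
      (hneg.comp hns.tendsto_atTop) hη1 hηc i hε).symm
  have hint1 : IntegrableOn (fun x => max (-u x) 0 * fderiv ℝ η x e) Ω :=
    hU.mul_bdd (continuous_partial hη1 e).aestronglyMeasurable (Eventually.of_forall hM')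
  have hint2 : IntegrableOn (fun x => negPartDeriv (u x) * V x i * η x) Ω := by
    have h1 : IntegrableOn (fun x => negPartDeriv (u x) * V x i) Ω := by
      have h2 := (EuclideanSpace.proj (𝕜 := ℝ) i).integrable_comp hW
      simpa [IntegrableOn] using h2
    exact h1.mul_bdd hη1.continuous.aestronglyMeasurable (Eventually.of_forall hM)
  rw [integral_add hint1 hint2] at hzero
  have e1 : ∫ x in Set.univ, Ω.indicator (fun x => max (-u x) 0) x * fderiv ℝ η x e
      = ∫ x in Ω, max (-u x) 0 * fderiv ℝ η x e := by
    rw [Measure.restrict_univ, ← integral_indicator hΩ]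
    congr 1 with x
    by_cases hx : x ∈ Ω <;> simp [hx]
  have e2 : ∫ x in Set.univ, (Ω.indicator (fun x => negPartDeriv (u x) • V x) x) i * η x
      = ∫ x in Ω, negPartDeriv (u x) * V x i * η x := by
    rw [Measure.restrict_univ, ← integral_indicator hΩ]
    congr 1 with x
    by_cases hx : x ∈ Ω <;> simp [hx]
  rw [e1, e2]
  linarith

end

/-! ### The space `W^{1,G}_0` -/

section ZeroSpace

variable {N : ℕ} {Ω : Set (EuclideanSpace ℝ (Fin N))} {G : ℝ → ℝ} {p r : ℝ}
  {u u' : EuclideanSpace ℝ (Fin N) → ℝ} {V V' : EuclideanSpace ℝ (Fin N) → EuclideanSpace ℝ (Fin N)}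

lemma HasWeakGradient.mono_set {Ω' : Set (EuclideanSpace ℝ (Fin N))}
    (h : HasWeakGradient Ω' u V) (hΩ : Ω ⊆ Ω') : HasWeakGradient Ω u V := by
  refine ⟨h.1.mono_set hΩ, h.2.mono_set hΩ, fun η hη i => ?_⟩
  have hz : ∀ x, x ∉ Ω → η x = 0 := fun x hx =>
    image_eq_zero_of_notMem_tsupport fun hx' => hx (hη.2.2 hx')
  have hz' : ∀ x, x ∉ Ω → fderiv ℝ η x (EuclideanSpace.single i 1) = 0 := fun x hx => by
    simp [fderiv_of_notMem_tsupport ℝ fun hx' => hx (hη.2.2 hx')]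
  have h1 := h.integral_eq η ⟨hη.1, hη.2.1, hη.2.2.trans hΩ⟩ i
  rw [setIntegral_eq_integral_of_forall_compl_eq_zero
      fun x hx => by rw [hz' x fun hx' => hx (hΩ hx'), mul_zero],
    setIntegral_eq_integral_of_forall_compl_eq_zero
      fun x hx => by rw [hz x fun hx' => hx (hΩ hx'), mul_zero]] at h1
  rwa [setIntegral_eq_integral_of_forall_compl_eq_zero fun x hx => by rw [hz' x hx, mul_zero],
    setIntegral_eq_integral_of_forall_compl_eq_zero fun x hx => by rw [hz x hx, mul_zero]]

lemma HasWeakGradient.mem_orliczSobolev (hΩ : IsOpen Ω) (h : HasWeakGradient Ω u V)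
    (hu : MemOrlicz G u (volume.restrict Ω)) (hV : MemOrlicz G V (volume.restrict Ω)) :
    u ∈ orliczSobolev G Ω :=
  ⟨h.weaklyDifferentiable, hu, hV.congr (h.weakGradient_ae_eq hΩ).symm⟩

lemma hasWeakGradient_sub_test (hΩ : IsOpen Ω) (h : HasWeakGradient Ω u V)
    {η : EuclideanSpace ℝ (Fin N) → ℝ} (hη : η ∈ testFunctions Ω) :
    HasWeakGradient Ω (u - η) (V - gradient η) :=
  h.sub hΩ (hasWeakGradient_of_contDiff (hη.1.of_le (by simp)))

/-- A membership criterion with any weak gradient and modular convergence, in place of the chosen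
gradient and the norm. -/
lemma IsGauge.mem_orliczSobolevZero (hG : IsGauge G p r) (hΩ : IsOpen Ω)
    (h : HasWeakGradient Ω u V) (hu : MemOrlicz G u (volume.restrict Ω))
    (hV : MemOrlicz G V (volume.restrict Ω)) {η : ℕ → EuclideanSpace ℝ (Fin N) → ℝ}
    (hη : ∀ n, η n ∈ testFunctions Ω)
    (h1 : Tendsto (fun n => modular G (u - η n) (volume.restrict Ω)) atTop (𝓝 0))
    (h2 : Tendsto (fun n => modular G (V - gradient (η n)) (volume.restrict Ω)) atTop (𝓝 0)) :
    u ∈ orliczSobolevZero G Ω := by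
  refine ⟨h.mem_orliczSobolev hΩ hu hV, η, hη, ?_⟩
  have h3 := (hG.tendsto_luxemburgNorm_iff.2 h1).add (hG.tendsto_luxemburgNorm_iff.2 h2)
  rw [add_zero] at h3
  refine h3.congr fun n => ?_
  rw [orliczSobolevNorm,
    luxemburgNorm_congr ((hasWeakGradient_sub_test hΩ h (hη n)).weakGradient_ae_eq hΩ)]

lemma IsGauge.exists_test_tendsto (hG : IsGauge G p r) (hΩ : IsOpen Ω)
    (h : HasWeakGradient Ω u V) (hu : u ∈ orliczSobolevZero G Ω) :
    ∃ η : ℕ → EuclideanSpace ℝ (Fin N) → ℝ, (∀ n, η n ∈ testFunctions Ω) ∧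
      Tendsto (fun n => modular G (u - η n) (volume.restrict Ω)) atTop (𝓝 0) ∧
      Tendsto (fun n => modular G (V - gradient (η n)) (volume.restrict Ω)) atTop (𝓝 0) := by
  obtain ⟨-, η, hη, hlim⟩ := hu
  refine ⟨η, hη, ?_, ?_⟩
  · refine hG.tendsto_luxemburgNorm_iff.1 (tendsto_of_tendsto_of_tendsto_of_le_of_le
      tendsto_const_nhds hlim (fun _ => zero_le) fun n => ?_)
    exact le_self_add
  · refine hG.tendsto_luxemburgNorm_iff.1 (tendsto_of_tendsto_of_tendsto_of_le_of_le
      tendsto_const_nhds hlim (fun _ => zero_le) fun n => ?_)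
    rw [← luxemburgNorm_congr ((hasWeakGradient_sub_test hΩ h (hη n)).weakGradient_ae_eq hΩ)]
    exact le_add_self

lemma gradient_add_of_contDiff {f g : EuclideanSpace ℝ (Fin N) → ℝ} (hf : ContDiff ℝ 1 f)
    (hg : ContDiff ℝ 1 g) : gradient (f + g) = gradient f + gradient g := by
  ext x i
  rw [gradient_apply, fderiv_add (hf.differentiable one_ne_zero x)
    (hg.differentiable one_ne_zero x)]
  simp [gradient_apply]

lemma testFunctions_add {η η' : EuclideanSpace ℝ (Fin N) → ℝ} (hη : η ∈ testFunctions Ω)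
    (hη' : η' ∈ testFunctions Ω) : η + η' ∈ testFunctions Ω :=
  ⟨hη.1.add hη'.1, hη.2.1.add hη'.2.1,
    (tsupport_add η η').trans (Set.union_subset hη.2.2 hη'.2.2)⟩

lemma IsGauge.orliczSobolevZero_add (hG : IsGauge G p r) (hΩ : IsOpen Ω)
    (hu : u ∈ orliczSobolevZero G Ω) (hu' : u' ∈ orliczSobolevZero G Ω) :
    u + u' ∈ orliczSobolevZero G Ω := by
  have hw := hu.1.1.hasWeakGradient
  have hw' := hu'.1.1.hasWeakGradient
  obtain ⟨η, hη, h1, h2⟩ := hG.exists_test_tendsto hΩ hw hu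
  obtain ⟨η', hη', h1', h2'⟩ := hG.exists_test_tendsto hΩ hw' hu'
  have hm := hG.memOrlicz_iff.1 hu.1.2.1
  have hm' := hG.memOrlicz_iff.1 hu'.1.2.1
  have hmV := hG.memOrlicz_iff.1 hu.1.2.2
  have hmV' := hG.memOrlicz_iff.1 hu'.1.2.2
  refine hG.mem_orliczSobolevZero hΩ (hw.add hΩ hw')
    (hG.memOrlicz_iff.2 ⟨hm.1.add hm'.1, hG.modular_add_lt_top hm.1 hm.2 hm'.2⟩)
    (hG.memOrlicz_iff.2 ⟨hmV.1.add hmV'.1, hG.modular_add_lt_top hmV.1 hmV.2 hmV'.2⟩)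
    (fun n => testFunctions_add (hη n) (hη' n)) ?_ ?_
  · refine (hG.tendsto_modular_add
      (fun n => hm.1.sub (hη n).1.continuous.aestronglyMeasurable) h1 h1').congr fun n => ?_
    congr 1; abel
  · have hc : ∀ n, ContDiff ℝ 1 (η n) := fun n => (hη n).1.of_le (by simp)
    have hc' : ∀ n, ContDiff ℝ 1 (η' n) := fun n => (hη' n).1.of_le (by simp)
    refine (hG.tendsto_modular_add
      (fun n => hmV.1.sub (continuous_gradient (hc n)).aestronglyMeasurable) h2 h2').congr
      fun n => ?_
    rw [gradient_add_of_contDiff (hc n) (hc' n)]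
    congr 1; abel

/-- `U ∈ W^{1,G}(ℝᴺ) ∩ W^{1,1}(ℝᴺ)` with weak gradient `V`. -/
structure IsGlobalSobolev (G : ℝ → ℝ) (U : EuclideanSpace ℝ (Fin N) → ℝ)
    (V : EuclideanSpace ℝ (Fin N) → EuclideanSpace ℝ (Fin N)) : Prop where
  integrable : Integrable U
  integrable_grad : Integrable V
  hasWeakGradient : HasWeakGradient Set.univ U V
  modular_lt_top : modular G U volume < ⊤
  modular_grad_lt_top : modular G V volume < ⊤

lemma IsGlobalSobolev.sub (hG : IsGauge G p r) (h : IsGlobalSobolev G u V)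
    (h' : IsGlobalSobolev G u' V') : IsGlobalSobolev G (u - u') (V - V') := by
  refine ⟨h.1.sub h'.1, h.2.sub h'.2, h.3.sub isOpen_univ h'.3, ?_, ?_⟩
  · rw [sub_eq_add_neg]
    exact hG.modular_add_lt_top h.1.1 h.4 (by rw [modular_neg]; exact h'.4)
  · rw [sub_eq_add_neg]
    exact hG.modular_add_lt_top h.2.1 h.5 (by rw [modular_neg]; exact h'.5)

/-- The product rule, obtained by testing the weak gradient of `u` with `χ * η`. -/
lemma HasWeakGradient.mul_contDiff (h : HasWeakGradient Set.univ u V)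
    {χ : EuclideanSpace ℝ (Fin N) → ℝ} (hχ : ContDiff ℝ ∞ χ) :
    HasWeakGradient Set.univ (fun x => χ x * u x)
      (fun x => χ x • V x + u x • gradient χ x) := by
  have hχ1 : ContDiff ℝ 1 χ := hχ.of_le (by simp)
  refine ⟨?_, ?_, fun η hη i => ?_⟩
  · exact h.1.continuousOn_mul hχ.continuous.continuousOn isOpen_univ.isLocallyClosed
  · refine LocallyIntegrableOn.add ?_ ?_
    · exact h.2.continuousOn_smul isOpen_univ.isLocallyClosed hχ.continuous.continuousOn
    · exact h.1.smul_continuousOn isOpen_univ.isLocallyClosed (continuous_gradient hχ1).continuousOn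
  have hη' : (fun x => χ x * η x) ∈ testFunctions Set.univ :=
    ⟨hχ.mul hη.1, hη.2.1.mul_left, Set.subset_univ _⟩
  have hη1 : ContDiff ℝ 1 η := hη.1.of_le (by simp)
  set e : EuclideanSpace ℝ (Fin N) := EuclideanSpace.single i 1 with he
  have h1 := h.integral_eq _ hη' i
  have hder : ∀ x, fderiv ℝ (fun x => χ x * η x) x e
      = χ x * fderiv ℝ η x e + η x * gradient χ x i := by
    intro x
    have h2 : HasFDerivAt (fun x => χ x * η x) _ x :=
      (hχ1.differentiable one_ne_zero x).hasFDerivAt.mul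
        (hη1.differentiable one_ne_zero x).hasFDerivAt
    rw [h2.fderiv, gradient_apply]
    simp [he]
  have i1 : IntegrableOn (fun x => u x * (χ x * fderiv ℝ η x e)) Set.univ :=
    integrableOn_mul_of_tsupport_subset MeasurableSet.univ h.1
      (hχ.continuous.mul (continuous_partial hη1 e)) (hasCompactSupport_partial hη.2.1 e).mul_left
      (Set.subset_univ _)
  have hgc : Continuous fun x => gradient χ x i := by
    simp only [gradient_apply]; exact continuous_partial hχ1 _
  have i2 : IntegrableOn (fun x => u x * (η x * gradient χ x i)) Set.univ :=
    integrableOn_mul_of_tsupport_subset MeasurableSet.univ h.1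
      (hη1.continuous.mul hgc) hη.2.1.mul_right (Set.subset_univ _)
  have i3 : IntegrableOn (fun x => V x i * (χ x * η x)) Set.univ :=
    h.integrableOn_right isOpen_univ hη' i
  rw [← he] at h1
  simp only [hder, mul_add] at h1
  rw [integral_add i1 i2] at h1
  have e1 : ∫ x in Set.univ, χ x * u x * fderiv ℝ η x e
      = ∫ x in Set.univ, u x * (χ x * fderiv ℝ η x e) := by
    congr 1 with x; ring
  have e2 : ∫ x in Set.univ, (χ x • V x + u x • gradient χ x) i * η x
      = ∫ x in Set.univ, (V x i * (χ x * η x) + u x * (η x * gradient χ x i)) := by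
    congr 1 with x
    simp only [PiLp.add_apply, PiLp.smul_apply, smul_eq_mul]; ring
  rw [e1, e2, integral_add i3 i2]
  linarith

lemma IsGlobalSobolev.mul_contDiff (hG : IsGauge G p r) (h : IsGlobalSobolev G u V)
    {χ : EuclideanSpace ℝ (Fin N) → ℝ} (hχ : ContDiff ℝ ∞ χ) (hc : HasCompactSupport χ) :
    IsGlobalSobolev G (fun x => χ x * u x) (fun x => χ x • V x + u x • gradient χ x) := by
  have hχ1 : ContDiff ℝ 1 χ := hχ.of_le (by simp)
  have hgc := continuous_gradient hχ1
  obtain ⟨M, hM⟩ := hc.exists_bound_of_continuous hχ.continuous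
  obtain ⟨M', hM'⟩ := (hc.fderiv ℝ).exists_bound_of_continuous
    (hχ1.continuous_fderiv one_ne_zero)
  simp only [← norm_gradient] at hM'
  have i1 : Integrable fun x => χ x • V x :=
    h.2.bdd_smul M hχ.continuous.aestronglyMeasurable (Eventually.of_forall hM)
  have i2 : Integrable fun x => u x • gradient χ x :=
    h.1.smul_bdd M' hgc.aestronglyMeasurable (Eventually.of_forall hM')
  refine ⟨h.1.bdd_mul hχ.continuous.aestronglyMeasurable (Eventually.of_forall hM),
    i1.add i2, h.3.mul_contDiff hχ, ?_, ?_⟩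
  · refine hG.modular_lt_top_of_norm_le (C := M) (fun x => ?_) h.4
    rw [norm_mul]
    exact mul_le_mul_of_nonneg_right (hM x) (norm_nonneg _)
  · refine hG.modular_add_lt_top i1.1 ?_ ?_
    · refine hG.modular_lt_top_of_norm_le (C := M) (fun x => ?_) h.5
      rw [norm_smul]
      exact mul_le_mul_of_nonneg_right (hM x) (norm_nonneg _)
    · refine hG.modular_lt_top_of_norm_le (C := M') (fun x => ?_) h.4
      rw [norm_smul, mul_comm]
      exact mul_le_mul_of_nonneg_right (hM' x) (norm_nonneg _)

/-- Near every point of its closure, a smooth domain can be pushed into itself. -/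
lemma exists_inner_cone (hΩ : IsOpen Ω) (hs : HasSmoothBoundary Ω)
    {x₀ : EuclideanSpace ℝ (Fin N)} (hx₀ : x₀ ∈ closure Ω) :
    ∃ (ρ : ℝ) (ν : EuclideanSpace ℝ (Fin N)) (c T : ℝ), 0 < ρ ∧ 0 < c ∧ 0 < T ∧
      ∀ x ∈ closure Ω ∩ Metric.closedBall x₀ ρ, ∀ t, 0 < t → t < T →
        ∀ z ∈ Metric.closedBall (t • ν) (c * t), x + z ∈ Ω := by
  by_cases hx : x₀ ∈ Ω
  · obtain ⟨ε, hε, hball⟩ := Metric.isOpen_iff.1 hΩ x₀ hx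
    -- At an interior point every direction is admissible: axis zero and opening one give full
    -- balls.
    refine ⟨ε / 2, 0, 1, ε / 2, by linarith, one_pos, by linarith, fun x hx t ht htT z hz => ?_⟩
    apply hball
    rw [smul_zero, one_mul, mem_closedBall_zero_iff] at hz
    have h1 := hx.2
    rw [Metric.mem_closedBall, dist_eq_norm] at h1
    rw [Metric.mem_ball, dist_eq_norm, add_sub_right_comm]
    exact (norm_add_le _ _).trans_lt (by linarith)
  have hfr : x₀ ∈ frontier Ω := by rw [hΩ.frontier_eq]; exact ⟨hx₀, hx⟩
  obtain ⟨O, f, hO, hxO, hf, hf0, hOΩ⟩ := hs x₀ hfr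
  obtain ⟨w, hw⟩ : ∃ w, fderiv ℝ f x₀ w ≠ 0 := by
    by_contra! hcon
    exact hf0 (ContinuousLinearMap.ext hcon)
  -- With this scaling the derivative of `f` in direction `ν` is minus a nonzero square, whatever
  -- the sign of the derivative along `w`.
  set ν := -(fderiv ℝ f x₀ w) • w with hν
  have hν0 : fderiv ℝ f x₀ ν < 0 := by
    rw [hν, map_smul, smul_eq_mul]
    have := mul_self_pos.2 hw
    linarith
  have hcf : ContinuousOn (fderiv ℝ f) O := hf.continuousOn_fderiv_of_isOpen hO (by simp)
  have hcont : ContinuousAt (fun q : EuclideanSpace ℝ (Fin N) × EuclideanSpace ℝ (Fin N) =>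
      fderiv ℝ f q.1 q.2) (x₀, ν) := by
    have h1 : ContinuousAt (fun q : EuclideanSpace ℝ (Fin N) × EuclideanSpace ℝ (Fin N) =>
        fderiv ℝ f q.1) (x₀, ν) :=
      ContinuousAt.comp (f := Prod.fst) (hcf.continuousAt (hO.mem_nhds hxO)) continuousAt_fst
    exact h1.clm_apply continuousAt_snd
  have hev : ∀ᶠ q : EuclideanSpace ℝ (Fin N) × EuclideanSpace ℝ (Fin N) in 𝓝 (x₀, ν),
      fderiv ℝ f q.1 q.2 < 0 ∧ q.1 ∈ O :=
    (hcont.eventually (gt_mem_nhds hν0)).and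
      (continuousAt_fst.eventually (hO.mem_nhds hxO))
  obtain ⟨δ, hδ, hball⟩ := Metric.eventually_nhds_iff_ball.1 hev
  have hkey : ∀ y v, dist y x₀ < δ → dist v ν < δ → fderiv ℝ f y v < 0 ∧ y ∈ O := by
    intro y v hy hv
    exact hball (y, v) (by rw [Metric.mem_ball, Prod.dist_eq]; exact max_lt hy hv)
  have hB : 0 < ‖ν‖ + δ := by positivity
  -- The bound on `t` keeps displacements of velocity at most `‖ν‖ + δ` shorter than `δ / 2`, so the
  -- whole segment stays in the ball where `f` decreases.
  refine ⟨δ / 2, ν, δ / 2, δ / 2 / (‖ν‖ + δ), by linarith, by linarith, by positivity,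
    fun x hx t ht htT z hz => ?_⟩
  have hxd : dist x x₀ ≤ δ / 2 := hx.2
  set v := t⁻¹ • z with hv
  have hz' : z = t • v := by rw [hv, smul_smul, mul_inv_cancel₀ ht.ne', one_smul]
  have hvν : dist v ν ≤ δ / 2 := by
    rw [Metric.mem_closedBall, hz', dist_smul₀, Real.norm_of_nonneg ht.le, mul_comm] at hz
    exact le_of_mul_le_mul_right hz ht
  have hvn : ‖v‖ ≤ ‖ν‖ + δ := by
    have h1 : ‖v‖ ≤ ‖ν‖ + ‖v - ν‖ := by
      simpa using norm_add_le ν (v - ν)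
    rw [← dist_eq_norm] at h1
    linarith
  have hdist : ∀ s ∈ Set.Icc 0 t, dist (x + s • v) x₀ < δ := by
    intro s hs
    have h1 : s * (‖ν‖ + δ) < δ / 2 := by
      rw [← lt_div_iff₀ hB]; exact hs.2.trans_lt htT
    have h2 : ‖s • v‖ ≤ s * (‖ν‖ + δ) := by
      rw [norm_smul, Real.norm_of_nonneg hs.1]
      exact mul_le_mul_of_nonneg_left hvn hs.1
    calc dist (x + s • v) x₀ = ‖(x - x₀) + s • v‖ := by rw [dist_eq_norm]; congr 1; abel
      _ ≤ ‖x - x₀‖ + ‖s • v‖ := norm_add_le _ _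
      _ < δ := by rw [← dist_eq_norm]; linarith
  have hneg : ∀ s ∈ Set.Icc 0 t, fderiv ℝ f (x + s • v) v < 0 ∧ x + s • v ∈ O :=
    fun s hs => hkey _ v (hdist s hs) (by linarith)
  have hderiv : ∀ s ∈ Set.Icc 0 t, HasDerivAt (fun s : ℝ => f (x + s • v))
      (fderiv ℝ f (x + s • v) v) s := by
    intro s hs
    have h1 := ((hf.differentiableOn (by simp)).differentiableAt
      (hO.mem_nhds (hneg s hs).2)).hasFDerivAt
    have h2 : HasDerivAt (fun s : ℝ => x + s • v) v s := by
      simpa using ((hasDerivAt_id s).smul_const v).const_add x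
    exact h1.comp_hasDerivAt s h2
  have hanti : StrictAntiOn (fun s : ℝ => f (x + s • v)) (Set.Icc 0 t) := by
    apply strictAntiOn_of_deriv_neg (convex_Icc 0 t)
    · exact fun s hs => (hderiv s hs).continuousAt.continuousWithinAt
    · intro s hs
      have hs' := interior_subset hs
      rw [(hderiv s hs').deriv]
      exact (hneg s hs').1
  have h0 := hanti ⟨le_rfl, ht.le⟩ ⟨ht.le, le_rfl⟩ ht
  simp only [zero_smul, add_zero] at h0
  have hxO' : x ∈ O := by simpa using (hneg 0 ⟨le_rfl, ht.le⟩).2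
  -- By continuity `f ≤ 0` on the closure near `x₀`; the strict decrease along the segment then puts
  -- its endpoint in `{f < 0}`.
  have hfx : f x ≤ 0 := by
    have hcl : x ∈ closure (Ω ∩ O) := by
      rw [Set.inter_comm]
      exact hO.inter_closure ⟨hxO', hx.1⟩
    have := ((hf.continuousOn.continuousAt (hO.mem_nhds hxO')).continuousWithinAt
      (s := Ω ∩ O)).mem_closure hcl (t := Set.Iic 0) fun y hy => ?_
    · simpa using this
    · rw [hOΩ] at hy
      exact le_of_lt hy.2
  have hmem : x + z ∈ {y ∈ O | f y < 0} := by
    rw [hz']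
    exact ⟨(hneg t ⟨ht.le, le_rfl⟩).2, by linarith⟩
  rw [← hOΩ] at hmem
  exact hmem.1

lemma tsupport_mollify_subset {K : Set (EuclideanSpace ℝ (Fin N))} (hK : IsCompact K)
    {c : EuclideanSpace ℝ (Fin N)} (φ : ContDiffBump c) (hu : ∀ x, u x ≠ 0 → x ∈ K) :
    tsupport (mollify φ u) ⊆ (fun q : EuclideanSpace ℝ (Fin N) × EuclideanSpace ℝ (Fin N) =>
      q.1 + q.2) '' (K ×ˢ Metric.closedBall c φ.rOut) := by
  refine closure_minimal (fun x hx => ?_)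
    ((hK.prod (isCompact_closedBall c φ.rOut)).image (by fun_prop)).isClosed
  obtain ⟨z, hz, hxz⟩ := exists_ne_zero_of_mollify_ne_zero φ hx
  exact ⟨(x - z, z), ⟨hu _ hxz, Metric.ball_subset_closedBall hz⟩, by simp⟩

/-- Kernels supported in small balls around `t • ν` push the support from `K` into `Ω`, so the
mollifications are test functions; as `t → 0` they converge in the modular together with their
gradients. -/
lemma IsGlobalSobolev.mem_orliczSobolevZero_of_cone (hG : IsGauge G p r) (hΩ : IsOpen Ω)
    (h : IsGlobalSobolev G u V) {K : Set (EuclideanSpace ℝ (Fin N))} (hK : IsCompact K)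
    (hu : ∀ x, u x ≠ 0 → x ∈ K) {ν : EuclideanSpace ℝ (Fin N)} {c T : ℝ} (hc : 0 < c) (hT : 0 < T)
    (hcone : ∀ x ∈ K, ∀ t, 0 < t → t < T → ∀ z ∈ Metric.closedBall (t • ν) (c * t), x + z ∈ Ω) :
    u ∈ orliczSobolevZero G Ω := by
  -- The shift by two makes `t n < T` strict already for `n = 0`.
  set t : ℕ → ℝ := fun n => T / (n + 2) with ht
  have ht0 : ∀ n, 0 < t n := fun n => by positivity
  have htT : ∀ n, t n < T := fun n => by
    rw [ht, div_lt_iff₀ (by positivity)]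
    nlinarith [Nat.cast_nonneg (α := ℝ) n]
  set φ : ∀ n, ContDiffBump (t n • ν) := fun n =>
    ⟨c * t n / 2, c * t n, half_pos (mul_pos hc (ht0 n)), half_lt_self (mul_pos hc (ht0 n))⟩ with hφ
  have hrOut : ∀ n, (φ n).rOut = c * t n := fun n => rfl
  have htlim : Tendsto t atTop (𝓝 0) := by
    have h1 : Tendsto (fun n : ℕ => (n : ℝ) + 2) atTop atTop :=
      tendsto_atTop_add_const_right _ _ tendsto_natCast_atTop_atTop
    exact h1.const_div_atTop T
  have hR : Tendsto (fun n => (‖ν‖ + c) * t n) atTop (𝓝 0) := by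
    simpa using htlim.const_mul (‖ν‖ + c)
  have hsub : ∀ n, Metric.ball (t n • ν) (φ n).rOut ⊆ Metric.ball 0 ((‖ν‖ + c) * t n) := by
    intro n
    apply Metric.ball_subset_ball'
    rw [dist_zero_right, norm_smul, Real.norm_of_nonneg (ht0 n).le, hrOut]
    linarith
  have himg : ∀ n, (fun q : EuclideanSpace ℝ (Fin N) × EuclideanSpace ℝ (Fin N) =>
      q.1 + q.2) '' (K ×ˢ Metric.closedBall (t n • ν) (φ n).rOut) ⊆ Ω := by
    rintro n _ ⟨⟨x, z⟩, ⟨hx, hz⟩, rfl⟩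
    exact hcone x hx (t n) (ht0 n) (htT n) z hz
  have hle : (volume.restrict Ω : Measure (EuclideanSpace ℝ (Fin N))) ≤ volume :=
    Measure.restrict_le_self
  refine hG.mem_orliczSobolevZero (V := V) (η := fun n => mollify (φ n) u) hΩ
    (h.3.mono_set (Set.subset_univ _))
    (hG.memOrlicz_iff.2 ⟨h.1.1.restrict, (modular_mono_measure hle).trans_lt h.4⟩)
    (hG.memOrlicz_iff.2 ⟨h.2.1.restrict, (modular_mono_measure hle).trans_lt h.5⟩)
    (fun n => ⟨contDiff_mollify (φ n) h.1.locallyIntegrable, ?_, ?_⟩) ?_ ?_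
  · exact ((hK.prod (isCompact_closedBall _ _)).image (by fun_prop)).of_isClosed_subset
      (isClosed_tsupport _) (tsupport_mollify_subset hK (φ n) hu)
  · exact (tsupport_mollify_subset hK (φ n) hu).trans (himg n)
  · refine tendsto_of_tendsto_of_tendsto_of_le_of_le tendsto_const_nhds
      (hG.tendsto_modular_mollify_sub φ hR hsub h.1 h.4) (fun _ => zero_le) fun n => ?_
    rw [← neg_sub u, modular_neg]
    exact modular_mono_measure hle
  · refine tendsto_of_tendsto_of_tendsto_of_le_of_le tendsto_const_nhds
      (hG.tendsto_modular_mollify_sub φ hR hsub h.2 h.5) (fun _ => zero_le) fun n => ?_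
    rw [← neg_sub V, modular_neg, gradient_mollify (φ n) h.3]
    exact modular_mono_measure hle

lemma IsGauge.zero_mem_orliczSobolevZero (hG : IsGauge G p r) (hΩ : IsOpen Ω) :
    (0 : EuclideanSpace ℝ (Fin N) → ℝ) ∈ orliczSobolevZero G Ω := by
  have hgrad : gradient (0 : EuclideanSpace ℝ (Fin N) → ℝ) = 0 := by
    ext x i; rw [gradient_apply]; simp
  have hw : HasWeakGradient Ω (0 : EuclideanSpace ℝ (Fin N) → ℝ) 0 := by
    have := hasWeakGradient_of_contDiff (Ω := Ω) (ψ := 0) contDiff_const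
    rwa [hgrad] at this
  refine hG.mem_orliczSobolevZero (η := fun _ => 0) hΩ hw ?_ ?_ (fun _ => ?_) ?_ ?_
  · exact hG.memOrlicz_iff.2 ⟨aestronglyMeasurable_zero, by simp [modular, hG.map_zero]⟩
  · exact hG.memOrlicz_iff.2 ⟨aestronglyMeasurable_zero, by simp [modular, hG.map_zero]⟩
  · exact ⟨contDiff_const, HasCompactSupport.zero, by simp [tsupport]⟩
  · simp [modular, hG.map_zero]
  · simp [modular, hG.map_zero, hgrad]

/-- A function in `W^{1,G}(ℝᴺ)` that vanishes outside a smooth bounded domain belongs to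
`W^{1,G}_0`. -/
lemma IsGlobalSobolev.mem_orliczSobolevZero (hG : IsGauge G p r) (hΩ : IsOpen Ω)
    (hb : Bornology.IsBounded Ω) (hs : HasSmoothBoundary Ω) (h : IsGlobalSobolev G u V)
    (hu : ∀ x, u x ≠ 0 → x ∈ closure Ω) : u ∈ orliczSobolevZero G Ω := by
  have hcomp : IsCompact (closure Ω) := hb.isCompact_closure
  choose! ρ ν c T hρ hc hT hcone using
    fun x (hx : x ∈ closure Ω) => exists_inner_cone hΩ hs hx
  obtain ⟨t, htΩ, hcov⟩ := hcomp.elim_nhds_subcover (fun x => Metric.ball x (ρ x / 2))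
    fun x hx => Metric.ball_mem_nhds x (half_pos (hρ x hx))
  -- Induction on the number of covering balls, with `u` and `V` general because each step replaces
  -- `u` by `u - χ u`.
  have hmain : ∀ s : Finset (EuclideanSpace ℝ (Fin N)), (∀ y ∈ s, y ∈ closure Ω) →
      ∀ (u : EuclideanSpace ℝ (Fin N) → ℝ)
        (V : EuclideanSpace ℝ (Fin N) → EuclideanSpace ℝ (Fin N)), IsGlobalSobolev G u V →
        (∀ x, u x ≠ 0 → x ∈ closure Ω ∧ ∃ y ∈ s, x ∈ Metric.ball y (ρ y / 2)) →
        u ∈ orliczSobolevZero G Ω := by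
    classical
    intro s
    induction s using Finset.induction_on with
    | empty =>
      intro _ u V _ hu
      have : u = 0 := by
        ext x
        by_contra hx
        obtain ⟨-, y, hy, -⟩ := hu x hx
        simp at hy
      rw [this]
      exact hG.zero_mem_orliczSobolevZero hΩ
    | insert y s _ ih =>
      intro hs u V h hu
      have hy : y ∈ closure Ω := hs y (Finset.mem_insert_self _ _)
      -- The cutoff is supported where the cone at `y` is available and equals one on the
      -- half-radius ball, so the remainder vanishes on that ball.
      let χ : ContDiffBump y := ⟨ρ y / 2, ρ y, half_pos (hρ y hy), half_lt_self (hρ y hy)⟩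
      have hχ := h.mul_contDiff hG χ.contDiff χ.hasCompactSupport
      have h1 : (fun x => χ x * u x) ∈ orliczSobolevZero G Ω := by
        refine hχ.mem_orliczSobolevZero_of_cone hG hΩ
          (hcomp.inter_right Metric.isClosed_closedBall) (fun x hx => ?_) (hc y hy) (hT y hy)
          (hcone y hy)
        refine ⟨(hu x (right_ne_zero_of_mul hx)).1, ?_⟩
        have : x ∈ Function.support χ := left_ne_zero_of_mul hx
        rw [χ.support_eq] at this
        exact Metric.ball_subset_closedBall this
      have h2 : (u - fun x => χ x * u x) ∈ orliczSobolevZero G Ω := by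
        refine ih (fun z hz => hs z (Finset.mem_insert_of_mem hz)) _ _ (h.sub hG hχ) fun x hx => ?_
        have hux : u x ≠ 0 := by
          intro h0; apply hx; simp [h0]
        obtain ⟨hxc, z, hz, hxz⟩ := hu x hux
        refine ⟨hxc, z, ?_, hxz⟩
        rcases Finset.mem_insert.1 hz with rfl | hz
        · exact absurd (by simp [χ.one_of_mem_closedBall (Metric.ball_subset_closedBall hxz)]) hx
        · exact hz
      have := hG.orliczSobolevZero_add hΩ h1 h2
      rwa [add_sub_cancel] at this
  refine hmain t htΩ u V h fun x hx => ⟨hu x hx, ?_⟩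
  simpa using hcov (hu x hx)

end ZeroSpace

/-! ### The Poincaré and Sobolev inequalities -/

section

variable {m : ℕ} {Ω : Set (EuclideanSpace ℝ (Fin (m + 1)))} {G : ℝ → ℝ} {p r : ℝ}
  {u : EuclideanSpace ℝ (Fin (m + 1)) → ℝ}

/-- The function is constant, and it vanishes somewhere because the space is not compact. -/
lemma eq_zero_of_gradient_eq_zero {f : EuclideanSpace ℝ (Fin (m + 1)) → ℝ} (hf : ContDiff ℝ 1 f)
    (hc : HasCompactSupport f) (h : gradient f = 0) : f = 0 := by
  have h1 : ∀ x, fderiv ℝ f x = 0 := fun x => by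
    rw [← norm_eq_zero, ← norm_gradient, h]; simp
  obtain ⟨y, hy⟩ : ∃ y, y ∉ tsupport f := by
    by_contra! hcon
    have : tsupport f = Set.univ := Set.eq_univ_of_forall hcon
    exact noncompact_univ (EuclideanSpace ℝ (Fin (m + 1))) (this ▸ hc.isCompact)
  ext x
  rw [is_const_of_fderiv_eq_zero (hf.differentiable one_ne_zero) h1 x y,
    image_eq_zero_of_notMem_tsupport hy]
  rfl

/-- A compactly supported integrable function with vanishing weak gradient vanishes. -/
lemma ae_eq_zero_of_hasWeakGradient_zero (hu : Integrable u)
    (h : HasWeakGradient Set.univ u 0) {K : Set (EuclideanSpace ℝ (Fin (m + 1)))}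
    (hK : IsCompact K) (huK : ∀ x, u x ≠ 0 → x ∈ K) : u =ᵐ[volume] 0 := by
  set φ : ℕ → ContDiffBump (0 : EuclideanSpace ℝ (Fin (m + 1))) := fun n =>
    ⟨1 / (n + 1) / 2, 1 / (n + 1), by positivity, half_lt_self (by positivity)⟩ with hφ
  have hlim := tendsto_eLpNorm_mollify_sub φ
    (tendsto_one_div_add_atTop_nhds_zero_nat (𝕜 := ℝ)) (fun n => subset_rfl) hu
  have hz : ∀ n, mollify (φ n) u = 0 := by
    intro n
    refine eq_zero_of_gradient_eq_zero
      ((contDiff_mollify (φ n) hu.locallyIntegrable).of_le (by simp)) ?_ ?_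
    · exact ((hK.prod (isCompact_closedBall _ _)).image (by fun_prop)).of_isClosed_subset
        (isClosed_tsupport _) (tsupport_mollify_subset hK (φ n) huK)
    · rw [gradient_mollify (φ n) h]
      ext x : 1
      simp [mollify]
  simp only [hz, zero_sub, eLpNorm_neg] at hlim
  exact (eLpNorm_eq_zero_iff hu.1 one_ne_zero).1 (tendsto_nhds_unique tendsto_const_nhds hlim)

lemma IsGauge.lintegral_enorm_rpow_le (hG : IsGauge G p r) {α E : Type*} [MeasurableSpace α]
    [NormedAddCommGroup E] {μ : Measure α} (f : α → E) :
    ∫⁻ x, ‖f x‖ₑ ^ p ∂μ ≤ μ Set.univ + ENNReal.ofReal (G 1)⁻¹ * modular G f μ := by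
  have h1 : μ Set.univ = ∫⁻ _, 1 ∂μ := by simp
  rw [modular, h1, ← lintegral_const_mul' _ _ ENNReal.ofReal_ne_top,
    ← lintegral_add_left measurable_const]
  refine lintegral_mono fun x => ?_
  have h1 : 0 ≤ (G 1)⁻¹ := inv_nonneg.2 (hG.pos 1 one_pos).le
  rw [← ofReal_norm, ← ENNReal.ofReal_mul h1, ENNReal.ofReal_rpow_of_nonneg (norm_nonneg _)
    (by linarith [hG.one_le]), ← ENNReal.ofReal_one, ← ENNReal.ofReal_add zero_le_one
    (mul_nonneg h1 (hG.nonneg (norm_nonneg _)))]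
  exact ENNReal.ofReal_le_ofReal (hG.rpow_le (norm_nonneg _))

/-- Functions in `W^{1,G}_0` are integrable to the Sobolev exponent of `p`. -/
lemma IsGauge.memLp_of_mem_orliczSobolevZero (hG : IsGauge G p r) (hΩ : IsOpen Ω)
    (hΩfin : volume Ω ≠ ⊤) (hu : u ∈ orliczSobolevZero G Ω) {s : ℝ} (hs : 0 ≤ s)
    (hps : s⁻¹ = p⁻¹ - ((m + 1 : ℕ) : ℝ)⁻¹) :
    MemLp u (ENNReal.ofReal s) (volume.restrict Ω) := by
  have : IsFiniteMeasure (volume.restrict Ω) := ⟨by simpa using hΩfin.lt_top⟩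
  have hp0 : 0 < p := by linarith [hG.one_le]
  have hw := hu.1.1.hasWeakGradient
  have hum := hG.memOrlicz_iff.1 hu.1.2.1
  have hVm := hG.memOrlicz_iff.1 hu.1.2.2
  obtain ⟨η, hη, h1, h2⟩ := hG.exists_test_tendsto hΩ hw hu
  set V := weakGradient Ω u with hV
  have hη1 : ∀ n, ContDiff ℝ 1 (η n) := fun n => (hη n).1.of_le (by simp)
  set B : ℝ≥0∞ := ENNReal.ofReal (2 ^ r) * (modular G V (volume.restrict Ω) + 1) with hB
  have hBt : B < ⊤ := ENNReal.mul_lt_top ENNReal.ofReal_lt_top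
    (ENNReal.add_lt_top.2 ⟨hVm.2, ENNReal.one_lt_top⟩)
  set B' : ℝ≥0∞ := (volume.restrict Ω) Set.univ + ENNReal.ofReal (G 1)⁻¹ * B with hB'
  have hB't : B' < ⊤ := ENNReal.add_lt_top.2
    ⟨measure_lt_top _ _, ENNReal.mul_lt_top ENNReal.ofReal_lt_top hBt⟩
  -- Modular convergence bounds the gradients of the approximating test functions, hence their
  -- `p`-th powers.
  have hgrad : ∀ᶠ n in atTop, modular G (gradient (η n)) (volume.restrict Ω) ≤ B := by
    filter_upwards [ENNReal.tendsto_nhds_zero.1 h2 1 one_pos] with n hn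
    have h3 : gradient (η n) = V + -(V - gradient (η n)) := by abel
    rw [h3]
    refine (hG.modular_add_le hVm.1).trans ?_
    rw [modular_neg, hB]
    gcongr
  have hgrad' : ∀ᶠ n in atTop,
      eLpNorm (fderiv ℝ (η n)) (p.toNNReal : ℝ≥0∞) volume ≤ B' ^ (1 / p) := by
    filter_upwards [hgrad] with n hn
    rw [eLpNorm_eq_lintegral_rpow_enorm_toReal (by simpa using hp0) ENNReal.coe_ne_top,
      ENNReal.coe_toReal, Real.coe_toNNReal p hp0.le]
    refine ENNReal.rpow_le_rpow ?_ (by positivity)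
    calc ∫⁻ x, ‖fderiv ℝ (η n) x‖ₑ ^ p = ∫⁻ x in Ω, ‖gradient (η n) x‖ₑ ^ p := by
          rw [← lintegral_indicator hΩ.measurableSet]
          congr 1 with x
          by_cases hx : x ∈ Ω
          · rw [Set.indicator_of_mem hx, ← ofReal_norm, ← ofReal_norm, norm_gradient]
          · rw [Set.indicator_of_notMem hx, ← ofReal_norm,
              fderiv_of_notMem_tsupport ℝ fun hx' => hx ((hη n).2.2 hx'), norm_zero,
              ENNReal.ofReal_zero, ENNReal.zero_rpow_of_pos hp0]
      _ ≤ B' := (hG.lintegral_enorm_rpow_le _).trans (by rw [hB']; gcongr)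
  -- The Gagliardo–Nirenberg–Sobolev constant; the inequality is applied to the test functions on
  -- the whole space.
  set C := SNormLESNormFDerivOfEqConst ℝ
    (volume : Measure (EuclideanSpace ℝ (Fin (m + 1)))) (p.toNNReal : ℝ) with hC
  have hnorm : ∀ᶠ n in atTop, eLpNorm (η n) (ENNReal.ofReal s) (volume.restrict Ω)
      ≤ C * B' ^ (1 / p) := by
    filter_upwards [hgrad'] with n hn
    have hp1 : 1 ≤ p.toNNReal := Real.one_le_toNNReal.2 hG.one_le
    have h3 := eLpNorm_le_eLpNorm_fderiv_of_eq (p' := s.toNNReal)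
      (volume : Measure (EuclideanSpace ℝ (Fin (m + 1)))) (hη1 n) (hη n).2.1
      hp1 (by simp) (by simpa [Real.coe_toNNReal p hp0.le, Real.coe_toNNReal s hs] using hps)
    refine (eLpNorm_mono_measure _ Measure.restrict_le_self).trans (h3.trans ?_)
    gcongr
  have hbt : (C : ℝ≥0∞) * B' ^ (1 / p) < ⊤ :=
    ENNReal.mul_lt_top ENNReal.coe_lt_top
      (ENNReal.rpow_lt_top_of_nonneg (by positivity) hB't.ne)
  have hL1 : Tendsto (fun n => eLpNorm (η n - u) 1 (volume.restrict Ω)) atTop (𝓝 0) := by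
    refine (hG.tendsto_eLpNorm_one h1).congr fun n => ?_
    rw [← neg_sub, eLpNorm_neg]
  obtain ⟨ns, hns, hae⟩ := (tendstoInMeasure_of_tendsto_eLpNorm one_ne_zero
    (fun n => (hη1 n).continuous.aestronglyMeasurable) hum.1 hL1).exists_seq_tendsto_ae
  refine ⟨hum.1, lt_of_le_of_lt ?_ hbt⟩
  -- Fatou's lemma transfers the uniform bound to the a.e. limit `u`.
  refine (Lp.eLpNorm_lim_le_liminf_eLpNorm
    (fun n => (hη1 (ns n)).continuous.aestronglyMeasurable) u hae).trans ?_
  exact liminf_le_of_frequently_le'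
    (hns.tendsto_atTop.eventually hnorm).frequently

/-! ### Integrability of the energy density -/

lemma exists_ae_norm_le {α : Type*} [MeasurableSpace α] {μ : Measure α} {f : α → ℝ}
    (hf : MemLp f ∞ μ) : ∃ C, ∀ᵐ x ∂μ, ‖f x‖ ≤ C := by
  refine ⟨(eLpNorm f ∞ μ).toReal, ?_⟩
  filter_upwards [ae_le_eLpNormEssSup (f := f) (μ := μ)] with x hx
  rw [← toReal_enorm]
  exact ENNReal.toReal_mono hf.2.ne (by rwa [eLpNorm_exponent_top])

lemma integrable_modular {α E : Type*} [MeasurableSpace α] [NormedAddCommGroup E]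
    {μ : Measure α} (hG : IsGauge G p r) {f : α → E} (hf : MemOrlicz G f μ) :
    Integrable (fun x => G ‖f x‖) μ := by
  obtain ⟨h1, h2⟩ := hG.memOrlicz_iff.1 hf
  refine ⟨hG.continuous_comp_norm.comp_aestronglyMeasurable h1, ?_⟩
  rw [hasFiniteIntegral_iff_ofReal (Eventually.of_forall fun x => hG.nonneg (norm_nonneg _))]
  exact h2

lemma integrableOn_indicator_pos (hΩfin : volume Ω ≠ ⊤)
    (hu : AEStronglyMeasurable u (volume.restrict Ω)) (lam : ℝ) :
    IntegrableOn (fun x => lam * Set.indicator {y | 0 < u y} (fun _ => (1 : ℝ)) x) Ω := by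
  have : IsFiniteMeasure (volume.restrict Ω) := ⟨by simpa using hΩfin.lt_top⟩
  have h1 : (fun x => Set.indicator {y | 0 < u y} (fun _ => (1 : ℝ)) x)
      = fun x => (Set.Ioi (0 : ℝ)).indicator (fun _ => (1 : ℝ)) (u x) := by
    ext x; by_cases hx : 0 < u x <;> simp [hx]
  have h2 : AEStronglyMeasurable (fun x => Set.indicator {y | 0 < u y} (fun _ => (1 : ℝ)) x)
      (volume.restrict Ω) := by
    rw [h1]
    exact ((measurable_const.indicator measurableSet_Ioi).comp_aemeasurable
      hu.aemeasurable).aestronglyMeasurable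
  refine Integrable.const_mul (Integrable.of_bound h2 1 (Eventually.of_forall fun x => ?_)) lam
  by_cases hx : 0 < u x <;> simp [hx]

/-- The energy density of an admissible function is integrable. -/
lemma IsGauge.integrableOn_energy (hG : IsGauge G p r) (hΩ : IsOpen Ω) (hΩfin : volume Ω ≠ ⊤)
    (hpm : p < (m + 1 : ℕ)) {F : ℝ → ℝ} {a b : ℝ} (hF : LiebermanCondition F a b) (ha : 0 ≤ a)
    (hb : b ≤ ((m + 1 : ℕ) : ℝ) * p / (((m + 1 : ℕ) : ℝ) - p))
    {q h φ : EuclideanSpace ℝ (Fin (m + 1)) → ℝ} (hq : MemLp q ∞ (volume.restrict Ω))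
    (hh : MemLp h ∞ (volume.restrict Ω)) (hφ : MemLp φ ∞ (volume.restrict Ω)) (lam : ℝ)
    (hu : u ∈ admissible G Ω φ) :
    IntegrableOn (fun x => G ‖weakGradient Ω u x‖ + q x * F (max (u x) 0) + h x * u x
      + lam * Set.indicator {y | 0 < u y} (fun _ => (1 : ℝ)) x) Ω := by
  have : IsFiniteMeasure (volume.restrict Ω) := ⟨by simpa using hΩfin.lt_top⟩
  have hp0 : 0 < p := by linarith [hG.one_le]
  have hm0 : (0 : ℝ) < ((m + 1 : ℕ) : ℝ) := by positivity
  set n : ℝ := ((m + 1 : ℕ) : ℝ) with hn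
  set s : ℝ := n * p / (n - p) with hs
  have hs0 : 0 < s := div_pos (mul_pos hm0 hp0) (by linarith)
  have hsinv : s⁻¹ = p⁻¹ - n⁻¹ := by
    have : n - p ≠ 0 := by linarith
    rw [hs]; field_simp
  have hus := hu.1.2.1.1
  -- Here `u = (u - φ) + φ`, where the first term is in `W^{1,G}_0` and the second is bounded on a
  -- set of finite measure.
  have hLs : MemLp u (ENNReal.ofReal s) (volume.restrict Ω) := by
    have h1 := hG.memLp_of_mem_orliczSobolevZero hΩ hΩfin hu.2 hs0.le hsinv
    have h2 := h1.add (hφ.mono_exponent (p := ENNReal.ofReal s) le_top)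
    rwa [sub_add_cancel] at h2
  have hus' : Integrable (fun x => ‖u x‖ ^ s) (volume.restrict Ω) := by
    have := hLs.integrable_norm_rpow (by simpa using hs0) ENNReal.ofReal_ne_top
    rwa [ENNReal.toReal_ofReal hs0.le] at this
  have hFcont : Continuous fun t : ℝ => F (max t 0) :=
    hF.continuousOn.comp_continuous (by fun_prop) fun t => Set.mem_Ici.2 (le_max_right _ _)
  have hFint : Integrable (fun x => F (max (u x) 0)) (volume.restrict Ω) := by
    refine Integrable.mono' (((integrable_const (1 : ℝ)).add hus').const_mul (F 1))
      (hFcont.comp_aestronglyMeasurable hus) (Eventually.of_forall fun x => ?_)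
    rw [Real.norm_of_nonneg (hF.nonneg (le_max_right _ _))]
    refine (hF.le_rpow ha hb (le_max_right _ _)).trans ?_
    refine mul_le_mul_of_nonneg_left ?_ (hF.pos 1 one_pos).le
    simp only [Pi.add_apply]
    gcongr
    exact max_le (le_abs_self _) (abs_nonneg _)
  obtain ⟨Cq, hCq⟩ := exists_ae_norm_le hq
  obtain ⟨Ch, hCh⟩ := exists_ae_norm_le hh
  exact (((integrable_modular hG hu.1.2.2).add (hFint.bdd_mul hq.1 hCq)).add
    ((memLp_one_iff_integrable.1 (hG.memLp_one hu.1.2.1)).bdd_mul hh.1 hCh)).add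
    (integrableOn_indicator_pos hΩfin hus lam)

/-- Admissible functions with non-negative boundary values are limits in `W^{1,1}` of smooth
functions whose negative parts tend to zero on the boundary. -/
lemma IsGauge.exists_contDiff_tendsto (hG : IsGauge G p r) (hΩ : IsOpen Ω)
    (hΩfin : volume Ω ≠ ⊤) {φ : EuclideanSpace ℝ (Fin (m + 1)) → ℝ}
    (hφ : NonnegOnBoundary Ω φ) (hu : u ∈ admissible G Ω φ) :
    ∃ ζ : ℕ → EuclideanSpace ℝ (Fin (m + 1)) → ℝ, (∀ n, ContDiff ℝ 1 (ζ n)) ∧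
      Tendsto (fun n => eLpNorm (ζ n - u) 1 (volume.restrict Ω)) atTop (𝓝 0) ∧
      Tendsto (fun n => eLpNorm (gradient (ζ n) - weakGradient Ω u) 1 (volume.restrict Ω))
        atTop (𝓝 0) ∧
      Tendsto (fun n => ∫⁻ x, ENNReal.ofReal (max (-ζ n x) 0) ∂(surfaceMeasure Ω))
        atTop (𝓝 0) := by
  have : IsFiniteMeasure (volume.restrict Ω) := ⟨by simpa using hΩfin.lt_top⟩
  obtain ⟨T, ⟨hφw, hφ1, hφV, -, ψ, hψ, hψφ, hψV, hψT⟩, hT0⟩ := hφ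
  have hw : HasWeakGradient Ω (u - φ) (weakGradient Ω u - weakGradient Ω φ) :=
    hu.1.1.hasWeakGradient.sub hΩ hφw.hasWeakGradient
  obtain ⟨η, hη, h1, h2⟩ := hG.exists_test_tendsto hΩ hw hu.2
  have hψ1 : ∀ n, ContDiff ℝ 1 (ψ n) := fun n => (hψ n).of_le (by simp)
  have hη1 : ∀ n, ContDiff ℝ 1 (η n) := fun n => (hη n).1.of_le (by simp)
  have hum := hu.1.2.1.1
  have hVm := hu.1.2.2.1
  refine ⟨fun n => ψ n + η n, fun n => (hψ1 n).add (hη1 n), ?_, ?_, ?_⟩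
  · refine tendsto_of_tendsto_of_tendsto_of_le_of_le tendsto_const_nhds
      (by simpa using hψφ.add (hG.tendsto_eLpNorm_one h1)) (fun _ => zero_le) fun n => ?_
    have : ψ n + η n - u = (ψ n - φ) - (u - φ - η n) := by abel
    rw [this]
    exact eLpNorm_sub_le ((hψ1 n).continuous.aestronglyMeasurable.sub hφ1.1)
      ((hum.sub hφ1.1).sub (hη1 n).continuous.aestronglyMeasurable) le_rfl
  · refine tendsto_of_tendsto_of_tendsto_of_le_of_le tendsto_const_nhds
      (by simpa using hψV.add (hG.tendsto_eLpNorm_one h2)) (fun _ => zero_le) fun n => ?_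
    rw [gradient_add_of_contDiff (hψ1 n) (hη1 n)]
    have : gradient (ψ n) + gradient (η n) - weakGradient Ω u = (gradient (ψ n) -
        weakGradient Ω φ) - (weakGradient Ω u - weakGradient Ω φ - gradient (η n)) := by abel
    rw [this]
    exact eLpNorm_sub_le ((continuous_gradient (hψ1 n)).aestronglyMeasurable.sub hφV.1)
      ((hVm.sub hφV.1).sub (continuous_gradient (hη1 n)).aestronglyMeasurable) le_rfl
  · refine tendsto_of_tendsto_of_tendsto_of_le_of_le tendsto_const_nhds hψT
      (fun _ => zero_le) fun n => ?_
    rw [eLpNorm_one_eq_lintegral_enorm]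
    refine lintegral_mono_ae ?_
    -- On the frontier the test functions vanish, and `T ≥ 0` gives `(-ψ n)⁺ ≤ |ψ n - T|`.
    filter_upwards [hT0, ae_restrict_mem isClosed_frontier.measurableSet] with x hx hxf
    have hxΩ : x ∉ Ω := by
      rw [hΩ.frontier_eq] at hxf; exact hxf.2
    have hηx : η n x = 0 := image_eq_zero_of_notMem_tsupport fun hx' => hxΩ ((hη n).2.2 hx')
    rw [← ofReal_norm]
    refine ENNReal.ofReal_le_ofReal (max_le ?_ (norm_nonneg _))
    rw [Pi.add_apply, hηx, add_zero, Pi.sub_apply]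
    linarith [neg_abs_le (ψ n x - T x), Real.norm_eq_abs (ψ n x - T x)]

/-! ### Comparison of a minimizer with its positive part -/

lemma modular_indicator (hG : IsGauge G p r) {α E : Type*} [MeasurableSpace α]
    [NormedAddCommGroup E] {μ : Measure α} {s : Set α} (hs : MeasurableSet s) (f : α → E) :
    modular G (s.indicator f) μ = modular G f (μ.restrict s) := by
  rw [modular, modular, ← lintegral_indicator hs]
  congr 1 with x
  by_cases hx : x ∈ s <;> simp [hx, hG.map_zero]

/-- The positive part of an admissible function with non-negative boundary values is
admissible. -/
lemma IsGauge.add_negPart_mem_admissible (hG : IsGauge G p r) (hΩ : IsSmoothBoundedDomain Ω)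
    {φ : EuclideanSpace ℝ (Fin (m + 1)) → ℝ} (hφ : NonnegOnBoundary Ω φ)
    (hu : u ∈ admissible G Ω φ) :
    IsGlobalSobolev G (Ω.indicator fun x => max (-u x) 0)
      (Ω.indicator fun x => negPartDeriv (u x) • weakGradient Ω u x) ∧
    (u + Ω.indicator fun x => max (-u x) 0) ∈ admissible G Ω φ := by
  have hΩfin : volume Ω ≠ ⊤ := hΩ.isBounded.measure_lt_top.ne
  have : IsFiniteMeasure (volume.restrict Ω) := ⟨by simpa using hΩfin.lt_top⟩
  have hmeas := hΩ.isOpen.measurableSet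
  obtain ⟨ζ, hζ, hζu, hζV, hneg⟩ := hG.exists_contDiff_tendsto hΩ.isOpen hΩfin hφ hu
  obtain ⟨hU, hW, hUW⟩ := hasWeakGradient_indicator_negPart hmeas hΩfin
    (memLp_one_iff_integrable.1 (hG.memLp_one hu.1.2.1))
    (memLp_one_iff_integrable.1 (hG.memLp_one hu.1.2.2)) hζ hζu hζV hneg
  have hmu := hG.memOrlicz_iff.1 hu.1.2.1
  have hmV := hG.memOrlicz_iff.1 hu.1.2.2
  have hglob : IsGlobalSobolev G (Ω.indicator fun x => max (-u x) 0)
      (Ω.indicator fun x => negPartDeriv (u x) • weakGradient Ω u x) := by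
    refine ⟨hU, hW, hUW, ?_, ?_⟩
    · rw [modular_indicator hG hmeas]
      refine (hG.modular_mono (Eventually.of_forall fun x => ?_)).trans_lt hmu.2
      rw [Real.norm_of_nonneg (le_max_right _ _)]
      exact max_le (neg_le_abs _) (abs_nonneg _)
    · rw [modular_indicator hG hmeas]
      refine (hG.modular_mono (Eventually.of_forall fun x => ?_)).trans_lt hmV.2
      rw [norm_smul]
      exact mul_le_of_le_one_left (norm_nonneg _) (abs_negPartDeriv_le _)
  refine ⟨hglob, ?_⟩
  have hzero := hglob.mem_orliczSobolevZero hG hΩ.isOpen hΩ.isBounded hΩ.smoothBoundary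
    fun x hx => subset_closure (Set.mem_of_indicator_ne_zero hx)
  have hw := hu.1.1.hasWeakGradient.add hΩ.isOpen (hUW.mono_set (Set.subset_univ Ω))
  have hle : (volume.restrict Ω : Measure (EuclideanSpace ℝ (Fin (m + 1)))) ≤ volume :=
    Measure.restrict_le_self
  refine ⟨hw.mem_orliczSobolev hΩ.isOpen
    (hG.memOrlicz_iff.2 ⟨hmu.1.add hU.1.restrict, hG.modular_add_lt_top hmu.1 hmu.2
      ((modular_mono_measure hle).trans_lt hglob.4)⟩)
    (hG.memOrlicz_iff.2 ⟨hmV.1.add hW.1.restrict, hG.modular_add_lt_top hmV.1 hmV.2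
      ((modular_mono_measure hle).trans_lt hglob.5)⟩), ?_⟩
  have := hG.orliczSobolevZero_add hΩ.isOpen hu.2 hzero
  rwa [sub_add_eq_add_sub] at this

/-- Minimizers with non-negative boundary values are non-negative. -/
lemma IsGauge.ae_nonneg_of_isMinimizer (hG : IsGauge G p r) (hΩ : IsSmoothBoundedDomain Ω)
    (hpm : p < (m + 1 : ℕ)) {F : ℝ → ℝ} {a b : ℝ} (hF : LiebermanCondition F a b) (ha : 0 ≤ a)
    (hb : b ≤ ((m + 1 : ℕ) : ℝ) * p / (((m + 1 : ℕ) : ℝ) - p))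
    {q h φ : EuclideanSpace ℝ (Fin (m + 1)) → ℝ} (hq : MemLp q ∞ (volume.restrict Ω))
    (hh : MemLp h ∞ (volume.restrict Ω)) (hh0 : ∀ᵐ x ∂(volume.restrict Ω), h x ≤ 0)
    (hφ : MemLp φ ∞ (volume.restrict Ω)) (hφ0 : NonnegOnBoundary Ω φ) {lam : ℝ}
    (hu : IsMinimizer Ω G F q h lam φ u) : ∀ᵐ x ∂(volume.restrict Ω), 0 ≤ u x := by
  have hΩfin : volume Ω ≠ ⊤ := hΩ.isBounded.measure_lt_top.ne
  have hmeas := hΩ.isOpen.measurableSet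
  obtain ⟨hu, hmin⟩ := hu
  obtain ⟨hglob, hv⟩ := hG.add_negPart_mem_admissible hΩ hφ0 hu
  set U := Ω.indicator fun x => max (-u x) 0 with hU
  set W := Ω.indicator fun x => negPartDeriv (u x) • weakGradient Ω u x with hW
  have hJ := hmin hv
  -- Integrability is essential: a non-integrable density would have integral `0` by convention, and
  -- the energies could not be subtracted.
  have hiu := hG.integrableOn_energy hΩ.isOpen hΩfin hpm hF ha hb hq hh hφ lam hu
  have hiv := hG.integrableOn_energy hΩ.isOpen hΩfin hpm hF ha hb hq hh hφ lam hv
  have hgrad : weakGradient Ω (u + U) =ᵐ[volume.restrict Ω] weakGradient Ω u + W :=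
    (hu.1.1.hasWeakGradient.add hΩ.isOpen
      (hglob.3.mono_set (Set.subset_univ Ω))).weakGradient_ae_eq hΩ.isOpen
  -- Where `u < 0` the competitor and its gradient vanish; elsewhere nothing changes. The `F` and
  -- indicator terms cancel in both cases.
  have hdiff : ∀ᵐ x ∂(volume.restrict Ω), (G ‖weakGradient Ω u x‖ + q x * F (max (u x) 0)
      + h x * u x + lam * Set.indicator {y | 0 < u y} (fun _ => (1 : ℝ)) x) -
      (G ‖weakGradient Ω (u + U) x‖ + q x * F (max ((u + U) x) 0) + h x * (u + U) x
      + lam * Set.indicator {y | 0 < (u + U) y} (fun _ => (1 : ℝ)) x)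
      = if u x < 0 then G ‖weakGradient Ω u x‖ + h x * u x else 0 := by
    filter_upwards [hgrad, ae_restrict_mem hmeas] with x hx hxΩ
    have hUx : U x = max (-u x) 0 := by rw [hU, Set.indicator_of_mem hxΩ]
    have hWx : W x = negPartDeriv (u x) • weakGradient Ω u x := by
      rw [hW, Set.indicator_of_mem hxΩ]
    rw [hx, Pi.add_apply, Pi.add_apply, hWx]
    simp only [Set.indicator_apply, Set.mem_ofPred_eq, Pi.add_apply, hUx]
    by_cases hux : u x < 0
    · have h1 : max (-u x) 0 = -u x := max_eq_left (by linarith)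
      have h2 : max (u x) 0 = 0 := max_eq_right hux.le
      have h3 : ¬0 < u x := not_lt.2 hux.le
      simp [negPartDeriv, hux, h1, h2, h3, hG.map_zero]
      ring
    · have h1 : max (-u x) 0 = 0 := max_eq_right (by linarith)
      simp [negPartDeriv, hux, h1]
  have hnonneg : ∀ᵐ x ∂(volume.restrict Ω),
      0 ≤ if u x < 0 then G ‖weakGradient Ω u x‖ + h x * u x else 0 := by
    filter_upwards [hh0] with x hx
    split_ifs with hux
    · exact add_nonneg (hG.nonneg (norm_nonneg _)) (mul_nonneg_of_nonpos_of_nonpos hx hux.le)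
    · exact le_rfl
  have hint : Integrable (fun x => if u x < 0 then G ‖weakGradient Ω u x‖ + h x * u x else 0)
      (volume.restrict Ω) := (hiu.sub hiv).congr hdiff
  have hzero : (fun x => if u x < 0 then G ‖weakGradient Ω u x‖ + h x * u x else 0)
      =ᵐ[volume.restrict Ω] 0 := by
    rw [← integral_eq_zero_iff_of_nonneg_ae hnonneg hint]
    refine le_antisymm ?_ (integral_nonneg_of_ae hnonneg)
    rw [← integral_congr_ae hdiff, integral_sub hiu hiv]
    exact sub_nonpos.2 hJ
  -- Two non-negative terms with zero sum both vanish, and `G` vanishes only at `0`, so the gradient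
  -- is zero on `{u < 0}`.
  have hW0 : W =ᵐ[volume] 0 := by
    have h1 : ∀ᵐ x ∂(volume.restrict Ω), negPartDeriv (u x) • weakGradient Ω u x = 0 := by
      filter_upwards [hzero, hh0] with x hx hhx
      by_cases hux : u x < 0
      · simp only [hux, if_true, Pi.zero_apply] at hx
        have h2 := hG.nonneg (norm_nonneg (weakGradient Ω u x))
        have h3 := mul_nonneg_of_nonpos_of_nonpos hhx hux.le
        have h4 := hG.eq_zero (norm_nonneg _) (le_antisymm (by linarith) h2)
        rw [norm_eq_zero.1 h4, smul_zero]
      · simp [negPartDeriv, hux]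
    filter_upwards [(ae_restrict_iff' hmeas).1 h1] with x hx
    by_cases hxΩ : x ∈ Ω
    · rw [hW, Set.indicator_of_mem hxΩ, hx hxΩ]; rfl
    · rw [hW, Set.indicator_of_notMem hxΩ]; rfl
  have hU0 : U =ᵐ[volume] 0 := by
    refine ae_eq_zero_of_hasWeakGradient_zero hglob.1
      (hglob.3.congr (ae_eq_refl _) (by rwa [Measure.restrict_univ]))
      hΩ.isBounded.isCompact_closure fun x hx =>
      subset_closure (Set.mem_of_indicator_ne_zero hx)
  filter_upwards [ae_restrict_of_ae hU0, ae_restrict_mem hmeas] with x hx hxΩ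
  rw [hU, Set.indicator_of_mem hxΩ] at hx
  have : -u x ≤ 0 := (le_max_left _ _).trans hx.le
  linarith

end

end OrliczFreeBoundary

end

/-! ### The theorem for the primitive of `g` -/

theorem corollary3p4 (N : ℕ) (hN : 2 < N) (Ω : Set (EuclideanSpace ℝ (Fin N)))
    (hΩ : OrliczFreeBoundary.IsSmoothBoundedDomain Ω)
    (g F : ℝ → ℝ) (δ₀ g₀ θ₀ f₀ : ℝ)
    (hδ₀ : 0 < δ₀) (hδ₀N : 1 + δ₀ < N)
    (hg : OrliczFreeBoundary.LiebermanCondition g δ₀ g₀)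
    (hθ₀ : 0 < 1 + θ₀) (hθf : 1 + θ₀ ≤ 1 + f₀)
    (hf₀ : 1 + f₀ ≤ (N : ℝ) * (1 + δ₀) / ((N : ℝ) - (1 + δ₀)))
    (hF : OrliczFreeBoundary.LiebermanCondition F (1 + θ₀) (1 + f₀))
    (q h φ : EuclideanSpace ℝ (Fin N) → ℝ) (lam : ℝ) (hlam : 0 ≤ lam)
    (hq : MemLp q ∞ (volume.restrict Ω)) (hq0 : ¬ q =ᵐ[volume.restrict Ω] 0)
    (hh : MemLp h ∞ (volume.restrict Ω)) (hh0 : ∀ᵐ x ∂(volume.restrict Ω), h x ≤ 0)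
    (hφ : φ ∈ OrliczFreeBoundary.orliczSobolev (OrliczFreeBoundary.primitive g) Ω)
    (hφ_bdd : MemLp φ ∞ (volume.restrict Ω))
    (hφ_nonneg : OrliczFreeBoundary.NonnegOnBoundary Ω φ)
    (u : EuclideanSpace ℝ (Fin N) → ℝ)
    (hu : OrliczFreeBoundary.IsMinimizer Ω (OrliczFreeBoundary.primitive g) F q h lam φ u) :
    ∀ᵐ x ∂(volume.restrict Ω), 0 ≤ u x := by
  -- Successor form is what allows one coordinate to be split off in the boundary estimate; the
  -- gauge exponents below are `1 + δ₀` and `1 + g₀`.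
  obtain ⟨m, rfl⟩ : ∃ m, N = m + 1 := ⟨N - 1, by omega⟩
  exact (hg.isGauge_primitive hδ₀.le).ae_nonneg_of_isMinimizer hΩ hδ₀N hF hθ₀.le hf₀ hq hh hh0
    hφ_bdd hφ_nonneg hu
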